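/- Let $n\ge 1$ and let $\mathbb{S}^n\subseteq\mathbb{R}^{n+1}$ be the unit sphere with its Riemannian volume $dq$, $V_n=\mathrm{vol}(\mathbb{S}^n)$, Riemannian distance $d_R(p,q)=\arccos\langle p,q\rangle$, and Laplace--Beltrami operator $\Delta=-\mathrm{div}\,\nabla$. Let $G(\mathbb{S}^n;\cdot,\cdot)$ be the Green function of $\mathbb{S}^n$, i.e. the unique real function on pairs of distinct points of $\mathbb{S}^n$ that is symmetric and such that, for every $p$, the function $G(\mathbb{S}^n;p,\cdot)$ is continuous on $\mathbb{S}^n\setminus\{p\}$, integrable, of mean zero, and satisfies $\Delta_q G(\mathbb{S}^n;p,q)=\delta_p(q)-V_n^{-1}$ in the sense of distributions. For $p_0\in\mathbb{S}^n$ and $a>0$ let $B(p_0,a)=\{q\in\mathbb{S}^n: d_R(p_0,q)<a\}$ and let $|B_a|$ be its volume. For $0<a\le\pi$ put $$K(\mathbb{S}^n,a)=\frac{2}{nV_n}\sum_{k=0}^{\infty}\frac{(n)_k}{\left(\frac n2+1\right)_k(k+1)}\,\frac{B_{\sin^2\frac a2}\left(\frac n2+k+1,\frac n2\right)}{B_{\sin^2\frac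 a2}\left(\frac n2,\frac n2\right)},$$ where $(x)_k=x(x+1)\cdots(x+k-1)$ and $B_x(\alpha,\beta)=\int_0^x t^{\alpha-1}(1-t)^{\beta-1}\,dt$. Then for all $p,p_0\in\mathbb{S}^n$ and all $0<a\le\pi$ the function $G(\mathbb{S}^n;p,\cdot)$ is integrable on $B(p_0,a)$, and if $p\ne p_0$, then $$\frac{1}{|B_a|}\int_{q\in B(p_0,a)}G(\mathbb{S}^n;p,q)\,dq\;\le\; G(\mathbb{S}^n;p,p_0)+K(\mathbb{S}^n,a).$$ Moreover, equality holds whenever $p\notin B(p_0,a)$. -/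

import Mathlib

open MeasureTheory Metric
open scoped Manifold ContDiff

noncomputable section

/-- The unit sphere `𝕊ⁿ ⊆ ℝⁿ⁺¹`, with the manifold structure that Mathlib gives it. -/
abbrev UnitSphere (n : ℕ) : Type :=
  sphere (0 : EuclideanSpace ℝ (Fin (n + 1))) 1

/-- The surface measure (Riemannian volume) of `𝕊ⁿ`. -/
def sphereMeasure (n : ℕ) : Measure (UnitSphere n) :=
  (volume : Measure (EuclideanSpace ℝ (Fin (n + 1)))).toSphere

/-- `V_n = vol(𝕊ⁿ)`. -/
def sphereVol (n : ℕ) : ℝ := (sphereMeasure n).real Set.univ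

/-- The Riemannian distance `arccos ⟨p, q⟩` of `𝕊ⁿ`. -/
def sphereDist {n : ℕ} (p q : UnitSphere n) : ℝ :=
  Real.arccos (inner ℝ (p : EuclideanSpace ℝ (Fin (n + 1))) (q : EuclideanSpace ℝ (Fin (n + 1))))

/-- The open geodesic ball `B(p₀, a)`. -/
def geodesicBall {n : ℕ} (p₀ : UnitSphere n) (a : ℝ) : Set (UnitSphere n) :=
  {q | sphereDist p₀ q < a}

/-- The extension `x ↦ f (x / ‖x‖)` of a function on the sphere to a function on `ℝⁿ⁺¹ ∖ {0}` that
is constant along rays (with value `0` at the origin). -/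
def radialExtension {n : ℕ} (f : UnitSphere n → ℝ) (x : EuclideanSpace ℝ (Fin (n + 1))) : ℝ :=
  open Classical in
  if h : x = 0 then 0 else f ⟨‖x‖⁻¹ • x, by simp [norm_smul, h]⟩

/-- The Laplace–Beltrami operator `Δ = - div ∇` of `𝕊ⁿ` (the nonnegative one), on smooth functions.

On the sphere, the Euclidean gradient of the extension `F` of `f` that is constant along rays is the
Riemannian gradient of `f`; as `∇F` is homogeneous of degree `-1` and tangential, its Euclidean
divergence on the sphere is the divergence of the tangent field `∇f`. So `div ∇ f = Δ_{ℝⁿ⁺¹} F`. -/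
def sphereLaplacian {n : ℕ} (f : UnitSphere n → ℝ) (p : UnitSphere n) : ℝ :=
  - Laplacian.laplacian (radialExtension f) (p : EuclideanSpace ℝ (Fin (n + 1)))

/-- The defining properties of the Green function `G(𝕊ⁿ; p, q)`, a function of pairs of distinct
points; its values on the diagonal are irrelevant here. -/
structure IsGreenFunction (n : ℕ) (G : UnitSphere n → UnitSphere n → ℝ) : Prop where
  /-- `G(p, ·)` is a genuine continuous function off `p` … -/
  continuousOn : ∀ p, ContinuousOn (G p) {p}ᶜ
  /-- … and is integrable, so that it defines a distribution on `𝕊ⁿ`. -/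
  integrable : ∀ p, Integrable (G p) (sphereMeasure n)
  /-- `Δ_q G(p, ·) = δ_p - vol(𝕊ⁿ)⁻¹` in the sense of distributions. -/
  laplacian : ∀ p, ∀ φ : UnitSphere n → ℝ, ContMDiff (𝓡 n) 𝓘(ℝ, ℝ) ∞ φ →
    ∫ q, G p q * sphereLaplacian φ q ∂(sphereMeasure n) =
      φ p - (sphereVol n)⁻¹ * ∫ q, φ q ∂(sphereMeasure n)
  /-- `G` is symmetric. -/
  symm : ∀ p q, p ≠ q → G p q = G q p
  /-- `G(p, ·)` has mean zero. -/
  mean_zero : ∀ p, ∫ q, G p q ∂(sphereMeasure n) = 0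

/-- The Green function of `𝕊ⁿ`: the function with the properties `IsGreenFunction`
(which determine it off the diagonal). -/
def greenFunction (n : ℕ) : UnitSphere n → UnitSphere n → ℝ :=
  Classical.epsilon (IsGreenFunction n)

/-- The incomplete beta function `B_x(α, β) = ∫₀ˣ t^(α-1) (1-t)^(β-1) dt`. -/
def incompleteBeta (x α β : ℝ) : ℝ :=
  ∫ t in (0 : ℝ)..x, t ^ (α - 1) * (1 - t) ^ (β - 1)

/-- The Pochhammer symbol `(x)_k = x (x + 1) ⋯ (x + k - 1)`. -/
def pochhammerSymbol (x : ℝ) (k : ℕ) : ℝ := (ascPochhammer ℝ k).eval x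

/-- The constant `K(𝕊ⁿ, a)`, for `0 < a ≤ π`. -/
def greenK (n : ℕ) (a : ℝ) : ℝ :=
  2 / (n * sphereVol n) * ∑' k : ℕ,
    pochhammerSymbol n k / (pochhammerSymbol (n / 2 + 1) k * (k + 1)) *
      (incompleteBeta (Real.sin (a / 2) ^ 2) (n / 2 + k + 1) (n / 2) /
        incompleteBeta (Real.sin (a / 2) ^ 2) (n / 2) (n / 2))

end

/-! Write `capVol n θ` for `∫₀^θ sin^(n-1)`, proportional to the volume of a cap, and `capPot n` for
the primitive of `capVol n / sin^(n-1)` that vanishes at `0`. The flux of the Green field of `p`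
through the geodesic sphere of radius `s` is the uniform mass outside it, so up to a constant the
Green function at distance `θ` is `capPot n (π - θ) / V_n`.

The theorem then follows from a spherical version of Newton's shell theorem. If `p` lies at distance
`θ` from `p₀`, the mean of this kernel over the geodesic sphere of radius `s` about `p₀` is `V_n⁻¹ *
shellKernel n θ s`. For `s ≤ θ` the shell kernel is `capPot n (π - θ) + capPot n s`: the value at
the centre plus a term that does not involve `p`. For `s ≥ θ` it is `capPot n (π - s) + capPot n θ`,
which is no larger because `capPot n` is increasing. Integrating over `s < a` gives the inequality,
with equality when `a ≤ θ`; the correction is the mean of `capPot n / V_n` over the ball, and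
expanding `capPot n` in powers of `sin²(s/2)` identifies it with `K(𝕊ⁿ, a)` (`greenK_eq`).

All the analysis is reduced to polynomials in `⟨p, q⟩`. On these the Laplacian acts as the ordinary
differential operator `zonalOp`, it is symmetric against smooth functions
(`integral_eval_mul_sphereLaplacian`), and its range is everything modulo constants
(`exists_zonalOp_eq_sub_C`). Hence the volume density in the distance from a point
(`map_sphereDist`), the uniqueness of the Green function (`eq_zero_of_weakly_harmonic`), its
existence (`exists_zonal_approximation`) and the shell theorem (`integral_eval_mul_zonalKernel`).
Moments then carry the shell theorem from polynomials to indicator functions of balls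
(`setIntegral_geodesicBall_zonalKernel`). -/

noncomputable section

/-! ### Euclidean Laplacians of scaled and zonal functions. -/

section Laplacian
open Laplacian InnerProductSpace

variable {E : Type*} [NormedAddCommGroup E] [InnerProductSpace ℝ E] [FiniteDimensional ℝ E]

theorem laplacian_comp_smul (f : E → ℝ) (c : ℝ) (x : E) :
    Δ (fun y => f (c • y)) x = c ^ 2 * Δ f (c • x) := by
  have h1 : fderiv ℝ (fun y => f (c • y)) = fun y => c • fderiv ℝ f (c • y) := by
    funext y; rw [fderiv_comp_smul]
  simp only [laplacian_eq_iteratedFDeriv_stdOrthonormalBasis, iteratedFDeriv_two_apply, h1,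
    Finset.mul_sum]
  refine Finset.sum_congr rfl fun i _ => ?_
  have h2 : fderiv ℝ (fun y => c • fderiv ℝ f (c • y)) x = c • c • fderiv ℝ (fderiv ℝ f) (c • x) := by
    rw [← fderiv_comp_smul]
    exact congrFun (fderiv_const_smul_field (𝕜 := ℝ) (f := fun y => fderiv ℝ f (c • y)) c) x
  rw [h2]
  simp [pow_two, mul_assoc]

/-- The Laplacian of a function with a prescribed second derivative along each line. -/
theorem laplacian_eq_of_hasDerivAt {ι : Type*} [Fintype ι] (b : OrthonormalBasis ι ℝ E)
    {f : E → ℝ} {x : E} (hf : ContDiffAt ℝ 2 f x) {L : ι → ℝ}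
    (h : ∀ i, HasDerivAt (fun τ : ℝ => fderiv ℝ f (x + τ • b i) (b i)) (L i) 0) :
    Δ f x = ∑ i, L i := by
  simp only [laplacian_eq_iteratedFDeriv_orthonormalBasis f b, iteratedFDeriv_two_apply]
  refine Finset.sum_congr rfl fun i _ => ?_
  have h1 : DifferentiableAt ℝ (fderiv ℝ f) x :=
    (hf.fderiv_right (m := 1) one_add_one_eq_two.le).differentiableAt one_ne_zero
  have h2 : HasDerivAt (fun τ : ℝ => x + τ • b i) (b i) 0 := by
    simpa using ((hasDerivAt_id (0 : ℝ)).smul_const (b i)).const_add x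
  have h3 : HasFDerivAt (fun y => fderiv ℝ f y (b i)) ((fderiv ℝ (fderiv ℝ f) x).flip (b i))
      (x + (0 : ℝ) • b i) := by
    rw [zero_smul, add_zero]
    simpa using h1.hasFDerivAt.clm_apply (hasFDerivAt_const (b i) x)
  have h4 : HasDerivAt (fun τ : ℝ => fderiv ℝ f (x + τ • b i) (b i))
      ((fderiv ℝ (fderiv ℝ f) x).flip (b i) (b i)) 0 := by
    have := HasFDerivAt.comp_hasDerivAt (l := fun y => fderiv ℝ f y (b i))
      (f := fun τ : ℝ => x + τ • b i) (0 : ℝ) h3 h2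
    exact this
  exact h4.unique (h i)

/-- Serves twice: with `α` a cutoff, to integrate by parts, and with `α s = s ^ (-k/2)`, to compute
the spherical Laplacian of `⟨p, ·⟩ ^ k`. The truncated exponent `k - 1 - 1` is harmless, since its
coefficient vanishes for `k ≤ 1`. -/
theorem laplacian_zonal (p : E) (α : ℝ → ℝ) (k : ℕ) (x : E) (hα : ContDiffAt ℝ 2 α (‖x‖ ^ 2)) :
    Δ (fun y : E => α (‖y‖ ^ 2) * inner ℝ p y ^ k) x =
      inner ℝ p x ^ k * (4 * ‖x‖ ^ 2 * deriv (deriv α) (‖x‖ ^ 2) +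
        (2 * Module.finrank ℝ E + 4 * k) * deriv α (‖x‖ ^ 2)) +
      k * ((k - 1 : ℕ) : ℝ) * ‖p‖ ^ 2 * inner ℝ p x ^ (k - 1 - 1) * α (‖x‖ ^ 2) := by
  set b := stdOrthonormalBasis ℝ E
  have hF : ContDiffAt ℝ 2 (fun y : E => α (‖y‖ ^ 2) * inner ℝ p y ^ k) x := by
    refine ContDiffAt.mul (hα.comp x ?_) ?_
    · exact (contDiff_norm_sq ℝ).contDiffAt
    · exact ((contDiff_const.inner ℝ contDiff_id).pow k).contDiffAt
  have hev : ∀ᶠ y in nhds x, ContDiffAt ℝ 2 α (‖y‖ ^ 2) :=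
    (by fun_prop : Continuous fun y : E => ‖y‖ ^ 2).continuousAt.eventually
      (hα.eventually (by simp))
  have hfd : ∀ v : E, ∀ y : E, ContDiffAt ℝ 2 α (‖y‖ ^ 2) →
      fderiv ℝ (fun y : E => α (‖y‖ ^ 2) * inner ℝ p y ^ k) y v =
        2 * inner ℝ y v * deriv α (‖y‖ ^ 2) * inner ℝ p y ^ k +
          α (‖y‖ ^ 2) * (k * inner ℝ p y ^ (k - 1) * inner ℝ p v) := by
    intro v y hy
    have e1 : HasDerivAt α (deriv α (‖y‖ ^ 2)) (‖y‖ ^ 2) :=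
      (hy.differentiableAt (by norm_num)).hasDerivAt
    have e2 := e1.comp_hasFDerivAt y (hasStrictFDerivAt_norm_sq y).hasFDerivAt
    have e3 : HasFDerivAt (fun y : E => inner ℝ p y) (innerSL ℝ p) y :=
      (innerSL ℝ p).hasFDerivAt
    have e4 := e2.mul (e3.pow k)
    have e5 : fderiv ℝ (fun y : E => α (‖y‖ ^ 2) * inner ℝ p y ^ k) y = _ := e4.fderiv
    rw [e5]
    simp [innerSL_apply_apply]
    ring
  have hsum : ∀ y z : E, ∑ i, inner ℝ y (b i) * inner ℝ z (b i) = inner ℝ y z := by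
    intro y z
    rw [← b.sum_inner_mul_inner y z]
    simp_rw [real_inner_comm z]
  -- The second derivative along `b i`; summing over `i`, Parseval (`hsum`) turns the products of
  -- coordinates into `⟨x, x⟩`, `⟨x, p⟩` and `⟨p, p⟩`.
  rw [laplacian_eq_of_hasDerivAt b hF (L := fun i =>
    2 * deriv α (‖x‖ ^ 2) * inner ℝ p x ^ k
     + 4 * (inner ℝ x (b i) * inner ℝ x (b i)) * deriv (deriv α) (‖x‖ ^ 2) * inner ℝ p x ^ k
     + 4 * (inner ℝ x (b i) * inner ℝ p (b i)) * deriv α (‖x‖ ^ 2) * (k * inner ℝ p x ^ (k - 1))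
     + α (‖x‖ ^ 2) * (k * ((k - 1 : ℕ) * inner ℝ p x ^ (k - 1 - 1))) *
      (inner ℝ p (b i) * inner ℝ p (b i)))]
  · simp only [Finset.sum_add_distrib, ← Finset.mul_sum, ← Finset.sum_mul, hsum]
    simp only [Finset.sum_const, Finset.card_univ, Fintype.card_fin, nsmul_eq_mul,
      real_inner_self_eq_norm_sq, real_inner_comm p x]
    rcases k with _ | k
    · simp; ring
    · simp [pow_succ]; ring
  · intro i
    have hn : ‖b i‖ = 1 := b.orthonormal.1 i
    have hin : inner ℝ (b i) (b i) = (1 : ℝ) := by rw [real_inner_self_eq_norm_sq, hn]; norm_num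
    have h2 : HasDerivAt (fun τ : ℝ => x + τ • b i) (b i) 0 := by
      simpa using ((hasDerivAt_id (0 : ℝ)).smul_const (b i)).const_add x
    have hev2 : ∀ᶠ τ in nhds (0 : ℝ), ContDiffAt ℝ 2 α (‖x + τ • b i‖ ^ 2) := by
      have := h2.continuousAt.tendsto
      simp only [zero_smul, add_zero] at this
      exact this.eventually hev
    have s1 : HasDerivAt (fun τ : ℝ => ‖x + τ • b i‖ ^ 2) (2 * inner ℝ x (b i)) 0 := by
      simpa using h2.norm_sq
    have s2 : HasDerivAt (fun τ : ℝ => inner ℝ (x + τ • b i) (b i)) 1 0 := by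
      simpa [hin] using h2.inner ℝ (hasDerivAt_const (0 : ℝ) (b i))
    have s3 : HasDerivAt (fun τ : ℝ => inner ℝ p (x + τ • b i)) (inner ℝ p (b i)) 0 := by
      simpa using (hasDerivAt_const (0 : ℝ) p).inner ℝ h2
    have a0 : HasDerivAt α (deriv α (‖x‖ ^ 2)) (‖x + (0 : ℝ) • b i‖ ^ 2) := by
      simpa using (hα.differentiableAt (by norm_num)).hasDerivAt
    have a1 : HasDerivAt (deriv α) (deriv (deriv α) (‖x‖ ^ 2)) (‖x + (0 : ℝ) • b i‖ ^ 2) := by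
      have h3 : DifferentiableAt ℝ (fderiv ℝ α) (‖x‖ ^ 2) :=
        (hα.fderiv_right (m := 1) one_add_one_eq_two.le).differentiableAt one_ne_zero
      have h4 : DifferentiableAt ℝ (deriv α) (‖x‖ ^ 2) :=
        h3.clm_apply (differentiableAt_const (1 : ℝ))
      simpa using h4.hasDerivAt
    have a0' := a0.comp (0 : ℝ) s1
    have a1' := a1.comp (0 : ℝ) s1
    have key := ((((s2.const_mul 2).mul a1').mul (s3.pow k))).add
      (a0'.mul ((((s3.pow (k - 1)).const_mul (k : ℝ))).mul_const (inner ℝ p (b i))))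
    refine (key.congr_of_eventuallyEq ?_).congr_deriv ?_
    · filter_upwards [hev2] with τ hτ
      rw [hfd _ _ hτ]
      simp [Function.comp_def]
    · simp [Function.comp_def]
      ring
end Laplacian

theorem two_le_infty : (2 : ℕ∞ω) ≤ ∞ := WithTop.coe_le_coe.2 (le_top : (2 : ℕ∞) ≤ ⊤)

/-! ### Smoothness and homogeneity of the extension constant along rays. -/

section RadialExtension
open Laplacian InnerProductSpace

variable {n : ℕ}

/-- The radial projection of a nonzero vector to the sphere. -/
def sphereProj (x : EuclideanSpace ℝ (Fin (n + 1))) (h : x ≠ 0) : UnitSphere n :=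
  ⟨‖x‖⁻¹ • x, by simp [norm_smul, h]⟩

theorem radialExtension_of_ne (f : UnitSphere n → ℝ) {x : EuclideanSpace ℝ (Fin (n + 1))}
    (h : x ≠ 0) : radialExtension f x = f (sphereProj x h) := by
  rw [radialExtension, dif_neg h, sphereProj]

theorem UnitSphere.norm_coe (q : UnitSphere n) : ‖(q : EuclideanSpace ℝ (Fin (n + 1)))‖ = 1 := by
  simp

theorem UnitSphere.coe_ne_zero (q : UnitSphere n) : (q : EuclideanSpace ℝ (Fin (n + 1))) ≠ 0 := by
  rw [← norm_pos_iff, q.norm_coe]; norm_num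

theorem sphereProj_smul (q : UnitSphere n) {r : ℝ} (hr : 0 < r)
    (h : r • (q : EuclideanSpace ℝ (Fin (n + 1))) ≠ 0) : sphereProj _ h = q := by
  apply Subtype.ext
  simp only [sphereProj, norm_smul, q.norm_coe, mul_one, Real.norm_eq_abs, abs_of_pos hr, smul_smul]
  rw [inv_mul_cancel₀ hr.ne', one_smul]

theorem radialExtension_smul_coe (f : UnitSphere n → ℝ) (q : UnitSphere n) {r : ℝ} (hr : 0 < r) :
    radialExtension f (r • (q : EuclideanSpace ℝ (Fin (n + 1)))) = f q := by
  have h : r • (q : EuclideanSpace ℝ (Fin (n + 1))) ≠ 0 := smul_ne_zero hr.ne' q.coe_ne_zero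
  rw [radialExtension_of_ne f h, sphereProj_smul q hr h]

theorem radialExtension_smul (f : UnitSphere n → ℝ) {r : ℝ} (hr : 0 < r)
    (x : EuclideanSpace ℝ (Fin (n + 1))) :
    radialExtension f (r • x) = radialExtension f x := by
  rcases eq_or_ne x 0 with rfl | hx
  · simp
  · have h : r • x ≠ 0 := smul_ne_zero hr.ne' hx
    rw [radialExtension_of_ne f h, radialExtension_of_ne f hx]
    congr 1
    apply Subtype.ext
    simp only [sphereProj, norm_smul, Real.norm_eq_abs, abs_of_pos hr, smul_smul]
    congr 1
    field_simp

theorem laplacian_radialExtension_smul (f : UnitSphere n → ℝ) (q : UnitSphere n) {r : ℝ}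
    (hr : 0 < r) :
    Δ (radialExtension f) (r • (q : EuclideanSpace ℝ (Fin (n + 1)))) =
      - (r ^ 2)⁻¹ * sphereLaplacian f q := by
  have h := laplacian_comp_smul (radialExtension f) r (q : EuclideanSpace ℝ (Fin (n + 1)))
  simp only [radialExtension_smul f hr] at h
  rw [sphereLaplacian, h]
  field_simp

/-- On the open submanifold `{0}ᶜ` the extension is `f` composed with `x ↦ x / ‖x‖`, which is smooth
as a map into the sphere. -/
theorem contDiffAt_radialExtension {f : UnitSphere n → ℝ} (hf : ContMDiff (𝓡 n) 𝓘(ℝ, ℝ) ∞ f)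
    {x : EuclideanSpace ℝ (Fin (n + 1))} (hx : x ≠ 0) :
    ContDiffAt ℝ ∞ (radialExtension f) x := by
  have : Fact (Module.finrank ℝ (EuclideanSpace ℝ (Fin (n + 1))) = n + 1) :=
    ⟨finrank_euclideanSpace_fin⟩
  let U : TopologicalSpace.Opens (EuclideanSpace ℝ (Fin (n + 1))) := ⟨{0}ᶜ, isOpen_compl_singleton⟩
  have h1 : ContMDiff 𝓘(ℝ, EuclideanSpace ℝ (Fin (n + 1))) 𝓘(ℝ, EuclideanSpace ℝ (Fin (n + 1))) ∞
      (fun y : U => ‖(y : EuclideanSpace ℝ (Fin (n + 1)))‖⁻¹ • (y : EuclideanSpace ℝ (Fin (n + 1)))) := by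
    intro y
    refine (contMDiffAt_subtype_iff (f := fun y : EuclideanSpace ℝ (Fin (n + 1)) => ‖y‖⁻¹ • y)).2 ?_
    apply ContDiffAt.contMDiffAt
    have hy : (y : EuclideanSpace ℝ (Fin (n + 1))) ≠ 0 := y.2
    exact ((contDiffAt_norm ℝ hy).inv (norm_ne_zero_iff.2 hy)).smul contDiffAt_id
  have h2 : ∀ y : U, ‖(y : EuclideanSpace ℝ (Fin (n + 1)))‖⁻¹ • (y : EuclideanSpace ℝ (Fin (n + 1)))
      ∈ sphere (0 : EuclideanSpace ℝ (Fin (n + 1))) 1 := by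
    intro y
    have hy : (y : EuclideanSpace ℝ (Fin (n + 1))) ≠ 0 := y.2
    simp [norm_smul, hy]
  have h3 := hf.comp (ContMDiff.codRestrict_sphere (n := n) h1 h2)
  have h4 : ContMDiffAt 𝓘(ℝ, EuclideanSpace ℝ (Fin (n + 1))) 𝓘(ℝ, ℝ) ∞ (radialExtension f)
      ((⟨x, hx⟩ : U) : EuclideanSpace ℝ (Fin (n + 1))) := by
    rw [← contMDiffAt_subtype_iff]
    convert h3 ⟨x, hx⟩ using 1
    funext y
    have hy : (y : EuclideanSpace ℝ (Fin (n + 1))) ≠ 0 := y.2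
    rw [radialExtension_of_ne f hy]
    rfl
  exact h4.contDiffAt

theorem continuousOn_laplacian_radialExtension {f : UnitSphere n → ℝ}
    (hf : ContMDiff (𝓡 n) 𝓘(ℝ, ℝ) ∞ f) :
    ContinuousOn (Δ (radialExtension f)) {0}ᶜ := by
  intro x hx
  apply ContinuousAt.continuousWithinAt
  have h1 : ContDiffAt ℝ 2 (radialExtension f) x :=
    (contDiffAt_radialExtension hf hx).of_le two_le_infty
  have h2 : ContDiffAt ℝ 1 (fderiv ℝ (radialExtension f)) x :=
    h1.fderiv_right one_add_one_eq_two.le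
  have h3 : ContinuousAt (fderiv ℝ (fderiv ℝ (radialExtension f))) x :=
    h2.continuousAt_fderiv one_ne_zero
  simp only [laplacian_eq_iteratedFDeriv_stdOrthonormalBasis, iteratedFDeriv_two_apply]
  refine tendsto_finsetSum _ fun i _ => ?_
  exact (h3.clm_apply continuousAt_const).clm_apply continuousAt_const

theorem continuous_sphereLaplacian {f : UnitSphere n → ℝ} (hf : ContMDiff (𝓡 n) 𝓘(ℝ, ℝ) ∞ f) :
    Continuous (sphereLaplacian f) := by
  refine Continuous.neg ?_
  exact (continuousOn_laplacian_radialExtension hf).comp_continuous continuous_subtype_val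
    fun q => q.coe_ne_zero

end RadialExtension

/-! ### Polar coordinates. -/

section Polar
variable {n : ℕ}

instance : IsFiniteMeasure (sphereMeasure n) := by unfold sphereMeasure; infer_instance
instance : (sphereMeasure n).IsOpenPosMeasure := by unfold sphereMeasure; infer_instance

theorem integral_eq_sphere_mul_Ioi {f : EuclideanSpace ℝ (Fin (n + 1)) → ℝ} {u : UnitSphere n → ℝ}
    {v : ℝ → ℝ} (h : ∀ (q : UnitSphere n) (r : ℝ), 0 < r →
      f (r • (q : EuclideanSpace ℝ (Fin (n + 1)))) = u q * v r) :
    ∫ x, f x = (∫ q, u q ∂(sphereMeasure n)) * ∫ r in Set.Ioi (0 : ℝ), r ^ n * v r := by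
  have hdim : Module.finrank ℝ (EuclideanSpace ℝ (Fin (n + 1))) - 1 = n := by simp
  have hmp := (volume : Measure (EuclideanSpace ℝ (Fin (n + 1)))).measurePreserving_homeomorphUnitSphereProd
  rw [hdim] at hmp
  calc
    ∫ x, f x = ∫ x : ({(0)}ᶜ : Set (EuclideanSpace ℝ (Fin (n + 1)))), f x.1
        ∂(volume.comap Subtype.val) := by
      rw [integral_subtype_comap (measurableSet_singleton _).compl f, restrict_compl_singleton]
    _ = ∫ z : UnitSphere n × Set.Ioi (0 : ℝ), u z.1 * v z.2.1
          ∂((sphereMeasure n).prod (.volumeIoiPow n)) := by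
      rw [sphereMeasure, ← hmp.integral_comp (Homeomorph.measurableEmbedding _)]
      congr 1
      funext x
      have hx : (x : EuclideanSpace ℝ (Fin (n + 1))) ≠ 0 := x.2
      rw [← h _ _ (Set.mem_Ioi.1 ((homeomorphUnitSphereProd _ x).2.2))]
      congr 1
      simp [smul_smul, hx]
    _ = (∫ q, u q ∂(sphereMeasure n)) * ∫ r : Set.Ioi (0 : ℝ), v r.1 ∂(.volumeIoiPow n) :=
      integral_prod_mul u fun r : Set.Ioi (0 : ℝ) => v r.1
    _ = _ := by
      congr 1
      simp only [Measure.volumeIoiPow, ENNReal.ofReal]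
      rw [integral_withDensity_eq_integral_smul,
        integral_subtype_comap measurableSet_Ioi fun a ↦ Real.toNNReal (a ^ n) • v a,
        setIntegral_congr_fun measurableSet_Ioi fun x hx ↦ ?_]
      · simp only [NNReal.smul_def, Real.coe_toNNReal _ (pow_nonneg (Set.mem_Ioi.1 hx).le _), smul_eq_mul]
      · exact (measurable_subtype_coe.pow_const _).real_toNNReal


end Polar

/-! ### Green's identity on the sphere, deduced from the Euclidean one. -/

section SelfAdjoint
open Laplacian InnerProductSpace

theorem integral_Ioi_radial_by_parts {α : ℝ → ℝ} (hα : ContDiff ℝ ∞ α)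
    (h0 : ∀ s, 2 ≤ s → α s = 0) (m k : ℕ) :
    ∫ r in Set.Ioi (0 : ℝ), (2 * (m + k + 2) * r ^ (m + k + 1) * deriv α (r ^ 2) +
        4 * r ^ (m + k + 3) * deriv (deriv α) (r ^ 2) +
        k * ((m + k : ℕ) * r ^ (m + k - 1)) * α (r ^ 2) +
        2 * k * r ^ (m + k + 1) * deriv α (r ^ 2)) = - (k * 0 ^ (m + k) * α 0) := by
  have h1 : ContDiff ℝ ∞ (deriv α) := (contDiff_infty_iff_deriv.1 hα).2
  have h2 : ∀ s, 2 ≤ s → deriv α s = 0 := by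
    have hev : ∀ s, 2 < s → deriv α s = 0 := by
      intro s hs
      have : α =ᶠ[nhds s] fun _ => 0 := by
        filter_upwards [lt_mem_nhds hs] with t ht using h0 t ht.le
      rw [this.deriv_eq, deriv_const]
    intro s hs
    rcases hs.eq_or_lt with rfl | hs
    · have hc := h1.continuous.continuousWithinAt (s := Set.Ioi 2) (x := (2 : ℝ))
      have hc2 : Filter.Tendsto (deriv α) (nhdsWithin 2 (Set.Ioi 2)) (nhds 0) :=
        tendsto_const_nhds.congr' (by filter_upwards [self_mem_nhdsWithin] with t ht
                                      exact (hev t ht).symm)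
      exact tendsto_nhds_unique hc hc2
    · exact hev s hs
  -- With `n = m + 1` and `g r = r ^ k * α (r ^ 2)`, this is `r ^ n * g' r`; the integrand is its
  -- derivative, so only the boundary term at `0` survives.
  set Ψ : ℝ → ℝ := fun r => 2 * r ^ (m + k + 2) * deriv α (r ^ 2) + k * r ^ (m + k) * α (r ^ 2)
  have hΨ : ContDiff ℝ 1 Ψ := by
    have a1 : ContDiff ℝ 1 α := hα.of_le (by exact_mod_cast le_top)
    have a2 : ContDiff ℝ 1 (deriv α) := h1.of_le (by exact_mod_cast le_top)
    have a3 : ContDiff ℝ 1 fun r : ℝ => r ^ 2 := by fun_prop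
    exact ((contDiff_const.mul (contDiff_id.pow _)).mul (a2.comp a3)).add
      ((contDiff_const.mul (contDiff_id.pow _)).mul (a1.comp a3))
  have hc : HasCompactSupport Ψ := by
    refine HasCompactSupport.of_support_subset_isCompact (isCompact_Icc (a := (-2 : ℝ)) (b := 2)) ?_
    intro r hr
    by_contra hr2
    apply hr
    have : 2 ≤ r ^ 2 := by
      simp only [Set.mem_Icc, not_and_or, not_le] at hr2
      rcases hr2 with h | h <;> nlinarith
    simp [Ψ, h0 _ this, h2 _ this]
  have h3 := hc.integral_Ioi_deriv_eq hΨ 0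
  have h4 : ∀ r, deriv Ψ r = 2 * (m + k + 2) * r ^ (m + k + 1) * deriv α (r ^ 2) +
        4 * r ^ (m + k + 3) * deriv (deriv α) (r ^ 2) +
        k * ((m + k : ℕ) * r ^ (m + k - 1)) * α (r ^ 2) +
        2 * k * r ^ (m + k + 1) * deriv α (r ^ 2) := by
    intro r
    have b0 : HasDerivAt (fun r : ℝ => r ^ 2) (2 * r) r := by simpa using hasDerivAt_pow 2 r
    have b1 := (((contDiff_infty_iff_deriv.1 hα).1 (r ^ 2)).hasDerivAt).comp r b0
    have b2 := (((contDiff_infty_iff_deriv.1 h1).1 (r ^ 2)).hasDerivAt).comp r b0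
    have b3 := (((hasDerivAt_pow (m + k + 2) r).const_mul 2).mul b2).add
      (((hasDerivAt_pow (m + k) r).const_mul (k : ℝ)).mul b1)
    have b4 : HasDerivAt Ψ _ r := b3
    rw [b4.deriv]
    simp only [Function.comp_def, Nat.add_succ_sub_one]
    push_cast
    ring
  simp_rw [h4] at h3
  rw [h3]
  simp [Ψ]

variable {n : ℕ}

theorem contDiff_cutoff_mul_radialExtension {φ : UnitSphere n → ℝ}
    (hφ : ContMDiff (𝓡 n) 𝓘(ℝ, ℝ) ∞ φ) {β : ℝ → ℝ} (hβ : ContDiff ℝ ∞ β)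
    (h0 : ∀ s, s ≤ 1 / 8 → β s = 0) :
    ContDiff ℝ ∞ fun x => β (‖x‖ ^ 2) * radialExtension φ x := by
  rw [contDiff_iff_contDiffAt]
  intro x
  rcases eq_or_ne x 0 with rfl | hx
  · have hev : ∀ᶠ y : EuclideanSpace ℝ (Fin (n + 1)) in nhds 0, ‖y‖ ^ 2 < 1 / 8 :=
      (by fun_prop : Continuous fun y : EuclideanSpace ℝ (Fin (n + 1)) =>
        ‖y‖ ^ 2).continuousAt.eventually_lt continuousAt_const (by norm_num)
    refine (contDiffAt_const (c := (0 : ℝ))).congr_of_eventuallyEq ?_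
    filter_upwards [hev] with y hy
    rw [h0 _ hy.le, zero_mul]
  · exact (hβ.comp (contDiff_norm_sq ℝ)).contDiffAt.mul (contDiffAt_radialExtension hφ hx)

theorem hasCompactSupport_cutoff {β : ℝ → ℝ} (h0 : ∀ s, 2 ≤ s → β s = 0)
    (g : EuclideanSpace ℝ (Fin (n + 1)) → ℝ) :
    HasCompactSupport fun x => β (‖x‖ ^ 2) * g x := by
  refine HasCompactSupport.of_support_subset_isCompact (isCompact_closedBall 0 2) ?_
  intro x hx
  by_contra hx2
  apply hx
  have : 2 ≤ ‖x‖ ^ 2 := by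
    simp only [mem_closedBall, dist_zero_right, not_le] at hx2
    nlinarith
  simp [h0 _ this]

/-- Green's identity on the sphere for a power of a linear function, through integration by parts
against its cut-off homogeneous extension. -/
theorem integral_inner_pow_mul_sphereLaplacian (hn : 1 ≤ n) (p : UnitSphere n)
    {φ : UnitSphere n → ℝ} (hφ : ContMDiff (𝓡 n) 𝓘(ℝ, ℝ) ∞ φ) (k : ℕ) :
    ∫ q : UnitSphere n, (inner ℝ (p : EuclideanSpace ℝ (Fin (n + 1))) q : ℝ) ^ k *
        sphereLaplacian φ q ∂(sphereMeasure n) =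
      k * (k + n - 1) * ∫ q : UnitSphere n,
        (inner ℝ (p : EuclideanSpace ℝ (Fin (n + 1))) q : ℝ) ^ k * φ q ∂(sphereMeasure n) -
      k * ((k - 1 : ℕ) : ℝ) * ∫ q : UnitSphere n,
        (inner ℝ (p : EuclideanSpace ℝ (Fin (n + 1))) q : ℝ) ^ (k - 1 - 1) * φ q
          ∂(sphereMeasure n) := by
  -- Cutoffs in the variable `s = ‖x‖ ^ 2`: `χ` is `1` on the support of `α`, and both vanish for `s
  -- ≤ 1/8`, which keeps away from the origin, where the radial extension is singular.
  let αb : ContDiffBump (1 : ℝ) := ⟨1 / 4, 1 / 2, by norm_num, by norm_num⟩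
  let χb : ContDiffBump (1 : ℝ) := ⟨3 / 4, 7 / 8, by norm_num, by norm_num⟩
  set α : ℝ → ℝ := fun s => αb s
  set χ : ℝ → ℝ := fun s => χb s
  have hα : ContDiff ℝ ∞ α := αb.contDiff
  have hχ : ContDiff ℝ ∞ χ := χb.contDiff
  have hα' : ContDiff ℝ ∞ (deriv α) := (contDiff_infty_iff_deriv.1 hα).2
  have hα'' : ContDiff ℝ ∞ (deriv (deriv α)) := (contDiff_infty_iff_deriv.1 hα').2
  have hα0 : ∀ s, 1 / 2 ≤ |s - 1| → α s = 0 := fun s hs => αb.zero_of_le_dist hs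
  have hχ0 : ∀ s, 7 / 8 ≤ |s - 1| → χ s = 0 := fun s hs => χb.zero_of_le_dist hs
  have hχ1 : ∀ s, |s - 1| ≤ 3 / 4 → χ s = 1 := fun s hs => χb.one_of_mem_closedBall hs
  have hαev : ∀ s, 1 / 2 < |s - 1| → α =ᶠ[nhds s] fun _ => 0 := by
    intro s hs
    have : ∀ᶠ t in nhds s, 1 / 2 < |t - 1| :=
      continuousAt_const.eventually_lt (by fun_prop) hs
    filter_upwards [this] with t ht using hα0 t ht.le
  have hα'0 : ∀ s, 1 / 2 < |s - 1| → deriv α s = 0 := fun s hs => by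
    rw [(hαev s hs).deriv_eq, deriv_const]
  have hα''0 : ∀ s, 1 / 2 < |s - 1| → deriv (deriv α) s = 0 := fun s hs => by
    rw [(hαev s hs).deriv.deriv_eq]; simp
  have absL : ∀ s : ℝ, s ≤ 1 / 8 → 7 / 8 ≤ |s - 1| := fun s hs => by
    rw [abs_sub_comm]; exact le_trans (by linarith) (le_abs_self _)
  have absR : ∀ s : ℝ, 2 ≤ s → 7 / 8 ≤ |s - 1| := fun s hs =>
    le_trans (by linarith) (le_abs_self _)
  set F := radialExtension φ
  set w : EuclideanSpace ℝ (Fin (n + 1)) → ℝ :=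
    fun x => α (‖x‖ ^ 2) * inner ℝ (p : EuclideanSpace ℝ (Fin (n + 1))) x ^ k
  set Fc : EuclideanSpace ℝ (Fin (n + 1)) → ℝ := fun x => χ (‖x‖ ^ 2) * F x
  have hw : ContDiff ℝ ∞ w :=
    (hα.comp (contDiff_norm_sq ℝ)).mul ((contDiff_const.inner ℝ contDiff_id).pow k)
  have hwc : HasCompactSupport w := hasCompactSupport_cutoff
    (fun s hs => hα0 s (by linarith [absR s hs])) _
  have hFc : ContDiff ℝ ∞ Fc := contDiff_cutoff_mul_radialExtension hφ hχ
    (fun s hs => hχ0 s (absL s hs))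
  have hFcc : HasCompactSupport Fc := hasCompactSupport_cutoff (fun s hs => hχ0 s (absR s hs)) _
  -- Symmetry of the Euclidean Laplacian for the pair `w`, `Fc`. As `χ = 1` wherever `α` lives, `Fc`
  -- is then replaced by `F` on both sides (`e1`, `e2`).
  have key := SchwartzMap.integral_mul_laplacian_right_eq_left (μ := volume)
    (hwc.toSchwartzMap hw) (hFcc.toSchwartzMap hFc)
  simp only [SchwartzMap.laplacian_apply] at key
  have key1 : ∫ x, w x * Δ Fc x = ∫ x, Δ w x * Fc x := key
  have e1 : ∀ x, w x * Δ Fc x = w x * Δ F x := by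
    intro x
    by_cases hx : 1 / 2 ≤ |‖x‖ ^ 2 - 1|
    · simp [w, hα0 _ hx]
    · congr 1
      have : ∀ᶠ y in nhds x, |‖y‖ ^ 2 - 1| < 1 / 2 :=
        (by fun_prop : ContinuousAt (fun y : EuclideanSpace ℝ (Fin (n + 1)) =>
          |‖y‖ ^ 2 - 1|) x).eventually_lt continuousAt_const (not_le.1 hx)
      refine Filter.EventuallyEq.eq_of_nhds (laplacian_congr_nhds ?_)
      filter_upwards [this] with y hy
      simp [Fc, hχ1 _ (hy.le.trans (by norm_num))]
  have hΔw := fun x => laplacian_zonal (p : EuclideanSpace ℝ (Fin (n + 1))) α k x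
    (hα.of_le two_le_infty).contDiffAt
  simp only [finrank_euclideanSpace_fin, p.norm_coe] at hΔw
  have e2 : ∀ x, Δ w x * Fc x = Δ w x * F x := by
    intro x
    by_cases hx : 1 / 2 < |‖x‖ ^ 2 - 1|
    · rw [hΔw]
      simp [hα'0 _ hx, hα''0 _ hx, hα0 _ hx.le]
    · simp [Fc, hχ1 _ ((not_lt.1 hx).trans (by norm_num))]
  simp_rw [e1, e2] at key1
  -- The coefficient of `⟨p, x⟩ ^ k` in `Δ w`.
  set β : ℝ → ℝ := fun s => 4 * s * deriv (deriv α) s + (2 * ((n + 1 : ℕ) : ℝ) + 4 * k) * deriv α s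
  have hβ : ContDiff ℝ ∞ β :=
    ((contDiff_const.mul contDiff_id).mul hα'').add (contDiff_const.mul hα')
  have hβ0 : ∀ s, 1 / 2 < |s - 1| → β s = 0 := fun s hs => by simp [β, hα'0 s hs, hα''0 s hs]
  have e3 : ∀ x, Δ w x * F x =
      (β (‖x‖ ^ 2) * F x) * inner ℝ (p : EuclideanSpace ℝ (Fin (n + 1))) x ^ k +
      k * ((k - 1 : ℕ) : ℝ) * ((α (‖x‖ ^ 2) * F x) *
        inner ℝ (p : EuclideanSpace ℝ (Fin (n + 1))) x ^ (k - 1 - 1)) := by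
    intro x
    rw [hΔw]
    ring
  have hint : ∀ (γ : ℝ → ℝ) (j : ℕ), ContDiff ℝ ∞ γ → (∀ s, 1 / 2 < |s - 1| → γ s = 0) →
      Integrable fun x => (γ (‖x‖ ^ 2) * F x) *
        inner ℝ (p : EuclideanSpace ℝ (Fin (n + 1))) x ^ j := by
    intro γ j hγ hγ0
    refine Continuous.integrable_of_hasCompactSupport ?_ ?_
    · refine Continuous.mul (contDiff_cutoff_mul_radialExtension hφ hγ
        (fun s hs => hγ0 s (by linarith [absL s hs]))).continuous (by fun_prop)
    · exact (hasCompactSupport_cutoff (fun s hs => hγ0 s (by linarith [absR s hs])) _).mul_right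
  simp_rw [e3] at key1
  rw [integral_add (hint β k hβ hβ0) ((hint α _ hα fun s hs => hα0 s hs.le).const_mul _),
    integral_const_mul] at key1
  have hy : ∀ (q : UnitSphere n) (r : ℝ) (j : ℕ), (inner ℝ (p : EuclideanSpace ℝ (Fin (n + 1)))
      (r • (q : EuclideanSpace ℝ (Fin (n + 1)))) : ℝ) ^ j = r ^ j *
      (inner ℝ (p : EuclideanSpace ℝ (Fin (n + 1))) q : ℝ) ^ j := by
    intro q r j
    rw [real_inner_smul_right, mul_pow]
  have hnr : ∀ (q : UnitSphere n) (r : ℝ), ‖r • (q : EuclideanSpace ℝ (Fin (n + 1)))‖ ^ 2 = r ^ 2 := by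
    intro q r
    rw [norm_smul, q.norm_coe, mul_one, Real.norm_eq_abs, sq_abs]
  have I1 := integral_eq_sphere_mul_Ioi (f := fun x => w x * Δ F x)
    (u := fun q : UnitSphere n => (inner ℝ (p : EuclideanSpace ℝ (Fin (n + 1))) q : ℝ) ^ k *
        sphereLaplacian φ q) (v := fun r => - (α (r ^ 2) * r ^ k * (r ^ 2)⁻¹)) (by
    intro q r hr
    simp only [w, F, laplacian_radialExtension_smul φ q hr, hy, hnr]
    ring)
  have I2 := fun (γ : ℝ → ℝ) (j : ℕ) => integral_eq_sphere_mul_Ioi (f := fun x => (γ (‖x‖ ^ 2) * F x) *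
        inner ℝ (p : EuclideanSpace ℝ (Fin (n + 1))) x ^ j)
    (u := fun q : UnitSphere n => (inner ℝ (p : EuclideanSpace ℝ (Fin (n + 1))) q : ℝ) ^ j *
        φ q) (v := fun r => γ (r ^ 2) * r ^ j) (by
    intro q r hr
    simp only [F, radialExtension_smul_coe φ q hr, hy, hnr]
    ring)
  rw [I1, I2, I2] at key1
  obtain ⟨m, rfl⟩ : ∃ m, n = m + 1 := ⟨n - 1, by omega⟩
  -- After polar coordinates every term carries a multiple of this one radial integral (`hneg`,
  -- `hA`, `hB`); it is positive, so it cancels and the spherical identity remains.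
  set J := ∫ r in Set.Ioi (0 : ℝ), r ^ (m + 1) * (α (r ^ 2) * r ^ k * (r ^ 2)⁻¹) with hJ
  have hneg : ∫ r in Set.Ioi (0 : ℝ), r ^ (m + 1) * -(α (r ^ 2) * r ^ k * (r ^ 2)⁻¹) = - J := by
    simp_rw [mul_neg]
    rw [integral_neg]
  have hcont : ∀ (γ : ℝ → ℝ) (j : ℕ), ContDiff ℝ ∞ γ → (∀ s, 1 / 2 < |s - 1| → γ s = 0) →
      IntegrableOn (fun r : ℝ => r ^ j * γ (r ^ 2)) (Set.Ioi 0) := by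
    intro γ j hγ hγ0
    refine (Continuous.integrable_of_hasCompactSupport
      (by have := hγ.continuous; fun_prop) ?_).integrableOn
    refine HasCompactSupport.of_support_subset_isCompact (isCompact_Icc (a := (-2 : ℝ)) (b := 2)) ?_
    intro r hr
    by_contra hr2
    apply hr
    have : 2 ≤ r ^ 2 := by
      simp only [Set.mem_Icc, not_and_or, not_le] at hr2
      rcases hr2 with h | h <;> nlinarith
    simp [hγ0 (r ^ 2) (by linarith [absR _ this])]
  have hJpos : 0 < J := by
    rw [hJ, setIntegral_pos_iff_support_of_nonneg_ae]
    · refine lt_of_lt_of_le ?_ (measure_mono (s := Set.Ioo (9 / 10 : ℝ) (11 / 10)) ?_)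
      · rw [Real.volume_Ioo]; norm_num
      · intro r hr
        have hr0 : 0 < r := by linarith [hr.1]
        refine ⟨?_, hr0⟩
        have : α (r ^ 2) = 1 := αb.one_of_mem_closedBall (by
          rw [mem_closedBall, Real.dist_eq, abs_le]
          constructor <;> simp only [αb] <;> nlinarith [hr.1, hr.2])
        simp only [Function.mem_support, this]
        positivity
    · filter_upwards [ae_restrict_mem measurableSet_Ioi] with r hr
      have hr0 : 0 < r := hr
      have : 0 ≤ α (r ^ 2) := αb.nonneg
      simp only [Pi.zero_apply]
      positivity
    -- The factor `χ` leaves the product unchanged but makes `χ s * s⁻¹` smooth at `0`.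
    · have hγ := hcont (fun s => α s * (χ s * s⁻¹)) (m + 1 + k) ?_ ?_
      · refine hγ.congr_fun (fun r hr => ?_) measurableSet_Ioi
        by_cases h : 1 / 2 ≤ |r ^ 2 - 1|
        · simp [hα0 _ h]
        · simp only [hχ1 _ ((not_le.1 h).le.trans (by norm_num))]
          ring
      · refine hα.mul ?_
        rw [contDiff_iff_contDiffAt]
        intro s
        rcases eq_or_ne s 0 with rfl | hs
        · refine (contDiffAt_const (c := (0 : ℝ))).congr_of_eventuallyEq ?_
          filter_upwards [gt_mem_nhds (show (0 : ℝ) < 1 / 8 by norm_num)] with t ht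
          rw [hχ0 _ (absL _ ht.le), zero_mul]
        · exact hχ.contDiffAt.mul (contDiffAt_id.inv hs)
      · intro s hs
        simp [hα0 s hs.le]
  have hA : (k : ℝ) * ((k - 1 : ℕ) : ℝ) * ∫ r in Set.Ioi (0 : ℝ),
      r ^ (m + 1) * (α (r ^ 2) * r ^ (k - 1 - 1)) = k * ((k - 1 : ℕ) : ℝ) * J := by
    rcases k with _ | _ | k
    · simp
    · simp
    · congr 1
      refine setIntegral_congr_fun measurableSet_Ioi fun r hr => ?_
      have hr0 : r ≠ 0 := (Set.mem_Ioi.1 hr).ne'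
      simp only [Nat.add_sub_cancel]
      field_simp
      ring
  -- The `β` integrand is a total derivative minus `k * (k + m) * r ^ (m + k - 1) * α (r ^ 2)`; this
  -- is where the eigenvalue `k * (k + n - 1)` comes from.
  have hB : ∫ r in Set.Ioi (0 : ℝ), r ^ (m + 1) * (β (r ^ 2) * r ^ k) = - (k * (k + m)) * J := by
    have hparts := integral_Ioi_radial_by_parts hα (fun s hs => hα0 s (by linarith [absR s hs])) m k
    have hα00 : α 0 = 0 := hα0 0 (by norm_num)
    rw [hα00, mul_zero, neg_zero] at hparts
    have : ∀ r ∈ Set.Ioi (0 : ℝ), (2 * (m + k + 2) * r ^ (m + k + 1) * deriv α (r ^ 2) +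
        4 * r ^ (m + k + 3) * deriv (deriv α) (r ^ 2) +
        k * ((m + k : ℕ) * r ^ (m + k - 1)) * α (r ^ 2) +
        2 * k * r ^ (m + k + 1) * deriv α (r ^ 2)) =
        r ^ (m + 1 + k) * β (r ^ 2) + k * ((m + k : ℕ) * (r ^ (m + k - 1) * α (r ^ 2))) := by
      intro r hr
      simp only [β]
      push_cast
      ring
    rw [setIntegral_congr_fun measurableSet_Ioi this, integral_add (hcont β _ hβ hβ0)
      (((hcont α _ hα fun s hs => hα0 s hs.le).const_mul _).const_mul _), integral_const_mul,
      integral_const_mul] at hparts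
    have h5 : ((m + k : ℕ) : ℝ) * ∫ r in Set.Ioi (0 : ℝ), r ^ (m + k - 1) * α (r ^ 2) =
        (m + k : ℕ) * J := by
      rcases Nat.eq_zero_or_pos (m + k) with h | h
      · simp [h]
      · congr 1
        refine setIntegral_congr_fun measurableSet_Ioi fun r hr => ?_
        have hr0 : r ≠ 0 := (Set.mem_Ioi.1 hr).ne'
        obtain ⟨j, hj⟩ : ∃ j, m + k = j + 1 := ⟨m + k - 1, by omega⟩
        have : r ^ (m + 1) * (α (r ^ 2) * r ^ k * (r ^ 2)⁻¹) =
          r ^ (m + k) * r * (α (r ^ 2) * (r ^ 2)⁻¹) := by ring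
        simp only [this, hj, Nat.add_sub_cancel]
        field_simp
        ring
    rw [h5] at hparts
    have h6 : ∫ r in Set.Ioi (0 : ℝ), r ^ (m + 1) * (β (r ^ 2) * r ^ k) =
        ∫ r in Set.Ioi (0 : ℝ), r ^ (m + 1 + k) * β (r ^ 2) := by
      congr 1; funext r; ring
    rw [h6]
    push_cast at hparts ⊢
    linarith
  rw [hneg, hB] at key1
  push_cast
  have h7 : ∀ a b : ℝ, ((k : ℝ) * ((k - 1 : ℕ) : ℝ)) * (a * b) =
    a * ((k : ℝ) * ((k - 1 : ℕ) : ℝ) * b) := fun a b => by ring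
  rw [h7, hA] at key1
  refine mul_right_cancel₀ hJpos.ne' ?_
  linear_combination -key1
end SelfAdjoint

/-! ### The Laplacian on polynomials in `⟨p, q⟩`. -/

section Zonal
open Laplacian InnerProductSpace

variable {n : ℕ}

/-- The inner product of two points of the sphere. -/
def sphereInner (p q : UnitSphere n) : ℝ :=
  inner ℝ (p : EuclideanSpace ℝ (Fin (n + 1))) (q : EuclideanSpace ℝ (Fin (n + 1)))

theorem continuous_sphereInner (p : UnitSphere n) : Continuous (sphereInner p) := by
  unfold sphereInner; fun_prop

theorem abs_sphereInner_le (p q : UnitSphere n) : |sphereInner p q| ≤ 1 := by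
  have := abs_real_inner_le_norm (p : EuclideanSpace ℝ (Fin (n + 1))) q
  rwa [p.norm_coe, q.norm_coe, mul_one] at this

theorem sphereInner_mem_Icc (p q : UnitSphere n) : sphereInner p q ∈ Set.Icc (-1 : ℝ) 1 :=
  abs_le.1 (abs_sphereInner_le p q)

theorem sphereInner_comm (p q : UnitSphere n) : sphereInner p q = sphereInner q p :=
  real_inner_comm _ _

theorem sphereInner_self (p : UnitSphere n) : sphereInner p p = 1 := by
  rw [sphereInner, real_inner_self_eq_norm_sq, p.norm_coe, one_pow]

theorem sphereInner_eq_one_iff {p q : UnitSphere n} : sphereInner p q = 1 ↔ p = q := by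
  rw [sphereInner, inner_eq_one_iff_of_norm_eq_one p.norm_coe q.norm_coe, Subtype.ext_iff]

theorem Continuous.integrable_sphereMeasure {f : UnitSphere n → ℝ} (hf : Continuous f) :
    Integrable f (sphereMeasure n) :=
  integrableOn_univ.1 (hf.continuousOn.integrableOn_compact isCompact_univ)

theorem contMDiff_eval_sphereInner (p : UnitSphere n) (P : Polynomial ℝ) :
    ContMDiff (𝓡 n) 𝓘(ℝ, ℝ) ∞ fun q => P.eval (sphereInner p q) := by
  have : Fact (Module.finrank ℝ (EuclideanSpace ℝ (Fin (n + 1))) = n + 1) :=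
    ⟨finrank_euclideanSpace_fin⟩
  have h : ContDiff ℝ ∞ fun x : EuclideanSpace ℝ (Fin (n + 1)) =>
      P.eval (inner ℝ (p : EuclideanSpace ℝ (Fin (n + 1))) x : ℝ) :=
    (by simpa using P.contDiff_aeval (𝕜 := ℝ) ∞ : ContDiff ℝ ∞ fun t => P.eval t).comp (contDiff_const.inner ℝ contDiff_id)
  exact h.contMDiff.comp (contMDiff_coe_sphere (n := n))

theorem sphereLaplacian_add {f g : UnitSphere n → ℝ} (hf : ContMDiff (𝓡 n) 𝓘(ℝ, ℝ) ∞ f)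
    (hg : ContMDiff (𝓡 n) 𝓘(ℝ, ℝ) ∞ g) (q : UnitSphere n) :
    sphereLaplacian (fun q => f q + g q) q = sphereLaplacian f q + sphereLaplacian g q := by
  have h1 : radialExtension (fun q => f q + g q) = radialExtension f + radialExtension g := by
    funext x
    simp only [radialExtension, Pi.add_apply]
    split_ifs <;> simp
  rw [sphereLaplacian, sphereLaplacian, sphereLaplacian, h1,
    ((contDiffAt_radialExtension hf q.coe_ne_zero).of_le two_le_infty).laplacian_add
      ((contDiffAt_radialExtension hg q.coe_ne_zero).of_le two_le_infty)]
  ring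

theorem sphereLaplacian_const_mul (c : ℝ) {f : UnitSphere n → ℝ}
    (hf : ContMDiff (𝓡 n) 𝓘(ℝ, ℝ) ∞ f) (q : UnitSphere n) :
    sphereLaplacian (fun q => c * f q) q = c * sphereLaplacian f q := by
  have h1 : radialExtension (fun q => c * f q) = c • radialExtension f := by
    funext x
    simp only [radialExtension, Pi.smul_apply, smul_eq_mul]
    split_ifs <;> simp
  rw [sphereLaplacian, sphereLaplacian, h1,
    laplacian_smul _ ((contDiffAt_radialExtension hf q.coe_ne_zero).of_le two_le_infty)]
  simp

theorem sphereLaplacian_inner_pow (p : UnitSphere n) (k : ℕ) (q : UnitSphere n) :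
    sphereLaplacian (fun q => sphereInner p q ^ k) q =
      k * (k + n - 1) * sphereInner p q ^ k -
        k * ((k - 1 : ℕ) : ℝ) * sphereInner p q ^ (k - 1 - 1) := by
  set r : ℝ := -(k / 2)
  -- Off the origin the extension of `⟨p, ·⟩ ^ k` is `⟨p, y⟩ ^ k / ‖y‖ ^ k`, hence the exponent `r =
  -- -k/2` of `‖y‖ ^ 2`.
  have hne := q.coe_ne_zero
  have h1 : radialExtension (fun q => sphereInner p q ^ k) =ᶠ[nhds (q : EuclideanSpace ℝ (Fin (n + 1)))]
      fun y => (fun s : ℝ => s ^ r) (‖y‖ ^ 2) * inner ℝ (p : EuclideanSpace ℝ (Fin (n + 1))) y ^ k := by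
    filter_upwards [isOpen_compl_singleton.mem_nhds hne] with y hy
    have hy0 : y ≠ 0 := hy
    rw [radialExtension_of_ne _ hy0, sphereInner, sphereProj, real_inner_smul_right, mul_pow]
    congr 1
    rw [← Real.rpow_natCast (‖y‖) 2, ← Real.rpow_mul (norm_nonneg _), inv_pow,
      ← Real.rpow_natCast, ← Real.rpow_neg (norm_nonneg _)]
    congr 1
    push_cast
    ring
  rw [sphereLaplacian, (laplacian_congr_nhds h1).eq_of_nhds, laplacian_zonal _ fun s : ℝ => s ^ r]
  · have hd : ∀ s : ℝ, 0 < s → deriv (fun s : ℝ => s ^ r) s = r * s ^ (r - 1) := fun s hs =>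
      (Real.hasDerivAt_rpow_const (Or.inl hs.ne')).deriv
    have hdd : deriv (deriv (fun s : ℝ => s ^ r)) 1 = r * (r - 1) := by
      have : deriv (fun s : ℝ => s ^ r) =ᶠ[nhds 1] fun s => r * s ^ (r - 1) := by
        filter_upwards [lt_mem_nhds one_pos] with s hs using hd s hs
      rw [this.deriv_eq, ((Real.hasDerivAt_rpow_const (p := r - 1)
        (Or.inl one_ne_zero)).const_mul r).deriv]
      simp
    simp only [q.norm_coe, p.norm_coe, one_pow, hdd, hd 1 one_pos, finrank_euclideanSpace_fin,
      Real.one_rpow, sphereInner, r]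
    push_cast
    ring
  · rw [q.norm_coe, one_pow]
    exact Real.contDiffAt_rpow_const_of_ne one_ne_zero

open Polynomial in
/-- The Laplace–Beltrami operator of `𝕊ⁿ` on zonal polynomials. -/
def zonalOp (n : ℕ) (P : ℝ[X]) : ℝ[X] :=
  C (n : ℝ) * X * derivative P - (1 - X ^ 2) * derivative (derivative P)

open Polynomial in
theorem zonalOp_add (n : ℕ) (P Q : ℝ[X]) : zonalOp n (P + Q) = zonalOp n P + zonalOp n Q := by
  simp only [zonalOp, derivative_add]; ring

open Polynomial in
theorem zonalOp_C_mul (n : ℕ) (c : ℝ) (P : ℝ[X]) : zonalOp n (C c * P) = C c * zonalOp n P := by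
  simp only [zonalOp, derivative_C_mul]; ring

open Polynomial in
theorem zonalOp_X_pow (n k : ℕ) : zonalOp n (X ^ k) =
    C ((k : ℝ) * (k + n - 1)) * X ^ k - C ((k : ℝ) * ((k - 1 : ℕ) : ℝ)) * X ^ (k - 1 - 1) := by
  rcases k with _ | _ | k
  · simp [zonalOp]
  · simp [zonalOp]
  · simp only [zonalOp, derivative_X_pow, Nat.add_sub_cancel, derivative_mul, map_mul,
      map_sub, map_add, map_natCast, derivative_natCast]
    simp only [Nat.cast_add, Nat.cast_one, map_one]
    ring

open Polynomial in
theorem sphereLaplacian_eval_sphereInner (p : UnitSphere n) (P : ℝ[X]) (q : UnitSphere n) :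
    sphereLaplacian (fun q => P.eval (sphereInner p q)) q =
      (zonalOp n P).eval (sphereInner p q) := by
  induction P using Polynomial.induction_on' with
  | add P Q hP hQ =>
    simp only [eval_add, zonalOp_add]
    rw [sphereLaplacian_add (contMDiff_eval_sphereInner p P) (contMDiff_eval_sphereInner p Q), hP, hQ]
  | monomial k c =>
    rw [← C_mul_X_pow_eq_monomial, zonalOp_C_mul]
    simp only [eval_mul, eval_C]
    rw [sphereLaplacian_const_mul c (contMDiff_eval_sphereInner p (X ^ k)), zonalOp_X_pow]
    simp only [eval_pow, eval_X, sphereLaplacian_inner_pow]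
    simp

open Polynomial in
theorem integral_eval_mul_sphereLaplacian (hn : 1 ≤ n) (p : UnitSphere n)
    {φ : UnitSphere n → ℝ} (hφ : ContMDiff (𝓡 n) 𝓘(ℝ, ℝ) ∞ φ) (P : ℝ[X]) :
    ∫ q, P.eval (sphereInner p q) * sphereLaplacian φ q ∂(sphereMeasure n) =
      ∫ q, (zonalOp n P).eval (sphereInner p q) * φ q ∂(sphereMeasure n) := by
  have hc := continuous_sphereInner p
  have hL := continuous_sphereLaplacian hφ
  have hφc := hφ.continuous
  induction P using Polynomial.induction_on' with
  | add P Q hP hQ =>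
    simp only [eval_add, zonalOp_add, add_mul]
    rw [integral_add, integral_add, hP, hQ]
    all_goals exact Continuous.integrable_sphereMeasure (by fun_prop)
  | monomial k c =>
    have h := integral_inner_pow_mul_sphereLaplacian hn p hφ k
    rw [← C_mul_X_pow_eq_monomial, zonalOp_C_mul, zonalOp_X_pow]
    generalize (k : ℝ) * (k + n - 1) = a at h ⊢
    generalize (k : ℝ) * ((k - 1 : ℕ) : ℝ) = b at h ⊢
    simp only [eval_mul, eval_C, eval_sub, eval_pow, eval_X, mul_assoc, sub_mul]
    rw [integral_const_mul, integral_const_mul, integral_sub, integral_const_mul, integral_const_mul]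
    · simp only [sphereInner]
      rw [h]
    all_goals exact Continuous.integrable_sphereMeasure (by fun_prop)

open Polynomial in
-- Symmetry against the constant `1`, which `zonalOp n` annihilates.
theorem integral_eval_zonalOp (hn : 1 ≤ n) (p : UnitSphere n) (P : ℝ[X]) :
    ∫ q, (zonalOp n P).eval (sphereInner p q) ∂(sphereMeasure n) = 0 := by
  have h := integral_eval_mul_sphereLaplacian hn p (contMDiff_eval_sphereInner p 1) P
  simp only [sphereLaplacian_eval_sphereInner] at h
  simpa [zonalOp] using h.symm

open Polynomial in
-- Poisson's equation is solvable in polynomials modulo constants: `zonalOp n` is triangular on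
-- monomials, with diagonal entries `k * (k + n - 1)` that are positive for `k ≥ 1`.
theorem exists_zonalOp_eq_sub_C (hn : 1 ≤ n) (f : ℝ[X]) : ∃ P c, zonalOp n P = f - C c := by
  induction f using Polynomial.induction_on' with
  | add f g hf hg =>
    obtain ⟨P, c, hP⟩ := hf
    obtain ⟨Q, d, hQ⟩ := hg
    exact ⟨P + Q, c + d, by rw [zonalOp_add, hP, hQ, C_add]; ring⟩
  | monomial k a =>
    have hk : ∃ P c, zonalOp n P = (X : ℝ[X]) ^ k - C c := by
      induction k using Nat.strong_induction_on with
      | _ k ih =>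
        rcases Nat.eq_zero_or_pos k with rfl | hk
        · exact ⟨0, 1, by simp [zonalOp]⟩
        · obtain ⟨P, c, hP⟩ := ih (k - 1 - 1) (by omega)
          have hpos : (0 : ℝ) < k * (k + n - 1) := by
            have h1 : (1 : ℝ) ≤ k := by exact_mod_cast hk
            have h2 : (1 : ℝ) ≤ n := by exact_mod_cast hn
            have : (0 : ℝ) < k + n - 1 := by linarith
            positivity
          refine ⟨C ((k : ℝ) * (k + n - 1))⁻¹ * (X ^ k + C ((k : ℝ) * ((k - 1 : ℕ) : ℝ)) * P),
            ((k : ℝ) * (k + n - 1))⁻¹ * ((k : ℝ) * ((k - 1 : ℕ) : ℝ)) * c, ?_⟩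
          rw [zonalOp_C_mul, zonalOp_add, zonalOp_C_mul, zonalOp_X_pow, hP]
          have e : C ((k : ℝ) * (k + n - 1))⁻¹ * C ((k : ℝ) * (k + n - 1)) = (1 : ℝ[X]) := by
            rw [← C_mul, inv_mul_cancel₀ hpos.ne', C_1]
          rw [C_mul (a := ((k : ℝ) * (k + n - 1))⁻¹ * ((k : ℝ) * ((k - 1 : ℕ) : ℝ))),
            C_mul (a := ((k : ℝ) * (k + n - 1))⁻¹)]
          linear_combination X ^ k * e
    obtain ⟨P, c, hP⟩ := hk
    exact ⟨C a * P, a * c, by rw [zonalOp_C_mul, hP, ← C_mul_X_pow_eq_monomial, C_mul]; ring⟩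
end Zonal

/-! ### Cap volumes and the radial potential. -/

section SinePower
open Real intervalIntegral

/-- `∫₀^θ sin^(n-1)`, the normalized volume of a geodesic ball of radius `θ` in `𝕊ⁿ`. -/
def capVol (n : ℕ) (θ : ℝ) : ℝ := ∫ s in (0 : ℝ)..θ, sin s ^ (n - 1)

/-- The radial potential `∫₀^θ capVol / sin^(n-1)`. -/
def capPot (n : ℕ) (θ : ℝ) : ℝ := ∫ s in (0 : ℝ)..θ, capVol n s / sin s ^ (n - 1)

variable {n : ℕ}

theorem continuous_sin_pow (m : ℕ) : Continuous fun s : ℝ => sin s ^ m := by fun_prop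

theorem hasDerivAt_capVol (n : ℕ) (θ : ℝ) : HasDerivAt (capVol n) (sin θ ^ (n - 1)) θ :=
  (continuous_sin_pow (n - 1)).integral_hasStrictDerivAt 0 θ |>.hasDerivAt

theorem continuous_capVol (n : ℕ) : Continuous (capVol n) :=
  continuous_iff_continuousAt.2 fun θ => (hasDerivAt_capVol n θ).continuousAt

theorem capVol_zero (n : ℕ) : capVol n 0 = 0 := integral_same

theorem capVol_sub (n : ℕ) (a b : ℝ) : capVol n b - capVol n a = ∫ s in a..b, sin s ^ (n - 1) := by
  rw [capVol, capVol, integral_interval_sub_left] <;>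
  exact (continuous_sin_pow _).intervalIntegrable _ _

theorem sin_pow_nonneg {s : ℝ} (hs : s ∈ Set.Icc 0 π) (m : ℕ) : 0 ≤ sin s ^ m :=
  pow_nonneg (sin_nonneg_of_mem_Icc hs) m

theorem sin_pow_pos {s : ℝ} (hs : s ∈ Set.Ioo 0 π) (m : ℕ) : 0 < sin s ^ m :=
  pow_pos (sin_pos_of_mem_Ioo hs) m

theorem capVol_monotoneOn (n : ℕ) : MonotoneOn (capVol n) (Set.Icc 0 π) := by
  intro a ha b hb hab
  rw [← sub_nonneg, capVol_sub]
  exact integral_nonneg hab fun u hu => sin_pow_nonneg ⟨ha.1.trans hu.1, hu.2.trans hb.2⟩ _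

theorem capVol_lt {a b : ℝ} (ha : 0 ≤ a) (hb : b ≤ π) (hab : a < b) : capVol n a < capVol n b := by
  rw [← sub_pos, capVol_sub]
  exact intervalIntegral_pos_of_pos_on ((continuous_sin_pow _).intervalIntegrable _ _)
    (fun x hx => sin_pow_pos ⟨ha.trans_lt hx.1, hx.2.trans_le hb⟩ _) hab

theorem capVol_nonneg {s : ℝ} (hs : s ∈ Set.Icc 0 π) : 0 ≤ capVol n s := by
  rw [← capVol_zero n]
  exact capVol_monotoneOn n ⟨le_rfl, pi_pos.le⟩ hs hs.1

theorem capVol_pos {s : ℝ} (hs : 0 < s) (hsπ : s ≤ π) : 0 < capVol n s := by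
  rw [← capVol_zero n]
  exact capVol_lt le_rfl hsπ hs

theorem capVol_pi_sub (n : ℕ) (s : ℝ) : capVol n (π - s) = capVol n π - capVol n s := by
  rw [capVol_sub, capVol]
  have h := integral_comp_sub_left (a := 0) (b := π - s) (fun s => sin s ^ (n - 1)) π
  simp only [sin_pi_sub, sub_sub_cancel, sub_zero] at h
  exact h

/-- The sine increases on `[0, π/2]`. This removes the singularity of `capVol n / sin ^ (n - 1)` at
`0`; the one at `π` is genuine for `n ≥ 2`, so `capPot n` is handled on `[0, π)`. -/
theorem capVol_le_mul {s : ℝ} (hs : s ∈ Set.Icc 0 (π / 2)) : capVol n s ≤ s * sin s ^ (n - 1) := by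
  have h : capVol n s ≤ ∫ _ in (0 : ℝ)..s, sin s ^ (n - 1) := by
    refine integral_mono_on hs.1 ((continuous_sin_pow _).intervalIntegrable _ _)
      intervalIntegrable_const fun x hx => ?_
    have hsin : sin x ≤ sin s := sin_le_sin_of_le_of_le_pi_div_two
      (by linarith [hx.1, pi_pos]) hs.2 hx.2
    exact pow_le_pow_left₀ (sin_nonneg_of_nonneg_of_le_pi hx.1
      (by linarith [hx.2, hs.2, pi_pos])) hsin _
  simpa using h

theorem capVol_div_nonneg {s : ℝ} (hs : s ∈ Set.Icc 0 π) :
    0 ≤ capVol n s / sin s ^ (n - 1) :=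
  div_nonneg (capVol_nonneg hs) (sin_pow_nonneg hs _)

theorem capVol_div_le {s : ℝ} (hs : s ∈ Set.Icc 0 (π / 2)) :
    capVol n s / sin s ^ (n - 1) ≤ s := by
  rcases hs.1.eq_or_lt with h | h
  · rw [← h, capVol_zero, zero_div]
  · rw [div_le_iff₀ (sin_pow_pos ⟨h, by linarith [hs.2, pi_pos]⟩ _)]
    exact capVol_le_mul hs

theorem continuousOn_capVol_div (n : ℕ) :
    ContinuousOn (fun s => capVol n s / sin s ^ (n - 1)) (Set.Ico 0 π) := by
  intro s hs
  rcases hs.1.eq_or_lt with h | h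
  · rw [← h]
    have h0 : Filter.Tendsto (fun s : ℝ => s) (nhdsWithin 0 (Set.Ico 0 π)) (nhds 0) :=
      (continuous_id.tendsto 0).mono_left nhdsWithin_le_nhds
    rw [ContinuousWithinAt, capVol_zero, zero_div]
    have hev : ∀ᶠ t in nhdsWithin (0 : ℝ) (Set.Ico 0 π), t ∈ Set.Icc 0 (π / 2) := by
      filter_upwards [self_mem_nhdsWithin,
        nhdsWithin_le_nhds (gt_mem_nhds (half_pos pi_pos))] with t ht1 ht2
      exact ⟨ht1.1, ht2.le⟩
    refine tendsto_of_tendsto_of_tendsto_of_le_of_le' tendsto_const_nhds h0 ?_ ?_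
    · filter_upwards [hev] with t ht
      exact capVol_div_nonneg ⟨ht.1, by linarith [ht.2, pi_pos]⟩
    · filter_upwards [hev] with t ht using capVol_div_le ht
  · exact ((continuous_capVol n).continuousAt.div (continuous_sin_pow _).continuousAt
      (sin_pow_pos ⟨h, hs.2⟩ _).ne').continuousWithinAt

theorem intervalIntegrable_capVol_div {a b : ℝ} (ha : 0 ≤ a) (hb : b < π) (hab : a ≤ b) :
    IntervalIntegrable (fun s => capVol n s / sin s ^ (n - 1)) volume a b := by
  refine ((continuousOn_capVol_div n).mono ?_).intervalIntegrable
  rw [Set.uIcc_of_le hab]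
  exact fun x hx => ⟨ha.trans hx.1, hx.2.trans_lt hb⟩

theorem capPot_sub {a b : ℝ} (ha : 0 ≤ a) (hab : a ≤ b) (hb : b < π) :
    capPot n b - capPot n a = ∫ s in a..b, capVol n s / sin s ^ (n - 1) := by
  rw [capPot, capPot, integral_interval_sub_left]
  · exact intervalIntegrable_capVol_div le_rfl hb (ha.trans hab)
  · exact intervalIntegrable_capVol_div le_rfl (hab.trans_lt hb) ha

theorem capPot_zero (n : ℕ) : capPot n 0 = 0 := integral_same

theorem capPot_nonneg {θ : ℝ} (hθ : θ ∈ Set.Icc 0 π) : 0 ≤ capPot n θ :=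
  integral_nonneg hθ.1 fun _ hu => capVol_div_nonneg ⟨hu.1, hu.2.trans hθ.2⟩

theorem capPot_monotoneOn (n : ℕ) : MonotoneOn (capPot n) (Set.Ico 0 π) := by
  intro a ha b hb hab
  rw [← sub_nonneg, capPot_sub ha.1 hab hb.2]
  exact integral_nonneg hab fun u hu => capVol_div_nonneg ⟨ha.1.trans hu.1, (hu.2.trans_lt hb.2).le⟩

theorem hasDerivAt_capPot {θ : ℝ} (hθ : θ ∈ Set.Ioo 0 π) :
    HasDerivAt (capPot n) (capVol n θ / sin θ ^ (n - 1)) θ := by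
  have hc : ContinuousOn (fun s => capVol n s / sin s ^ (n - 1)) (Set.Ioo 0 π) :=
    (continuousOn_capVol_div n).mono Set.Ioo_subset_Ico_self
  exact integral_hasDerivAt_right (intervalIntegrable_capVol_div le_rfl hθ.2 hθ.1.le)
    (hc.stronglyMeasurableAtFilter isOpen_Ioo θ hθ) (hc.continuousAt (Ioo_mem_nhds hθ.1 hθ.2))

theorem continuousOn_capPot (n : ℕ) : ContinuousOn (capPot n) (Set.Ico 0 π) := by
  intro θ hθ
  rcases hθ.1.eq_or_lt with h | h
  · rw [← h]
    have h1 := continuousOn_primitive_interval (a := 0) (b := π / 2) (μ := volume)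
      (f := fun s => capVol n s / sin s ^ (n - 1))
      ((intervalIntegrable_iff' enorm_ne_top).1
        (intervalIntegrable_capVol_div le_rfl (by linarith [pi_pos]) (half_pos pi_pos).le))
    have h2 := h1 0 Set.left_mem_uIcc
    refine h2.mono_of_mem_nhdsWithin ?_
    rw [Set.uIcc_of_le (half_pos pi_pos).le]
    filter_upwards [self_mem_nhdsWithin,
      nhdsWithin_le_nhds (gt_mem_nhds (half_pos pi_pos))] with t ht1 ht2
    exact ⟨ht1.1, ht2.le⟩
  · exact (hasDerivAt_capPot ⟨h, hθ.2⟩).continuousAt.continuousWithinAt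

/-- The reflection `s ↦ π - s` exchanges the two volume factors, so beyond `π/2` the first one
absorbs the zero of the sine. -/
theorem capVol_mul_div_le {s : ℝ} (hs : s ∈ Set.Ico 0 π) :
    (capVol n π - capVol n s) * (capVol n s / sin s ^ (n - 1)) ≤ capVol n π * (π / 2) := by
  have hs' : s ∈ Set.Icc 0 π := ⟨hs.1, hs.2.le⟩
  have h0 := capVol_nonneg (n := n) hs'
  have h1 : capVol n s ≤ capVol n π := capVol_monotoneOn n hs' ⟨pi_pos.le, le_rfl⟩ hs.2.le
  rcases le_total s (π / 2) with h | h
  · have h2 := capVol_div_le (n := n) ⟨hs.1, h⟩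
    have h3 := capVol_div_nonneg (n := n) hs'
    exact mul_le_mul (by linarith) (h2.trans h) h3 (by linarith)
  · have h2 := capVol_div_le (n := n) (s := π - s) ⟨by linarith [hs.2], by linarith⟩
    rw [capVol_pi_sub, sin_pi_sub] at h2
    have h3 : (capVol n π - capVol n s) * (capVol n s / sin s ^ (n - 1)) =
      capVol n s * ((capVol n π - capVol n s) / sin s ^ (n - 1)) := by ring
    rw [h3]
    exact mul_le_mul h1 (h2.trans (by linarith))
      (div_nonneg (by linarith) (sin_pow_nonneg hs' _)) (by linarith)

/-- Integration by parts on `[0, b i]` with `b i → π` bounds the integrals uniformly. The primitive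
of `sin ^ (n - 1)` is taken to be `capVol n - capVol n π`: the boundary term at `b i` is then
nonpositive and the remaining integrand is bounded by `capVol_mul_div_le`. -/
theorem integrableOn_capPot_mul (n : ℕ) :
    IntegrableOn (fun s => capPot n s * sin s ^ (n - 1)) (Set.Ioc 0 π) := by
  set b : ℕ → ℝ := fun i => π - π / (i + 1)
  have hb0 : ∀ i, 0 ≤ b i := fun i => by
    have : π / (i + 1) ≤ π := div_le_self pi_pos.le (by linarith [Nat.cast_nonneg (α := ℝ) i])
    simp only [b]; linarith
  have hbπ : ∀ i, b i < π := fun i => by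
    have : 0 < π / (i + 1) := div_pos pi_pos (by positivity)
    simp only [b]; linarith
  have hcont : ∀ i, ContinuousOn (capPot n) (Set.Icc 0 (b i)) := fun i =>
    (continuousOn_capPot n).mono fun x hx => ⟨hx.1, hx.2.trans_lt (hbπ i)⟩
  refine integrableOn_Ioc_of_intervalIntegral_norm_bounded_right (b := b) (l := Filter.atTop)
    (I := capVol n π * (π / 2) * π) (fun i => ?_) ?_ (Filter.Eventually.of_forall fun i => ?_)
  · exact (((hcont i).mul (continuous_sin_pow _).continuousOn).integrableOn_compact
      isCompact_Icc).mono_set Set.Ioc_subset_Icc_self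
  · have h : Filter.Tendsto (fun i : ℕ => π / ((i : ℝ) + 1)) Filter.atTop (nhds 0) :=
      tendsto_const_div_atTop_nhds_zero_nat π |>.comp (Filter.tendsto_add_atTop_nat 1) |>.congr
        fun i => by simp
    simpa [b] using tendsto_const_nhds.sub h
  · have e1 : ∫ x in Set.Ioc 0 (b i), ‖capPot n x * sin x ^ (n - 1)‖ =
        ∫ x in (0 : ℝ)..b i, capPot n x * sin x ^ (n - 1) := by
      rw [integral_of_le (hb0 i)]
      refine setIntegral_congr_fun measurableSet_Ioc fun x hx => ?_
      have hx' : x ∈ Set.Icc 0 π := ⟨hx.1.le, hx.2.trans (hbπ i).le⟩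
      exact Real.norm_of_nonneg (mul_nonneg (capPot_nonneg hx') (sin_pow_nonneg hx' _))
    have hi1 : IntervalIntegrable (fun x => capPot n x * sin x ^ (n - 1)) volume 0 (b i) := by
      refine ContinuousOn.intervalIntegrable ?_
      rw [Set.uIcc_of_le (hb0 i)]
      exact (hcont i).mul (continuous_sin_pow _).continuousOn
    have hi2 : IntervalIntegrable (fun x => (capVol n π - capVol n x) *
        (capVol n x / sin x ^ (n - 1))) volume 0 (b i) := by
      refine ContinuousOn.intervalIntegrable ?_
      rw [Set.uIcc_of_le (hb0 i)]
      exact ((continuous_const.sub (continuous_capVol n)).continuousOn).mul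
        ((continuousOn_capVol_div n).mono fun x hx => ⟨hx.1, hx.2.trans_lt (hbπ i)⟩)
    have e2 : ∫ x in (0 : ℝ)..b i, (capPot n x * sin x ^ (n - 1) -
        (capVol n π - capVol n x) * (capVol n x / sin x ^ (n - 1))) =
        capPot n (b i) * (capVol n (b i) - capVol n π) -
          capPot n 0 * (capVol n 0 - capVol n π) := by
      refine integral_eq_sub_of_hasDerivAt_of_le (hb0 i)
        (f := fun x => capPot n x * (capVol n x - capVol n π))
        ((hcont i).mul ((continuous_capVol n).sub continuous_const).continuousOn)
        (fun x hx => ?_) (hi1.sub hi2)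
      have hx' : x ∈ Set.Ioo 0 π := ⟨hx.1, hx.2.trans (hbπ i)⟩
      refine ((hasDerivAt_capPot hx').mul ((hasDerivAt_capVol n x).sub_const _)).congr_deriv ?_
      ring
    rw [integral_sub hi1 hi2, capPot_zero, zero_mul, sub_zero] at e2
    have e3 : ∫ x in (0 : ℝ)..b i, (capVol n π - capVol n x) * (capVol n x / sin x ^ (n - 1)) ≤
        ∫ _ in (0 : ℝ)..b i, capVol n π * (π / 2) := by
      refine integral_mono_on (hb0 i) hi2 intervalIntegrable_const fun x hx => ?_
      exact capVol_mul_div_le ⟨hx.1, hx.2.trans_lt (hbπ i)⟩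
    rw [intervalIntegral.integral_const, smul_eq_mul, sub_zero] at e3
    have e4 : capPot n (b i) * (capVol n (b i) - capVol n π) ≤ 0 :=
      mul_nonpos_of_nonneg_of_nonpos (capPot_nonneg ⟨hb0 i, (hbπ i).le⟩)
        (sub_nonpos.2 (capVol_monotoneOn n ⟨hb0 i, (hbπ i).le⟩ ⟨pi_pos.le, le_rfl⟩ (hbπ i).le))
    have e5 : b i * (capVol n π * (π / 2)) ≤ π * (capVol n π * (π / 2)) :=
      mul_le_mul_of_nonneg_right (hbπ i).le
        (mul_nonneg (capVol_nonneg ⟨pi_pos.le, le_rfl⟩) (half_pos pi_pos).le)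
    rw [e1]
    linarith

theorem intervalIntegrable_capPot_mul (n : ℕ) :
    IntervalIntegrable (fun s => capPot n s * sin s ^ (n - 1)) volume 0 π :=
  (intervalIntegrable_iff_integrableOn_Ioc_of_le pi_pos.le).2 (integrableOn_capPot_mul n)

theorem capPot_mul_le {θ : ℝ} (h0 : 0 ≤ θ) (hθ : θ < π) :
    capPot n θ * (capVol n π - capVol n θ) ≤ ∫ s in θ..π, capPot n s * sin s ^ (n - 1) := by
  rw [capVol_sub, ← intervalIntegral.integral_const_mul]
  refine integral_mono_on_of_le_Ioo hθ.le
    (((continuous_sin_pow _).const_mul _).intervalIntegrable _ _)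
    ((intervalIntegrable_capPot_mul n).mono_set ?_) fun x hx => ?_
  · rw [Set.uIcc_of_le hθ.le, Set.uIcc_of_le pi_pos.le]
    exact Set.Icc_subset_Icc_left h0
  · exact mul_le_mul_of_nonneg_right
      (capPot_monotoneOn n ⟨h0, hθ⟩ ⟨h0.trans hx.1.le, hx.2⟩ hx.1.le)
      (sin_pow_nonneg ⟨h0.trans hx.1.le, hx.2.le⟩ _)

/-- Monotonicity bounds the product by a tail of a convergent integral (`capPot_mul_le`). Continuity
of the shell potentials at `π` rests on this. -/
theorem tendsto_capPot_mul (n : ℕ) :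
    Filter.Tendsto (fun θ => capPot n θ * (capVol n π - capVol n θ))
      (nhdsWithin π (Set.Iio π)) (nhds 0) := by
  have h1 := continuousOn_primitive_interval_left (a := 0) (b := π) (μ := volume)
    (f := fun s => capPot n s * sin s ^ (n - 1))
    ((intervalIntegrable_iff' enorm_ne_top).1 (intervalIntegrable_capPot_mul n))
  have h2 := h1 π Set.right_mem_uIcc
  rw [ContinuousWithinAt, integral_same, Set.uIcc_of_le pi_pos.le] at h2
  have hle : nhdsWithin π (Set.Iio π) ≤ nhdsWithin π (Set.Icc 0 π) := by
    rw [← nhdsWithin_Ioo_eq_nhdsLT pi_pos]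
    exact nhdsWithin_mono _ Set.Ioo_subset_Icc_self
  have hev : ∀ᶠ θ in nhdsWithin π (Set.Iio π), θ ∈ Set.Ioo 0 π := by
    rw [← nhdsWithin_Ioo_eq_nhdsLT pi_pos]
    exact self_mem_nhdsWithin
  refine tendsto_of_tendsto_of_tendsto_of_le_of_le' tendsto_const_nhds (h2.mono_left hle) ?_ ?_
  · filter_upwards [hev] with θ hθ
    exact mul_nonneg (capPot_nonneg ⟨hθ.1.le, hθ.2.le⟩) (sub_nonneg.2
      (capVol_monotoneOn n ⟨hθ.1.le, hθ.2.le⟩ ⟨pi_pos.le, le_rfl⟩ hθ.2.le))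
  · filter_upwards [hev] with θ hθ using capPot_mul_le hθ.1.le hθ.2

open Polynomial in
-- The divergence theorem on a cap: the right side is the radial flux, and it vanishes at `θ = π`.
theorem integral_zonalOp_cos (hn : 1 ≤ n) (P : ℝ[X]) (θ : ℝ) :
    ∫ s in (0 : ℝ)..θ, (zonalOp n P).eval (cos s) * sin s ^ (n - 1) =
      P.derivative.eval (cos θ) * sin θ ^ n := by
  obtain ⟨m, rfl⟩ : ∃ m, n = m + 1 := ⟨n - 1, by omega⟩
  have h : ∀ s, HasDerivAt (fun s => P.derivative.eval (cos s) * sin s ^ (m + 1))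
      ((zonalOp (m + 1) P).eval (cos s) * sin s ^ (m + 1 - 1)) s := by
    intro s
    have h1 := ((P.derivative.hasDerivAt (cos s)).comp s (hasDerivAt_cos s)).mul
      ((hasDerivAt_sin s).pow (m + 1))
    refine h1.congr_deriv ?_
    simp only [zonalOp, eval_sub, eval_mul, eval_C, eval_X, eval_one, eval_pow, Function.comp_def,
      Nat.add_sub_cancel, Pi.pow_apply]
    linear_combination (-(P.derivative.derivative.eval (cos s) * sin s ^ m)) * (sin_sq_add_cos_sq s)
  rw [integral_eq_sub_of_hasDerivAt (fun s _ => h s)]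
  · simp
  · exact Continuous.intervalIntegrable (by fun_prop) _ _

end SinePower

/-! ### Measures on `[-1, 1]` are determined by their moments. -/

section Moments
open Polynomial

variable {X Y : Type*} [MeasurableSpace X] [MeasurableSpace Y] {μ : Measure X} {ν : Measure Y}

theorem integrable_continuous_comp_mul {w : X → ℝ} (hw : Integrable w μ) {σ : X → ℝ}
    (hσ : Measurable σ) (hσ1 : ∀ x, σ x ∈ Set.Icc (-1 : ℝ) 1) {f : ℝ → ℝ} (hf : Continuous f) :
    Integrable (fun x => f (σ x) * w x) μ := by
  obtain ⟨M, hM⟩ := isCompact_Icc.exists_bound_of_continuousOn (s := Set.Icc (-1 : ℝ) 1)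
    hf.continuousOn
  exact hw.bdd_mul (c := M) (hf.measurable.comp hσ).aestronglyMeasurable
    (Filter.Eventually.of_forall fun x => hM _ (hσ1 x))

theorem integral_eval_eq_of_moments {w : X → ℝ} {v : Y → ℝ} (hw : Integrable w μ)
    (hv : Integrable v ν) {σ : X → ℝ} {τ : Y → ℝ} (hσ : Measurable σ) (hτ : Measurable τ)
    (hσ1 : ∀ x, σ x ∈ Set.Icc (-1 : ℝ) 1) (hτ1 : ∀ y, τ y ∈ Set.Icc (-1 : ℝ) 1)
    (h : ∀ k : ℕ, ∫ x, σ x ^ k * w x ∂μ = ∫ y, τ y ^ k * v y ∂ν) (P : ℝ[X]) :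
    ∫ x, P.eval (σ x) * w x ∂μ = ∫ y, P.eval (τ y) * v y ∂ν := by
  induction P using Polynomial.induction_on' with
  | add P Q hP hQ =>
    simp only [eval_add, add_mul]
    rw [integral_add (integrable_continuous_comp_mul hw hσ hσ1 P.continuous)
      (integrable_continuous_comp_mul hw hσ hσ1 Q.continuous), hP, hQ,
      integral_add (integrable_continuous_comp_mul hv hτ hτ1 P.continuous)
      (integrable_continuous_comp_mul hv hτ hτ1 Q.continuous)]
  | monomial k c =>
    simp only [eval_monomial, mul_assoc]
    rw [integral_const_mul, integral_const_mul, h]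

theorem abs_integral_eval_sub_le {w : X → ℝ} (hw : Integrable w μ) {σ : X → ℝ}
    (hσ : Measurable σ) (hσ1 : ∀ x, σ x ∈ Set.Icc (-1 : ℝ) 1) {f : ℝ → ℝ} (hf : Continuous f)
    (P : ℝ[X]) {ε : ℝ} (hP : ∀ x ∈ Set.Icc (-1 : ℝ) 1, |P.eval x - f x| < ε) :
    |∫ x, P.eval (σ x) * w x ∂μ - ∫ x, f (σ x) * w x ∂μ| ≤ ε * ∫ x, |w x| ∂μ := by
  rw [← integral_sub (integrable_continuous_comp_mul hw hσ hσ1 P.continuous)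
    (integrable_continuous_comp_mul hw hσ hσ1 hf), ← integral_const_mul, ← Real.norm_eq_abs]
  refine (norm_integral_le_integral_norm _).trans ?_
  refine integral_mono_of_nonneg ?_ (hw.abs.const_mul ε)
    (Filter.Eventually.of_forall fun x => ?_)
  · exact Filter.Eventually.of_forall fun x => norm_nonneg _
  simp only [← sub_mul, norm_mul, Real.norm_eq_abs]
  exact mul_le_mul_of_nonneg_right (hP _ (hσ1 x)).le (abs_nonneg _)

/-- Weierstrass approximation, with the error controlled by the `L¹` norms of the weights. -/
theorem integral_comp_eq_of_moments {w : X → ℝ} {v : Y → ℝ} (hw : Integrable w μ)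
    (hv : Integrable v ν) {σ : X → ℝ} {τ : Y → ℝ} (hσ : Measurable σ) (hτ : Measurable τ)
    (hσ1 : ∀ x, σ x ∈ Set.Icc (-1 : ℝ) 1) (hτ1 : ∀ y, τ y ∈ Set.Icc (-1 : ℝ) 1)
    (h : ∀ k : ℕ, ∫ x, σ x ^ k * w x ∂μ = ∫ y, τ y ^ k * v y ∂ν) {f : ℝ → ℝ}
    (hf : Continuous f) :
    ∫ x, f (σ x) * w x ∂μ = ∫ y, f (τ y) * v y ∂ν := by
  set A := ∫ x, |w x| ∂μ
  set B := ∫ y, |v y| ∂ν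
  have hA : 0 ≤ A := integral_nonneg fun _ => abs_nonneg _
  have hB : 0 ≤ B := integral_nonneg fun _ => abs_nonneg _
  refine eq_of_abs_sub_le_all fun ε hε => ?_
  have hδ : 0 < ε / (A + B + 1) := by positivity
  obtain ⟨P, hP⟩ := exists_polynomial_near_of_continuousOn (-1) 1 f hf.continuousOn _ hδ
  have h1 := abs_integral_eval_sub_le hw hσ hσ1 hf P hP
  have h2 := abs_integral_eval_sub_le hv hτ hτ1 hf P hP
  rw [integral_eval_eq_of_moments hw hv hσ hτ hσ1 hτ1 h P] at h1
  have h3 : ε / (A + B + 1) * A + ε / (A + B + 1) * B ≤ ε := by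
    rw [← mul_add, div_mul_eq_mul_div, div_le_iff₀ (by positivity)]
    nlinarith
  rw [abs_le] at *
  constructor <;> linarith [h1.1, h1.2, h2.1, h2.2]

theorem integral_map_withDensity {w : X → ℝ} (hw : Integrable w μ) (hw0 : 0 ≤ᵐ[μ] w) {σ : X → ℝ}
    (hσ : Measurable σ) {f : ℝ → ℝ} (hf : Continuous f) :
    ∫ t, f t ∂((μ.withDensity fun x => ENNReal.ofReal (w x)).map σ) = ∫ x, f (σ x) * w x ∂μ := by
  rw [integral_map hσ.aemeasurable hf.aestronglyMeasurable,
    integral_withDensity_eq_integral_toReal_smul₀ hw.aemeasurable.ennreal_ofReal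
      (Filter.Eventually.of_forall fun _ => ENNReal.ofReal_lt_top)]
  refine integral_congr_ae ?_
  filter_upwards [hw0] with x hx
  rw [ENNReal.toReal_ofReal hx, smul_eq_mul, mul_comm]

/-- Finite measures with densities that are transported to `[-1, 1]` with the same moments agree. -/
theorem map_withDensity_eq_of_moments {w : X → ℝ} {v : Y → ℝ} (hw : Integrable w μ)
    (hv : Integrable v ν) (hw0 : 0 ≤ᵐ[μ] w) (hv0 : 0 ≤ᵐ[ν] v) {σ : X → ℝ} {τ : Y → ℝ}
    (hσ : Measurable σ) (hτ : Measurable τ)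
    (hσ1 : ∀ x, σ x ∈ Set.Icc (-1 : ℝ) 1) (hτ1 : ∀ y, τ y ∈ Set.Icc (-1 : ℝ) 1)
    (h : ∀ k : ℕ, ∫ x, σ x ^ k * w x ∂μ = ∫ y, τ y ^ k * v y ∂ν) :
    (μ.withDensity fun x => ENNReal.ofReal (w x)).map σ =
      (ν.withDensity fun y => ENNReal.ofReal (v y)).map τ := by
  have := isFiniteMeasure_withDensity_ofReal hw.2
  have := isFiniteMeasure_withDensity_ofReal hv.2
  refine ext_of_forall_integral_eq_of_IsFiniteMeasure fun f => ?_
  rw [integral_map_withDensity hw hw0 hσ f.continuous, integral_map_withDensity hv hv0 hτ f.continuous]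
  exact integral_comp_eq_of_moments hw hv hσ hτ hσ1 hτ1 h f.continuous

theorem setIntegral_preimage_eq_of_moments {w : X → ℝ} {v : Y → ℝ} (hw : Integrable w μ)
    (hv : Integrable v ν) (hw0 : 0 ≤ᵐ[μ] w) (hv0 : 0 ≤ᵐ[ν] v) {σ : X → ℝ} {τ : Y → ℝ}
    (hσ : Measurable σ) (hτ : Measurable τ)
    (hσ1 : ∀ x, σ x ∈ Set.Icc (-1 : ℝ) 1) (hτ1 : ∀ y, τ y ∈ Set.Icc (-1 : ℝ) 1)
    (h : ∀ k : ℕ, ∫ x, σ x ^ k * w x ∂μ = ∫ y, τ y ^ k * v y ∂ν) {A : Set ℝ}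
    (hA : MeasurableSet A) :
    ∫ x in σ ⁻¹' A, w x ∂μ = ∫ y in τ ⁻¹' A, v y ∂ν := by
  have h1 := congrArg (fun κ : Measure ℝ => (κ A).toReal)
    (map_withDensity_eq_of_moments hw hv hw0 hv0 hσ hτ hσ1 hτ1 h)
  simp only [Measure.map_apply hσ hA, Measure.map_apply hτ hA,
    withDensity_apply _ (hσ hA), withDensity_apply _ (hτ hA)] at h1
  rw [integral_eq_lintegral_of_nonneg_ae (ae_restrict_of_ae hw0) hw.aestronglyMeasurable.restrict,
    integral_eq_lintegral_of_nonneg_ae (ae_restrict_of_ae hv0) hv.aestronglyMeasurable.restrict]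
  exact h1
end Moments

/-! ### The distribution of the distance from a point. -/

section Pushforward
open Real

variable {n : ℕ}

theorem sphereVol_pos (n : ℕ) : 0 < sphereVol n := by
  have : Nonempty (UnitSphere n) := ⟨⟨EuclideanSpace.single 0 1, by simp⟩⟩
  exact ENNReal.toReal_pos (isOpen_univ.measure_pos _ Set.univ_nonempty).ne' (measure_ne_top _ _)

theorem continuous_sphereDist (p : UnitSphere n) : Continuous (sphereDist p) :=
  continuous_arccos.comp (continuous_sphereInner p)

theorem cos_sphereDist (p q : UnitSphere n) : cos (sphereDist p q) = sphereInner p q :=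
  cos_arccos (sphereInner_mem_Icc p q).1 (sphereInner_mem_Icc p q).2

theorem sphereDist_mem_Icc (p q : UnitSphere n) : sphereDist p q ∈ Set.Icc 0 π :=
  ⟨arccos_nonneg _, arccos_le_pi _⟩

theorem sphereDist_comm (p q : UnitSphere n) : sphereDist p q = sphereDist q p :=
  congrArg arccos (sphereInner_comm p q)

theorem sphereDist_pos {p q : UnitSphere n} (h : p ≠ q) : 0 < sphereDist p q :=
  arccos_pos.2 (lt_of_le_of_ne (sphereInner_mem_Icc p q).2 (mt sphereInner_eq_one_iff.1 h))

theorem sphereDist_self (p : UnitSphere n) : sphereDist p p = 0 := by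
  have : sphereDist p p = arccos (sphereInner p p) := rfl
  rw [this, sphereInner_self, arccos_one]

theorem measurableSet_geodesicBall (p : UnitSphere n) (a : ℝ) : MeasurableSet (geodesicBall p a) :=
  (isOpen_lt (continuous_sphereDist p) continuous_const).measurableSet

/-- Both integrals vanish on the range of `zonalOp n`, so modulo that range only constants need
comparing; this avoids slicing the sphere. -/
theorem integral_eval_sphereInner (hn : 1 ≤ n) (p : UnitSphere n) (P : Polynomial ℝ) :
    ∫ q, P.eval (sphereInner p q) ∂(sphereMeasure n) =
      sphereVol n / capVol n π * ∫ s in (0 : ℝ)..π, P.eval (cos s) * sin s ^ (n - 1) := by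
  obtain ⟨Q, c, hQ⟩ := exists_zonalOp_eq_sub_C hn P
  have h1 := integral_eval_zonalOp hn p Q
  have h2 := integral_zonalOp_cos hn Q π
  have hc := continuous_sphereInner p
  have hB := capVol_pos (n := n) pi_pos le_rfl
  simp only [hQ, Polynomial.eval_sub, Polynomial.eval_C, sub_mul] at h1 h2
  rw [integral_sub (Continuous.integrable_sphereMeasure (by fun_prop)) (integrable_const c),
    integral_const, sub_eq_zero] at h1
  rw [intervalIntegral.integral_sub (Continuous.intervalIntegrable (by fun_prop) _ _)
    (Continuous.intervalIntegrable (by fun_prop) _ _), intervalIntegral.integral_const_mul,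
    sin_pi, zero_pow (by omega), mul_zero, sub_eq_zero] at h2
  rw [h1, h2]
  change sphereVol n • c = sphereVol n / capVol n π * (c * capVol n π)
  rw [smul_eq_mul]
  field_simp

theorem map_sphereDist (hn : 1 ≤ n) (p : UnitSphere n) :
    (sphereMeasure n).map (sphereDist p) = (volume.restrict (Set.Ioc 0 π)).withDensity
      fun s => ENNReal.ofReal (sphereVol n / capVol n π * sin s ^ (n - 1)) := by
  have hC : 0 ≤ sphereVol n / capVol n π :=
    div_nonneg (sphereVol_pos n).le (capVol_pos pi_pos le_rfl).le
  have h := map_withDensity_eq_of_moments (μ := sphereMeasure n)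
    (ν := volume.restrict (Set.Ioc 0 π)) (w := fun _ => 1)
    (v := fun s => sphereVol n / capVol n π * sin s ^ (n - 1)) (integrable_const _)
    (((continuous_sin_pow _).const_mul _).integrableOn_Ioc)
    (Filter.Eventually.of_forall fun _ => zero_le_one)
    (by filter_upwards [ae_restrict_mem measurableSet_Ioc] with s hs
        exact mul_nonneg hC (sin_pow_nonneg ⟨hs.1.le, hs.2⟩ _))
    (continuous_sphereInner p).measurable measurable_cos (sphereInner_mem_Icc p)
    (fun s => ⟨neg_one_le_cos s, cos_le_one s⟩) (by
      intro k
      have := integral_eval_sphereInner hn p (Polynomial.X ^ k)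
      simp only [Polynomial.eval_pow, Polynomial.eval_X] at this
      simp only [mul_one, this]
      rw [intervalIntegral.integral_of_le pi_pos.le, ← integral_const_mul]
      congr 1; funext s; ring)
  simp only [ENNReal.ofReal_one] at h
  rw [show (fun _ : UnitSphere n => (1 : ENNReal)) = 1 from rfl, withDensity_one] at h
  -- The moments give the law of `⟨p, q⟩ = cos (sphereDist p q)`; pushing it forward by `arccos`
  -- gives the law of the distance.
  have h2 := congrArg (Measure.map arccos) h
  rw [Measure.map_map continuous_arccos.measurable (continuous_sphereInner p).measurable,
    Measure.map_map continuous_arccos.measurable measurable_cos] at h2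
  refine Eq.trans h2 ?_
  rw [Measure.map_congr (g := id), Measure.map_id]
  refine (withDensity_absolutelyContinuous _ _).ae_le ?_
  filter_upwards [ae_restrict_mem measurableSet_Ioc] with s hs
  exact arccos_cos hs.1.le hs.2

theorem integral_comp_sphereDist (hn : 1 ≤ n) (p : UnitSphere n) {g : ℝ → ℝ}
    (hg : AEStronglyMeasurable g (volume.restrict (Set.Ioc 0 π))) :
    ∫ q, g (sphereDist p q) ∂(sphereMeasure n) =
      sphereVol n / capVol n π * ∫ s in (0 : ℝ)..π, g s * sin s ^ (n - 1) := by
  have hC : 0 ≤ sphereVol n / capVol n π :=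
    div_nonneg (sphereVol_pos n).le (capVol_pos pi_pos le_rfl).le
  have hg' := hg.mono_ac (withDensity_absolutelyContinuous (volume.restrict (Set.Ioc 0 π))
    fun s => ENNReal.ofReal (sphereVol n / capVol n π * sin s ^ (n - 1)))
  rw [← map_sphereDist hn p] at hg'
  rw [← integral_map (continuous_sphereDist p).aemeasurable hg', map_sphereDist hn p,
    integral_withDensity_eq_integral_toReal_smul₀ (by fun_prop)
      (Filter.Eventually.of_forall fun _ => ENNReal.ofReal_lt_top),
    intervalIntegral.integral_of_le pi_pos.le, ← integral_const_mul]
  refine setIntegral_congr_fun measurableSet_Ioc fun s hs => ?_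
  simp only [smul_eq_mul]
  rw [ENNReal.toReal_ofReal (mul_nonneg hC (sin_pow_nonneg ⟨hs.1.le, hs.2⟩ _))]
  ring

theorem integrable_comp_sphereDist (hn : 1 ≤ n) (p : UnitSphere n) {g : ℝ → ℝ}
    (hg : AEStronglyMeasurable g (volume.restrict (Set.Ioc 0 π)))
    (hi : IntegrableOn (fun s => g s * sin s ^ (n - 1)) (Set.Ioc 0 π)) :
    Integrable (fun q => g (sphereDist p q)) (sphereMeasure n) := by
  have hC : 0 ≤ sphereVol n / capVol n π :=
    div_nonneg (sphereVol_pos n).le (capVol_pos pi_pos le_rfl).le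
  have hg' := hg.mono_ac (withDensity_absolutelyContinuous (volume.restrict (Set.Ioc 0 π))
    fun s => ENNReal.ofReal (sphereVol n / capVol n π * sin s ^ (n - 1)))
  rw [← map_sphereDist hn p] at hg'
  refine (integrable_map_measure hg' (continuous_sphereDist p).aemeasurable).1 ?_
  rw [map_sphereDist hn p, integrable_withDensity_iff_integrable_smul₀' (by fun_prop)
    (Filter.Eventually.of_forall fun _ => ENNReal.ofReal_lt_top)]
  refine (hi.const_mul (sphereVol n / capVol n π)).congr ?_
  filter_upwards [ae_restrict_mem measurableSet_Ioc] with s hs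
  rw [ENNReal.toReal_ofReal (mul_nonneg hC (sin_pow_nonneg ⟨hs.1.le, hs.2⟩ _)), smul_eq_mul]
  ring

theorem sphereMeasure_singleton (hn : 1 ≤ n) (p : UnitSphere n) : sphereMeasure n {p} = 0 := by
  have h0 : (sphereMeasure n).map (sphereDist p) {0} = 0 := by
    rw [map_sphereDist hn p]
    exact withDensity_absolutelyContinuous _ _ (by simp)
  rw [Measure.map_apply (continuous_sphereDist p).measurable (measurableSet_singleton 0)] at h0
  exact measure_mono_null (fun q hq => by rw [Set.mem_singleton_iff.1 hq]; exact sphereDist_self p) h0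

theorem measureReal_geodesicBall (hn : 1 ≤ n) (p : UnitSphere n) {a : ℝ} (ha : 0 ≤ a)
    (haπ : a ≤ π) :
    (sphereMeasure n).real (geodesicBall p a) = sphereVol n / capVol n π * capVol n a := by
  have h := integral_comp_sphereDist hn p (g := (Set.Iio a).indicator 1)
    ((measurable_one.indicator measurableSet_Iio).aestronglyMeasurable)
  have e1 : ∀ q, (Set.Iio a).indicator (1 : ℝ → ℝ) (sphereDist p q) =
      (geodesicBall p a).indicator 1 q := fun q => rfl
  simp_rw [e1] at h
  rw [integral_indicator_one (measurableSet_geodesicBall p a)] at h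
  rw [h]
  congr 1
  rw [capVol, intervalIntegral.integral_of_le ha, intervalIntegral.integral_of_le pi_pos.le,
    integral_Ioc_eq_integral_Ioo (x := 0) (y := a)]
  have e2 : ∀ s, (Set.Iio a).indicator (1 : ℝ → ℝ) s * sin s ^ (n - 1) =
      (Set.Iio a).indicator (fun s => sin s ^ (n - 1)) s := fun s => by
    by_cases hs : s ∈ Set.Iio a <;> simp [hs]
  simp_rw [e2]
  rw [setIntegral_indicator measurableSet_Iio]
  congr 2
  ext s
  simp only [Set.mem_inter_iff, Set.mem_Ioc, Set.mem_Iio, Set.mem_Ioo]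
  constructor
  · rintro ⟨⟨h1, -⟩, h3⟩; exact ⟨h1, h3⟩
  · rintro ⟨h1, h2⟩; exact ⟨⟨h1, (h2.trans_le haπ).le⟩, h2⟩

end Pushforward

/-! ### Polynomial approximations of the Green kernel. -/

section Existence
open Real Filter Topology

variable {n : ℕ}

/-- The base `(1 + ⟨p, q⟩) / 2` lies in `[0, 1]` and attains `1` only at `q = p`, so its normalized
powers concentrate there: polynomial approximations of `δ_p`. -/
theorem tendsto_peak_sphereInner (p : UnitSphere n) {h : UnitSphere n → ℝ}
    (hi : Integrable h (sphereMeasure n)) (hc : ContinuousAt h p) :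
    Tendsto (fun m : ℕ => (∫ q, ((1 + sphereInner p q) / 2) ^ m ∂(sphereMeasure n))⁻¹ *
      ∫ q, ((1 + sphereInner p q) / 2) ^ m * h q ∂(sphereMeasure n)) atTop (𝓝 (h p)) := by
  have hcont := continuous_sphereInner p
  have := tendsto_setIntegral_pow_smul_of_unique_maximum_of_isCompact_of_integrableOn
    (μ := sphereMeasure n) (s := Set.univ) (x₀ := p) (c := fun q => (1 + sphereInner p q) / 2)
    (g := h) isCompact_univ (by fun_prop) (fun q _ hq => ?_) (fun q _ => ?_) ?_ (by simp)
    hi.integrableOn hc.continuousWithinAt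
  · simpa using this
  · have h1 : sphereInner p q < 1 :=
      lt_of_le_of_ne (sphereInner_mem_Icc p q).2 fun h => hq (sphereInner_eq_one_iff.1 h).symm
    simp only [sphereInner_self]
    linarith
  · have := (sphereInner_mem_Icc p q).1
    linarith
  · simp [sphereInner_self]

theorem intervalIntegrable_capVol_compl_div {θ : ℝ} (h0 : 0 < θ) (hθ : θ ≤ π) :
    IntervalIntegrable (fun s => (capVol n π - capVol n s) / sin s ^ (n - 1)) volume θ π := by
  have h := (intervalIntegrable_capVol_div (n := n) (a := 0) (b := π - θ) le_rfl (by linarith)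
    (by linarith)).comp_sub_left π
  simp only [sub_zero, sub_sub_cancel, capVol_pi_sub, sin_pi_sub] at h
  exact h.symm

theorem capPot_pi_sub (n : ℕ) (θ : ℝ) :
    capPot n (π - θ) = ∫ s in θ..π, (capVol n π - capVol n s) / sin s ^ (n - 1) := by
  have h := intervalIntegral.integral_comp_sub_left (a := θ) (b := π)
    (fun s => capVol n s / sin s ^ (n - 1)) π
  simp only [capVol_pi_sub, sin_pi_sub, sub_self] at h
  rw [h, capPot]

theorem continuousOn_capPot_pi_sub (n : ℕ) :
    ContinuousOn (fun s => capPot n (π - s)) (Set.Ioc 0 π) :=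
  (continuousOn_capPot n).comp (by fun_prop) fun s hs => ⟨by linarith [hs.2], by linarith [hs.1]⟩

theorem aestronglyMeasurable_capPot_pi_sub (n : ℕ) :
    AEStronglyMeasurable (fun s => capPot n (π - s)) (volume.restrict (Set.Ioc 0 π)) :=
  (continuousOn_capPot_pi_sub n).aestronglyMeasurable measurableSet_Ioc

theorem intervalIntegrable_capPot_pi_sub_mul (n : ℕ) :
    IntervalIntegrable (fun s => capPot n (π - s) * sin s ^ (n - 1)) volume 0 π := by
  have h := (intervalIntegrable_capPot_mul n).comp_sub_left π
  simp only [sub_zero, sub_self, sin_pi_sub] at h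
  exact h.symm

theorem integrable_capPot_pi_sub (hn : 1 ≤ n) (p : UnitSphere n) :
    Integrable (fun q => capPot n (π - sphereDist p q)) (sphereMeasure n) :=
  integrable_comp_sphereDist hn p (aestronglyMeasurable_capPot_pi_sub n)
    ((intervalIntegrable_iff_integrableOn_Ioc_of_le pi_pos.le).1
      (intervalIntegrable_capPot_pi_sub_mul n))

open Polynomial in
/-- Bounds for the flux of a zonal polynomial whose Laplacian is a decreasing probability density
minus the uniform one. -/
theorem integral_zonal_density_mem_Icc (hn : 1 ≤ n) {ρ P : ℝ[X]} {v : ℝ}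
    (hP : zonalOp n P = ρ - C v) (hanti : AntitoneOn (fun s => ρ.eval (cos s)) (Set.Icc 0 π))
    (h0 : ∀ s, 0 ≤ ρ.eval (cos s)) {s : ℝ} (hs : s ∈ Set.Icc 0 π) :
    P.derivative.eval (cos s) * sin s ^ n ∈ Set.Icc 0 (v * (capVol n π - capVol n s)) := by
  have hint : ∀ (f : ℝ → ℝ) (hf : Continuous f) (a b : ℝ),
    IntervalIntegrable f volume a b := fun f hf a b => hf.intervalIntegrable a b
  have hF := fun θ => integral_zonalOp_cos hn P θ
  have hFπ := hF π
  rw [sin_pi, zero_pow (by omega), mul_zero] at hFπ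
  have hsplit : (∫ t in (0 : ℝ)..s, (zonalOp n P).eval (cos t) * sin t ^ (n - 1)) +
      ∫ t in s..π, (zonalOp n P).eval (cos t) * sin t ^ (n - 1) = 0 := by
    rw [intervalIntegral.integral_add_adjacent_intervals, hFπ] <;> exact hint _ (by fun_prop) _ _
  rw [hF s] at hsplit
  -- Upper bound: the total flux is zero, so the flux at `s` is minus the integral over `[s, π]`,
  -- where the density `ρ` is nonnegative.
  have hle : ∫ t in s..π, -(v * sin t ^ (n - 1)) ≤
      ∫ t in s..π, (zonalOp n P).eval (cos t) * sin t ^ (n - 1) := by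
    refine intervalIntegral.integral_mono_on hs.2 (hint _ (by fun_prop) _ _)
      (hint _ (by fun_prop) _ _) fun t ht => ?_
    have h1 := sin_pow_nonneg ⟨hs.1.trans ht.1, ht.2⟩ (n - 1)
    have h2 := mul_nonneg (h0 t) h1
    rw [hP, eval_sub, eval_C]
    linarith
  rw [intervalIntegral.integral_neg, intervalIntegral.integral_const_mul, ← capVol_sub] at hle
  refine ⟨?_, by linarith⟩
  -- Lower bound: as `ρ` decreases in the angle, either `ρ ≥ v` on all of `[0, s]` or `ρ ≤ v` on all
  -- of `[s, π]`.
  rcases le_total v (ρ.eval (cos s)) with h | h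
  · rw [← hF s]
    refine intervalIntegral.integral_nonneg hs.1 fun t ht => ?_
    have h1 := sin_pow_nonneg ⟨ht.1, ht.2.trans hs.2⟩ (n - 1)
    have h2 : ρ.eval (cos s) ≤ ρ.eval (cos t) := hanti ⟨ht.1, ht.2.trans hs.2⟩ hs ht.2
    rw [hP, eval_sub, eval_C]
    exact mul_nonneg (by linarith) h1
  · have h3 : 0 ≤ ∫ t in s..π, -((zonalOp n P).eval (cos t) * sin t ^ (n - 1)) := by
      refine intervalIntegral.integral_nonneg hs.2 fun t ht => ?_
      have h1 := sin_pow_nonneg ⟨hs.1.trans ht.1, ht.2⟩ (n - 1)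
      have h2 : ρ.eval (cos t) ≤ ρ.eval (cos s) := hanti hs ⟨hs.1.trans ht.1, ht.2⟩ ht.1
      rw [hP, eval_sub, eval_C, ← neg_mul]
      exact mul_nonneg (by linarith) h1
    rw [intervalIntegral.integral_neg] at h3
    linarith

open Polynomial in
theorem eval_cos_sub_eval_neg_one (P : ℝ[X]) (θ : ℝ) :
    P.eval (cos θ) - P.eval (-1) = ∫ s in θ..π, P.derivative.eval (cos s) * sin s := by
  have h : ∀ s, HasDerivAt (fun s => -P.eval (cos s)) (P.derivative.eval (cos s) * sin s) s := by
    intro s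
    refine ((P.hasDerivAt (cos s)).comp s (hasDerivAt_cos s)).neg.congr_deriv ?_
    ring
  rw [intervalIntegral.integral_eq_sub_of_hasDerivAt (fun s _ => h s)
    (Continuous.intervalIntegrable (by fun_prop) _ _), cos_pi]
  ring

theorem deriv_mul_sin_eq_div (hn : 1 ≤ n) (P : Polynomial ℝ) {s : ℝ} (hs : s ∈ Set.Ioo 0 π) :
    P.derivative.eval (cos s) * sin s =
      P.derivative.eval (cos s) * sin s ^ n / sin s ^ (n - 1) := by
  rw [eq_div_iff (sin_pow_pos hs _).ne', mul_assoc, ← pow_succ', Nat.sub_add_cancel hn]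

open Polynomial in
theorem eval_cos_sub_mem_Icc (hn : 1 ≤ n) {ρ P : ℝ[X]} {v : ℝ}
    (hP : zonalOp n P = ρ - C v) (hanti : AntitoneOn (fun s => ρ.eval (cos s)) (Set.Icc 0 π))
    (h0 : ∀ s, 0 ≤ ρ.eval (cos s)) {θ : ℝ} (hθ : θ ∈ Set.Ioc 0 π) :
    P.eval (cos θ) - P.eval (-1) ∈ Set.Icc 0 (v * capPot n (π - θ)) := by
  have hb : ∀ s ∈ Set.Ioo θ π, P.derivative.eval (cos s) * sin s ∈
      Set.Icc 0 (v * ((capVol n π - capVol n s) / sin s ^ (n - 1))) := by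
    intro s hs
    have hs' : s ∈ Set.Ioo 0 π := ⟨hθ.1.trans hs.1, hs.2⟩
    have h1 := integral_zonal_density_mem_Icc hn hP hanti h0 ⟨hs'.1.le, hs'.2.le⟩
    have h2 := sin_pow_pos hs' (n - 1)
    rw [deriv_mul_sin_eq_div hn P hs', ← mul_div_assoc]
    exact ⟨div_nonneg h1.1 h2.le, div_le_div_of_nonneg_right h1.2 h2.le⟩
  have hi1 : IntervalIntegrable (fun s => P.derivative.eval (cos s) * sin s) volume θ π :=
    Continuous.intervalIntegrable (by fun_prop) _ _
  have hi2 := (intervalIntegrable_capVol_compl_div (n := n) hθ.1 hθ.2).const_mul v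
  rw [eval_cos_sub_eval_neg_one, capPot_pi_sub, ← intervalIntegral.integral_const_mul]
  refine ⟨?_, intervalIntegral.integral_mono_on_of_le_Ioo hθ.2 hi1 hi2 fun s hs => (hb s hs).2⟩
  have := intervalIntegral.integral_mono_on_of_le_Ioo hθ.2
    (intervalIntegrable_const (c := (0 : ℝ))) hi1 fun s hs => (hb s hs).1
  simpa using this

/-- Polynomial approximations of the zonal Green kernel. -/
theorem exists_zonal_approximation (hn : 1 ≤ n) (p : UnitSphere n) :
    ∃ P : ℕ → Polynomial ℝ,
      (∀ m, zonalOp n (P m) =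
        Polynomial.C (∫ q, ((1 + sphereInner p q) / 2) ^ m ∂(sphereMeasure n))⁻¹ *
          (Polynomial.C (1 / 2) * (1 + Polynomial.X)) ^ m - Polynomial.C (sphereVol n)⁻¹) ∧
      (∀ m, ∀ θ ∈ Set.Ioc 0 π, |(P m).eval (cos θ) - (P m).eval (-1)| ≤
        (sphereVol n)⁻¹ * capPot n (π - θ)) ∧
      ∀ θ ∈ Set.Ioc 0 π, Tendsto (fun m => (P m).eval (cos θ) - (P m).eval (-1)) atTop
        (𝓝 ((sphereVol n)⁻¹ * capPot n (π - θ))) := by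
  set W : ℕ → ℝ := fun m => ∫ q, ((1 + sphereInner p q) / 2) ^ m ∂(sphereMeasure n)
  set ρ : ℕ → Polynomial ℝ := fun m =>
    Polynomial.C (W m)⁻¹ * (Polynomial.C (1 / 2) * (1 + Polynomial.X)) ^ m
  have hcont := continuous_sphereInner p
  have hV := sphereVol_pos n
  have hB := capVol_pos (n := n) pi_pos le_rfl
  have hρe : ∀ m t, (ρ m).eval t = (W m)⁻¹ * ((1 + t) / 2) ^ m := by
    intro m t
    simp only [ρ, Polynomial.eval_mul, Polynomial.eval_C, Polynomial.eval_pow, Polynomial.eval_add,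
      Polynomial.eval_one, Polynomial.eval_X]
    rw [show 1 / 2 * (1 + t) = (1 + t) / 2 by ring]
  have hbase : ∀ q, 0 ≤ (1 + sphereInner p q) / 2 := fun q => by
    linarith [(sphereInner_mem_Icc p q).1]
  have hW : ∀ m, 0 < W m := by
    intro m
    have hc : Continuous fun q => ((1 + sphereInner p q) / 2) ^ m := by fun_prop
    refine hc.integral_pos_of_hasCompactSupport_nonneg_nonzero
      (HasCompactSupport.of_compactSpace _) (fun q => pow_nonneg (hbase q) m) (x := p) ?_
    simp [sphereInner_self]
  have hρ0 : ∀ m s, 0 ≤ (ρ m).eval (cos s) := fun m s => by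
    rw [hρe]
    exact mul_nonneg (inv_nonneg.2 (hW m).le) (pow_nonneg (by linarith [neg_one_le_cos s]) m)
  have hanti : ∀ m, AntitoneOn (fun s => (ρ m).eval (cos s)) (Set.Icc 0 π) := by
    intro m s hs t ht hst
    simp only [hρe]
    refine mul_le_mul_of_nonneg_left (pow_le_pow_left₀ (by linarith [neg_one_le_cos t]) ?_ m)
      (inv_nonneg.2 (hW m).le)
    linarith [cos_le_cos_of_nonneg_of_le_pi hs.1 ht.2 hst]
  have hmass : ∀ m, ∫ q, (ρ m).eval (sphereInner p q) ∂(sphereMeasure n) = 1 := by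
    intro m
    simp_rw [hρe]
    rw [integral_const_mul]
    exact inv_mul_cancel₀ (hW m).ne'
  have hex : ∀ m, ∃ P, zonalOp n P = ρ m - Polynomial.C (sphereVol n)⁻¹ := by
    intro m
    -- The constant is forced to be `1 / V_n`, because `ρ m` has mass `1` and the Laplacian has
    -- integral `0`.
    obtain ⟨P, c, hP⟩ := exists_zonalOp_eq_sub_C hn (ρ m)
    have h1 := integral_eval_zonalOp hn p P
    simp only [hP, Polynomial.eval_sub, Polynomial.eval_C] at h1
    rw [integral_sub (Continuous.integrable_sphereMeasure (by fun_prop)) (integrable_const c),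
      integral_const, hmass] at h1
    change 1 - sphereVol n • c = 0 at h1
    rw [smul_eq_mul, sub_eq_zero] at h1
    refine ⟨P, ?_⟩
    rw [hP, eq_inv_of_mul_eq_one_right h1.symm]
  choose P hP using hex
  refine ⟨P, hP, fun m θ hθ => ?_, fun θ hθ => ?_⟩
  · have h := eval_cos_sub_mem_Icc hn (hP m) (hanti m) (hρ0 m) hθ
    rw [abs_of_nonneg h.1]
    exact h.2
  -- The flux at `s` is the mass of `ρ m` in the ball of radius `s`, suitably normalized, minus the
  -- uniform mass there; applying the peak limit to the indicator of the ball shows that the first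
  -- tends to its full value.
  · have hflux : ∀ s ∈ Set.Ioo 0 π, Tendsto
        (fun m => (P m).derivative.eval (cos s) * sin s ^ n) atTop
        (𝓝 ((sphereVol n)⁻¹ * (capVol n π - capVol n s))) := by
      intro s hs
      have hind : Integrable ((geodesicBall p s).indicator (1 : UnitSphere n → ℝ))
        (sphereMeasure n) := (integrable_const 1).indicator (measurableSet_geodesicBall p s)
      have hat : ContinuousAt ((geodesicBall p s).indicator (1 : UnitSphere n → ℝ)) p := by
        refine (continuousAt_const (y := (1 : ℝ))).congr ?_
        have : ∀ᶠ q in 𝓝 p, sphereDist p q < s :=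
          (continuous_sphereDist p).continuousAt.eventually_lt continuousAt_const
            (by rw [sphereDist_self]; exact hs.1)
        filter_upwards [this] with q hq
        rw [Set.indicator_of_mem (show q ∈ geodesicBall p s from hq), Pi.one_apply]
      have hpk := tendsto_peak_sphereInner p hind hat
      rw [Set.indicator_of_mem (show p ∈ geodesicBall p s by
        change sphereDist p p < s; rw [sphereDist_self]; exact hs.1)] at hpk
      have e1 : ∀ m, (W m)⁻¹ * ∫ q, ((1 + sphereInner p q) / 2) ^ m *
          (geodesicBall p s).indicator (1 : UnitSphere n → ℝ) q ∂(sphereMeasure n) =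
          sphereVol n / capVol n π * ∫ t in (0 : ℝ)..s, (ρ m).eval (cos t) * sin t ^ (n - 1) := by
        intro m
        have h := integral_comp_sphereDist hn p
          (g := (Set.Iio s).indicator fun t => (ρ m).eval (cos t))
          (((by fun_prop : Continuous fun t => (ρ m).eval (cos t)).measurable.indicator
            measurableSet_Iio).aestronglyMeasurable)
        have e2 : ∀ q, (Set.Iio s).indicator (fun t => (ρ m).eval (cos t)) (sphereDist p q) =
            (W m)⁻¹ * (((1 + sphereInner p q) / 2) ^ m *
              (geodesicBall p s).indicator (1 : UnitSphere n → ℝ) q) := by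
          intro q
          by_cases hq : sphereDist p q < s
          · rw [Set.indicator_of_mem (show sphereDist p q ∈ Set.Iio s from hq),
              Set.indicator_of_mem (show q ∈ geodesicBall p s from hq), cos_sphereDist, hρe]
            simp
          · rw [Set.indicator_of_notMem (show sphereDist p q ∉ Set.Iio s from hq),
              Set.indicator_of_notMem (show q ∉ geodesicBall p s from hq)]
            simp
        simp_rw [e2] at h
        rw [integral_const_mul] at h
        rw [h]
        congr 1
        rw [intervalIntegral.integral_of_le hs.1.le, intervalIntegral.integral_of_le pi_pos.le,
          integral_Ioc_eq_integral_Ioo (x := 0) (y := s)]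
        have e3 : ∀ t, (Set.Iio s).indicator (fun t => (ρ m).eval (cos t)) t * sin t ^ (n - 1) =
            (Set.Iio s).indicator (fun t => (ρ m).eval (cos t) * sin t ^ (n - 1)) t := fun t => by
          by_cases ht : t ∈ Set.Iio s <;> simp [ht]
        simp_rw [e3]
        rw [setIntegral_indicator measurableSet_Iio]
        congr 2
        ext t
        simp only [Set.mem_inter_iff, Set.mem_Ioc, Set.mem_Iio, Set.mem_Ioo]
        exact ⟨fun h => ⟨h.1.1, h.2⟩, fun h => ⟨⟨h.1, (h.2.trans hs.2).le⟩, h.2⟩⟩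
      have e4 : ∀ m, (P m).derivative.eval (cos s) * sin s ^ n =
          capVol n π / sphereVol n * (sphereVol n / capVol n π *
            ∫ t in (0 : ℝ)..s, (ρ m).eval (cos t) * sin t ^ (n - 1)) -
            (sphereVol n)⁻¹ * capVol n s := by
        intro m
        rw [← integral_zonalOp_cos hn (P m) s]
        simp only [hP, Polynomial.eval_sub, Polynomial.eval_C, sub_mul]
        rw [intervalIntegral.integral_sub (Continuous.intervalIntegrable (by fun_prop) _ _)
          (Continuous.intervalIntegrable (by fun_prop) _ _), intervalIntegral.integral_const_mul]
        rw [show ∫ t in (0 : ℝ)..s, sin t ^ (n - 1) = capVol n s from rfl]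
        field_simp
      have hlim := (hpk.const_mul (capVol n π / sphereVol n)).sub_const
        ((sphereVol n)⁻¹ * capVol n s)
      rw [show capVol n π / sphereVol n * (1 : UnitSphere n → ℝ) p -
        (sphereVol n)⁻¹ * capVol n s = (sphereVol n)⁻¹ * (capVol n π - capVol n s) by
          rw [Pi.one_apply]; ring] at hlim
      exact hlim.congr fun m => by rw [e4, ← e1]
    simp_rw [eval_cos_sub_eval_neg_one]
    rw [capPot_pi_sub, ← intervalIntegral.integral_const_mul]
    -- The flux bounds, uniform in `m`, provide the dominating function, integrable on `[θ, π]`.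
    refine intervalIntegral.tendsto_integral_filter_of_dominated_convergence
      (fun s => (sphereVol n)⁻¹ * ((capVol n π - capVol n s) / sin s ^ (n - 1)))
      (Eventually.of_forall fun m => Continuous.aestronglyMeasurable (by fun_prop))
      (Eventually.of_forall fun m => ?_)
      ((intervalIntegrable_capVol_compl_div hθ.1 hθ.2).const_mul _) ?_
    · have : ∀ᵐ s : ℝ, s ≠ π := Measure.ae_ne volume π
      filter_upwards [this] with s hsπ hs
      rw [Set.uIoc_of_le hθ.2] at hs
      have hs' : s ∈ Set.Ioo 0 π := ⟨hθ.1.trans hs.1, lt_of_le_of_ne hs.2 hsπ⟩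
      have h1 := integral_zonal_density_mem_Icc hn (hP m) (hanti m) (hρ0 m) ⟨hs'.1.le, hs'.2.le⟩
      have h2 := sin_pow_pos hs' (n - 1)
      rw [deriv_mul_sin_eq_div hn _ hs', ← mul_div_assoc, Real.norm_of_nonneg (div_nonneg h1.1 h2.le)]
      exact div_le_div_of_nonneg_right h1.2 h2.le
    · have : ∀ᵐ s : ℝ, s ≠ π := Measure.ae_ne volume π
      filter_upwards [this] with s hsπ hs
      rw [Set.uIoc_of_le hθ.2] at hs
      have hs' : s ∈ Set.Ioo 0 π := ⟨hθ.1.trans hs.1, lt_of_le_of_ne hs.2 hsπ⟩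
      have h1 := (hflux s hs').div_const (sin s ^ (n - 1))
      rw [← mul_div_assoc]
      exact h1.congr fun m => (deriv_mul_sin_eq_div hn _ hs').symm

end Existence

/-! ### Existence, uniqueness and formula for the Green function. -/

section Green
open Real Filter Topology

variable {n : ℕ}

/-- The zonal Green kernel, up to an additive constant. -/
def zonalKernel (p q : UnitSphere n) : ℝ := (sphereVol n)⁻¹ * capPot n (π - sphereDist p q)

/-- The mean of the zonal Green kernel. -/
def zonalMean (n : ℕ) : ℝ :=
  (capVol n π)⁻¹ * ∫ s in (0 : ℝ)..π, (sphereVol n)⁻¹ * (capPot n (π - s) * sin s ^ (n - 1))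

theorem integrable_zonalKernel (hn : 1 ≤ n) (p : UnitSphere n) :
    Integrable (zonalKernel p) (sphereMeasure n) :=
  (integrable_capPot_pi_sub hn p).const_mul _

theorem zonalKernel_nonneg (p q : UnitSphere n) : 0 ≤ zonalKernel p q :=
  mul_nonneg (inv_nonneg.2 (sphereVol_pos n).le) (capPot_nonneg
    ⟨by linarith [(sphereDist_mem_Icc p q).2], by linarith [(sphereDist_mem_Icc p q).1]⟩)

theorem continuousOn_zonalKernel (p : UnitSphere n) : ContinuousOn (zonalKernel p) {p}ᶜ := by
  refine continuousOn_const.mul ?_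
  refine (continuousOn_capPot n).comp
    (continuous_const.sub (continuous_sphereDist p)).continuousOn fun q hq => ?_
  have h1 := sphereDist_pos (Ne.symm (show q ≠ p from hq))
  exact ⟨by linarith [(sphereDist_mem_Icc p q).2], by linarith⟩

theorem integral_zonalKernel (hn : 1 ≤ n) (p : UnitSphere n) :
    ∫ q, zonalKernel p q ∂(sphereMeasure n) = sphereVol n * zonalMean n := by
  simp only [zonalKernel]
  rw [integral_const_mul, integral_comp_sphereDist hn p (aestronglyMeasurable_capPot_pi_sub n),
    zonalMean, intervalIntegral.integral_const_mul]
  have := sphereVol_pos n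
  field_simp

theorem ae_ne_sphere (hn : 1 ≤ n) (p : UnitSphere n) : ∀ᵐ q ∂(sphereMeasure n), q ≠ p :=
  measure_eq_zero_iff_ae_notMem.1 (sphereMeasure_singleton hn p)

theorem integral_sphereLaplacian (hn : 1 ≤ n) {φ : UnitSphere n → ℝ}
    (hφ : ContMDiff (𝓡 n) 𝓘(ℝ, ℝ) ∞ φ) (p : UnitSphere n) :
    ∫ q, sphereLaplacian φ q ∂(sphereMeasure n) = 0 := by
  have h := integral_eval_mul_sphereLaplacian hn p hφ 1
  simpa [zonalOp] using h

theorem integral_zonalKernel_mul_sphereLaplacian (hn : 1 ≤ n) (p : UnitSphere n)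
    {φ : UnitSphere n → ℝ} (hφ : ContMDiff (𝓡 n) 𝓘(ℝ, ℝ) ∞ φ) :
    ∫ q, zonalKernel p q * sphereLaplacian φ q ∂(sphereMeasure n) =
      φ p - (sphereVol n)⁻¹ * ∫ q, φ q ∂(sphereMeasure n) := by
  obtain ⟨P, hP, hbd, hlim⟩ := exists_zonal_approximation hn p
  have hL := continuous_sphereLaplacian hφ
  have hφc := hφ.continuous
  have hcont := continuous_sphereInner p
  obtain ⟨M, hM⟩ := isCompact_univ.exists_bound_of_continuousOn hL.continuousOn
  have e1 : ∀ m, ∫ q, ((P m).eval (sphereInner p q) - (P m).eval (-1)) * sphereLaplacian φ q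
      ∂(sphereMeasure n) =
      (∫ q, ((1 + sphereInner p q) / 2) ^ m ∂(sphereMeasure n))⁻¹ *
        ∫ q, ((1 + sphereInner p q) / 2) ^ m * φ q ∂(sphereMeasure n) -
      (sphereVol n)⁻¹ * ∫ q, φ q ∂(sphereMeasure n) := by
    intro m
    simp only [sub_mul]
    rw [integral_sub (Continuous.integrable_sphereMeasure (by fun_prop))
      (Continuous.integrable_sphereMeasure (by fun_prop)), integral_const_mul,
      integral_sphereLaplacian hn hφ p, mul_zero, sub_zero,
      integral_eval_mul_sphereLaplacian hn p hφ, hP]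
    simp only [Polynomial.eval_sub, Polynomial.eval_mul, Polynomial.eval_C, Polynomial.eval_pow,
      Polynomial.eval_add, Polynomial.eval_one, Polynomial.eval_X, sub_mul, mul_assoc]
    rw [integral_sub (Continuous.integrable_sphereMeasure (by fun_prop))
      (Continuous.integrable_sphereMeasure (by fun_prop)), integral_const_mul, integral_const_mul]
    have e : ∀ q, 1 / 2 * (1 + sphereInner p q) = (1 + sphereInner p q) / 2 := fun q => by ring
    simp_rw [e]
  have h1 : Tendsto (fun m => ∫ q, ((P m).eval (sphereInner p q) - (P m).eval (-1)) *
      sphereLaplacian φ q ∂(sphereMeasure n)) atTop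
      (𝓝 (φ p - (sphereVol n)⁻¹ * ∫ q, φ q ∂(sphereMeasure n))) := by
    simp_rw [e1]
    exact (tendsto_peak_sphereInner p hφc.integrable_sphereMeasure hφc.continuousAt).sub_const _
  refine tendsto_nhds_unique ?_ h1
  -- Subtracting `P m (-1)` costs nothing, since `sphereLaplacian φ` has integral zero, and it makes
  -- the approximations bounded by the integrable limit kernel.
  refine tendsto_integral_of_dominated_convergence (fun q => zonalKernel p q * M)
    (fun m => Continuous.aestronglyMeasurable (by fun_prop))
    ((integrable_zonalKernel hn p).mul_const M) (fun m => ?_) ?_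
  · filter_upwards [ae_ne_sphere hn p] with q hq
    rw [norm_mul]
    have h2 := hbd m _ ⟨sphereDist_pos hq.symm, (sphereDist_mem_Icc p q).2⟩
    rw [cos_sphereDist] at h2
    exact mul_le_mul h2 (hM q trivial) (norm_nonneg _) (zonalKernel_nonneg p q)
  · filter_upwards [ae_ne_sphere hn p] with q hq
    have h2 := hlim _ ⟨sphereDist_pos hq.symm, (sphereDist_mem_Icc p q).2⟩
    rw [cos_sphereDist] at h2
    exact h2.mul_const _

theorem isGreenFunction_zonalKernel (hn : 1 ≤ n) :
    IsGreenFunction n fun p q => zonalKernel p q - zonalMean n where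
  continuousOn p := (continuousOn_zonalKernel p).sub continuousOn_const
  integrable p := (integrable_zonalKernel hn p).sub (integrable_const _)
  laplacian p φ hφ := by
    have hL := continuous_sphereLaplacian hφ
    obtain ⟨M, hM⟩ := isCompact_univ.exists_bound_of_continuousOn hL.continuousOn
    have hi : Integrable (fun q => zonalKernel p q * sphereLaplacian φ q) (sphereMeasure n) :=
      (integrable_zonalKernel hn p).mul_bdd (c := M) hL.aestronglyMeasurable
        (Eventually.of_forall fun q => hM q trivial)
    simp only [sub_mul]
    rw [integral_sub hi (Continuous.integrable_sphereMeasure (by fun_prop)), integral_const_mul,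
      integral_sphereLaplacian hn hφ p, mul_zero, sub_zero,
      integral_zonalKernel_mul_sphereLaplacian hn p hφ]
  symm p q _ := by simp only [zonalKernel, sphereDist_comm p q]
  mean_zero p := by
    rw [integral_sub (integrable_zonalKernel hn p) (integrable_const _), integral_zonalKernel hn,
      integral_const]
    change sphereVol n * zonalMean n - sphereVol n • zonalMean n = 0
    rw [smul_eq_mul, sub_self]

/-- An integrable function which is weakly harmonic and of mean zero vanishes where it is
continuous. -/
theorem eq_zero_of_weakly_harmonic (hn : 1 ≤ n) {h : UnitSphere n → ℝ}
    (hi : Integrable h (sphereMeasure n)) (h0 : ∫ q, h q ∂(sphereMeasure n) = 0)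
    (hharm : ∀ φ : UnitSphere n → ℝ, ContMDiff (𝓡 n) 𝓘(ℝ, ℝ) ∞ φ →
      ∫ q, h q * sphereLaplacian φ q ∂(sphereMeasure n) = 0)
    {p : UnitSphere n} (hc : ContinuousAt h p) : h p = 0 := by
  have hcont := continuous_sphereInner p
  -- Every zonal polynomial is a Laplacian plus a constant, so weak harmonicity and mean zero make
  -- `h` orthogonal to all of them, in particular to the peak functions at `p`.
  have hP : ∀ f : Polynomial ℝ, ∫ q, f.eval (sphereInner p q) * h q ∂(sphereMeasure n) = 0 := by
    intro f
    obtain ⟨P, c, hPc⟩ := exists_zonalOp_eq_sub_C hn f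
    have h1 := hharm _ (contMDiff_eval_sphereInner p P)
    simp only [sphereLaplacian_eval_sphereInner, hPc, Polynomial.eval_sub, Polynomial.eval_C,
      mul_sub] at h1
    have hif : Integrable (fun q => h q * f.eval (sphereInner p q)) (sphereMeasure n) := by
      have hfc : Continuous fun q => f.eval (sphereInner p q) := by fun_prop
      obtain ⟨M, hM⟩ := isCompact_univ.exists_bound_of_continuousOn hfc.continuousOn
      exact hi.mul_bdd (c := M) hfc.aestronglyMeasurable (Eventually.of_forall fun q => hM q trivial)
    rw [integral_sub hif (hi.mul_const c), integral_mul_const, h0, zero_mul, sub_zero] at h1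
    simpa [mul_comm] using h1
  have hlim := tendsto_peak_sphereInner p hi hc
  refine tendsto_nhds_unique (hlim.congr fun m => ?_) tendsto_const_nhds
  have h1 := hP ((Polynomial.C (1 / 2) * (1 + Polynomial.X)) ^ m)
  simp only [Polynomial.eval_mul, Polynomial.eval_C, Polynomial.eval_pow,
      Polynomial.eval_add, Polynomial.eval_one, Polynomial.eval_X] at h1
  have e : ∀ q, 1 / 2 * (1 + sphereInner p q) = (1 + sphereInner p q) / 2 := fun q => by ring
  simp_rw [e] at h1
  rw [h1, mul_zero]

theorem IsGreenFunction.eq_of_ne (hn : 1 ≤ n) {G H : UnitSphere n → UnitSphere n → ℝ}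
    (hG : IsGreenFunction n G) (hH : IsGreenFunction n H) {p q : UnitSphere n} (hpq : q ≠ p) :
    G p q = H p q := by
  rw [← sub_eq_zero]
  refine eq_zero_of_weakly_harmonic hn (h := fun q => G p q - H p q)
    ((hG.integrable p).sub (hH.integrable p)) ?_ (fun φ hφ => ?_) ?_
  · rw [integral_sub (hG.integrable p) (hH.integrable p), hG.mean_zero, hH.mean_zero, sub_zero]
  · have hL := continuous_sphereLaplacian hφ
    obtain ⟨M, hM⟩ := isCompact_univ.exists_bound_of_continuousOn hL.continuousOn
    have hi : ∀ {f : UnitSphere n → ℝ}, Integrable f (sphereMeasure n) →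
        Integrable (fun q => f q * sphereLaplacian φ q) (sphereMeasure n) := fun hf =>
      hf.mul_bdd (c := M) hL.aestronglyMeasurable (Eventually.of_forall fun q => hM q trivial)
    simp only [sub_mul]
    rw [integral_sub (hi (hG.integrable p)) (hi (hH.integrable p)), hG.laplacian p φ hφ,
      hH.laplacian p φ hφ, sub_self]
  · have hopen : {p}ᶜ ∈ 𝓝 q := isOpen_compl_singleton.mem_nhds hpq
    exact ((hG.continuousOn p).continuousAt hopen).sub ((hH.continuousOn p).continuousAt hopen)

/-- `greenFunction` is a choice, so its defining properties are available only once some function is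
known to have them. -/
theorem isGreenFunction_greenFunction (hn : 1 ≤ n) : IsGreenFunction n (greenFunction n) :=
  Classical.epsilon_spec ⟨_, isGreenFunction_zonalKernel hn⟩

theorem greenFunction_eq (hn : 1 ≤ n) {p q : UnitSphere n} (h : q ≠ p) :
    greenFunction n p q = zonalKernel p q - zonalMean n :=
  (isGreenFunction_greenFunction hn).eq_of_ne hn (isGreenFunction_zonalKernel hn) h

end Green

/-! ### The shell theorem and integrals over geodesic balls. -/

section Shell
open Real Filter Topology

variable {n : ℕ}

/-- The mean of the zonal Green kernel over a sphere of radius `s`, at distance `θ` from its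
centre. -/
def shellKernel (n : ℕ) (θ s : ℝ) : ℝ := capPot n (π - max θ s) + capPot n (min θ s)

/-- The integral of `f · sin^(n-1)` against the shell kernel. -/
def shellPot (n : ℕ) (f : ℝ → ℝ) (θ : ℝ) : ℝ :=
  capPot n (π - θ) * (∫ s in (0 : ℝ)..θ, f s * sin s ^ (n - 1)) +
    (∫ s in (0 : ℝ)..θ, f s * (capPot n s * sin s ^ (n - 1))) +
    (∫ s in θ..π, f s * (capPot n (π - s) * sin s ^ (n - 1))) +
    capPot n θ * ∫ s in θ..π, f s * sin s ^ (n - 1)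

theorem abs_integral_le_mul_capVol_sub {f : ℝ → ℝ} {M : ℝ}
    (hM : ∀ s ∈ Set.Icc 0 π, ‖f s‖ ≤ M) {θ : ℝ} (hθ : θ ∈ Set.Icc 0 π) :
    |∫ s in θ..π, f s * sin s ^ (n - 1)| ≤ M * (capVol n π - capVol n θ) := by
  rw [capVol_sub, ← intervalIntegral.integral_const_mul, ← Real.norm_eq_abs]
  refine intervalIntegral.norm_integral_le_of_norm_le hθ.2 (Eventually.of_forall fun s hs => ?_)
    (((continuous_sin_pow _).const_mul _).intervalIntegrable _ _)
  have hs' : s ∈ Set.Icc 0 π := ⟨hθ.1.trans hs.1.le, hs.2⟩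
  rw [norm_mul, Real.norm_of_nonneg (sin_pow_nonneg hs' _)]
  exact mul_le_mul_of_nonneg_right (hM s hs') (sin_pow_nonneg hs' _)

/-- The point at issue is `θ = π`, where `capPot n` may blow up but the tail of the integral is at
most a constant times `capVol n π - capVol n θ`. This admits `p` antipodal to `p₀`. -/
theorem continuousOn_capPot_mul_integral {f : ℝ → ℝ} (hf : Continuous f) :
    ContinuousOn (fun θ => capPot n θ * ∫ s in θ..π, f s * sin s ^ (n - 1)) (Set.Icc 0 π) := by
  have hcont : Continuous fun θ => ∫ s in θ..π, f s * sin s ^ (n - 1) := by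
    have h : Continuous fun θ => ∫ s in π..θ, f s * sin s ^ (n - 1) :=
      intervalIntegral.continuous_primitive
        (fun a b => (hf.mul (continuous_sin_pow _)).intervalIntegrable a b) π
    simp_rw [fun θ => intervalIntegral.integral_symm (μ := volume) (f := fun s => f s * sin s ^ (n - 1)) π θ]
    exact h.neg
  intro θ hθ
  rcases hθ.2.eq_or_lt with h | h
  · rw [h]
    obtain ⟨M, hM⟩ := isCompact_Icc.exists_bound_of_continuousOn (s := Set.Icc 0 π) hf.continuousOn
    have hlim := (tendsto_capPot_mul n).const_mul M
    rw [mul_zero] at hlim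
    have h1 : Tendsto (fun θ => capPot n θ * ∫ s in θ..π, f s * sin s ^ (n - 1))
        (𝓝[<] π) (𝓝 0) := by
      refine squeeze_zero_norm' ?_ hlim
      have hev : ∀ᶠ θ in 𝓝[<] π, θ ∈ Set.Ioo 0 π := by
        rw [← nhdsWithin_Ioo_eq_nhdsLT pi_pos]
        exact self_mem_nhdsWithin
      filter_upwards [hev] with t ht
      have ht' : t ∈ Set.Icc 0 π := ⟨ht.1.le, ht.2.le⟩
      rw [norm_mul, Real.norm_of_nonneg (capPot_nonneg ht'), mul_left_comm]
      exact mul_le_mul_of_nonneg_left (abs_integral_le_mul_capVol_sub hM ht') (capPot_nonneg ht')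
    -- At `π` the interval is degenerate, so the product is `0` whatever default value the integral
    -- defining `capPot n π` takes.
    have h2 : ContinuousWithinAt (fun θ => capPot n θ * ∫ s in θ..π, f s * sin s ^ (n - 1))
        (Set.Iio π) π := by
      rw [ContinuousWithinAt, intervalIntegral.integral_same, mul_zero]
      exact h1
    have h3 : ContinuousWithinAt (fun θ => capPot n θ * ∫ s in θ..π, f s * sin s ^ (n - 1))
        (Set.Iic π) π := by
      rw [← Set.Iio_insert]
      exact h2.insert
    exact h3.mono Set.Icc_subset_Iic_self
  · have h1 : ContinuousWithinAt (capPot n) (Set.Icc 0 π) θ := by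
      refine (continuousOn_capPot n θ ⟨hθ.1, h⟩).mono_of_mem_nhdsWithin ?_
      filter_upwards [self_mem_nhdsWithin, nhdsWithin_le_nhds (gt_mem_nhds h)] with t ht1 ht2
      exact ⟨ht1.1, ht2⟩
    exact h1.mul hcont.continuousWithinAt

theorem continuousOn_capPot_pi_sub_mul_integral {f : ℝ → ℝ} (hf : Continuous f) :
    ContinuousOn (fun θ => capPot n (π - θ) * ∫ s in (0 : ℝ)..θ, f s * sin s ^ (n - 1))
      (Set.Icc 0 π) := by
  have h := (continuousOn_capPot_mul_integral (n := n) (f := fun s => f (π - s))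
    (by fun_prop)).comp (f := fun θ => π - θ) (s := Set.Icc 0 π) (by fun_prop)
    (fun θ hθ => ⟨by linarith [hθ.2], by linarith [hθ.1]⟩)
  refine h.congr fun θ _ => ?_
  have e := intervalIntegral.integral_comp_sub_left (a := 0) (b := θ)
    (fun s => f (π - s) * sin s ^ (n - 1)) π
  simp only [sub_sub_cancel, sin_pi_sub, sub_zero] at e
  simp only [Function.comp_def, e]

theorem intervalIntegrable_mul_capPot {f : ℝ → ℝ} (hf : Continuous f) :
    IntervalIntegrable (fun s => f s * (capPot n s * sin s ^ (n - 1))) volume 0 π :=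
  (intervalIntegrable_capPot_mul n).continuousOn_mul hf.continuousOn

theorem intervalIntegrable_mul_capPot_pi_sub {f : ℝ → ℝ} (hf : Continuous f) :
    IntervalIntegrable (fun s => f s * (capPot n (π - s) * sin s ^ (n - 1))) volume 0 π :=
  (intervalIntegrable_capPot_pi_sub_mul n).continuousOn_mul hf.continuousOn

theorem continuousOn_shellPot {f : ℝ → ℝ} (hf : Continuous f) :
    ContinuousOn (shellPot n f) (Set.Icc 0 π) := by
  have h2 := intervalIntegral.continuousOn_primitive_interval (a := 0) (b := π) (μ := volume)
    ((intervalIntegrable_iff' enorm_ne_top).1 (intervalIntegrable_mul_capPot (n := n) hf))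
  have h3 := intervalIntegral.continuousOn_primitive_interval_left (a := 0) (b := π) (μ := volume)
    ((intervalIntegrable_iff' enorm_ne_top).1 (intervalIntegrable_mul_capPot_pi_sub (n := n) hf))
  rw [Set.uIcc_of_le pi_pos.le] at h2 h3
  exact (((continuousOn_capPot_pi_sub_mul_integral hf).add h2).add h3).add
    (continuousOn_capPot_mul_integral hf)

/-- The contributions of the moving endpoints cancel, since the two branches of the shell kernel
agree at `s = θ`. For constant `f` what remains is zero; for `f = zonalOp n P ∘ cos` it is `capVol n
π` times the derivative of `P (cos θ)`. -/
theorem hasDerivAt_shellPot {f : ℝ → ℝ} (hf : Continuous f) {θ : ℝ} (hθ : θ ∈ Set.Ioo 0 π) :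
    HasDerivAt (shellPot n f)
      ((capVol n θ * (∫ s in (0 : ℝ)..π, f s * sin s ^ (n - 1)) -
        capVol n π * ∫ s in (0 : ℝ)..θ, f s * sin s ^ (n - 1)) / sin θ ^ (n - 1)) θ := by
  have hθ' : π - θ ∈ Set.Ioo 0 π := ⟨by linarith [hθ.2], by linarith [hθ.1]⟩
  have hfS : Continuous fun s => f s * sin s ^ (n - 1) := hf.mul (continuous_sin_pow _)
  have c1 : ContinuousOn (fun s => f s * (capPot n s * sin s ^ (n - 1))) (Set.Ioo 0 π) :=
    hf.continuousOn.mul (((continuousOn_capPot n).mono Set.Ioo_subset_Ico_self).mul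
      (continuous_sin_pow _).continuousOn)
  have c2 : ContinuousOn (fun s => f s * (capPot n (π - s) * sin s ^ (n - 1))) (Set.Ioo 0 π) :=
    hf.continuousOn.mul (((continuousOn_capPot_pi_sub n).mono Set.Ioo_subset_Ioc_self).mul
      (continuous_sin_pow _).continuousOn)
  have hnhds := Ioo_mem_nhds hθ.1 hθ.2
  have i1 : IntervalIntegrable (fun s => f s * (capPot n s * sin s ^ (n - 1))) volume 0 θ :=
    (intervalIntegrable_mul_capPot hf).mono_set (by
      rw [Set.uIcc_of_le hθ.1.le, Set.uIcc_of_le pi_pos.le]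
      exact Set.Icc_subset_Icc_right hθ.2.le)
  have i2 : IntervalIntegrable (fun s => f s * (capPot n (π - s) * sin s ^ (n - 1))) volume θ π :=
    (intervalIntegrable_mul_capPot_pi_sub hf).mono_set (by
      rw [Set.uIcc_of_le hθ.2.le, Set.uIcc_of_le pi_pos.le]
      exact Set.Icc_subset_Icc_left hθ.1.le)
  have d1 : HasDerivAt (fun θ => capPot n (π - θ))
      (-(capVol n (π - θ) / sin (π - θ) ^ (n - 1))) θ := by
    have h := HasDerivAt.comp_const_sub π θ (hasDerivAt_capPot (n := n) hθ')
    exact h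
  have d2 : HasDerivAt (fun θ => ∫ s in (0 : ℝ)..θ, f s * sin s ^ (n - 1))
      (f θ * sin θ ^ (n - 1)) θ := (hfS.integral_hasStrictDerivAt 0 θ).hasDerivAt
  have d3 : HasDerivAt (fun θ => ∫ s in θ..π, f s * sin s ^ (n - 1))
      (-(f θ * sin θ ^ (n - 1))) θ :=
    intervalIntegral.integral_hasDerivAt_left (hfS.intervalIntegrable _ _)
      (hfS.stronglyMeasurableAtFilter _ _) hfS.continuousAt
  have d4 := intervalIntegral.integral_hasDerivAt_right i1
    (c1.stronglyMeasurableAtFilter isOpen_Ioo θ hθ) (c1.continuousAt hnhds)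
  have d5 := intervalIntegral.integral_hasDerivAt_left i2
    (c2.stronglyMeasurableAtFilter isOpen_Ioo θ hθ) (c2.continuousAt hnhds)
  have hall := (((d1.mul d2).add d4).add d5).add ((hasDerivAt_capPot (n := n) hθ).mul d3)
  refine hall.congr_deriv ?_
  have hsplit := intervalIntegral.integral_add_adjacent_intervals
    (hfS.intervalIntegrable (μ := volume) 0 θ) (hfS.intervalIntegrable θ π)
  rw [← hsplit, capVol_pi_sub, sin_pi_sub]
  have := (sin_pow_pos hθ (n - 1)).ne'
  field_simp
  ring

/-- The mean value theorem for two functions with the same derivative; continuity on the closed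
interval allows `θ = π`. -/
theorem shellPot_sub_eq {f U : ℝ → ℝ} (hf : Continuous f) (hU : ContinuousOn U (Set.Icc 0 π))
    (hU' : ∀ θ ∈ Set.Ioo 0 π, HasDerivAt U
      ((capVol n θ * (∫ s in (0 : ℝ)..π, f s * sin s ^ (n - 1)) -
        capVol n π * ∫ s in (0 : ℝ)..θ, f s * sin s ^ (n - 1)) / sin θ ^ (n - 1)) θ)
    {θ : ℝ} (hθ : θ ∈ Set.Ioc 0 π) :
    shellPot n f θ - shellPot n f 0 = U θ - U 0 := by
  have hsub : Set.Icc 0 θ ⊆ Set.Icc 0 π := Set.Icc_subset_Icc_right hθ.2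
  obtain ⟨c, hc, h⟩ := exists_hasDerivAt_eq_slope (fun t => shellPot n f t - U t) (fun _ => 0) hθ.1
    (((continuousOn_shellPot hf).mono hsub).sub (hU.mono hsub)) (fun t ht => by
      have ht' : t ∈ Set.Ioo 0 π := ⟨ht.1, ht.2.trans_le hθ.2⟩
      exact ((hasDerivAt_shellPot (n := n) hf ht').sub (hU' t ht')).congr_deriv (sub_self _))
  have h1 := (eq_div_iff (by linarith [hθ.1] : θ - 0 ≠ 0)).1 h
  linarith

theorem shellPot_zero (f : ℝ → ℝ) :
    shellPot n f 0 = ∫ s in (0 : ℝ)..π, f s * (capPot n (π - s) * sin s ^ (n - 1)) := by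
  simp [shellPot, capPot_zero]

theorem shellPot_const {θ : ℝ} (hθ : θ ∈ Set.Ioc 0 π) (c : ℝ) :
    shellPot n (fun _ => c) θ = shellPot n (fun _ => c) 0 := by
  have h := shellPot_sub_eq (n := n) (f := fun _ => c) (U := fun _ => 0) continuous_const
    continuousOn_const (fun t _ => by
      refine (hasDerivAt_const t (0 : ℝ)).congr_deriv ?_
      simp only [intervalIntegral.integral_const_mul]
      change 0 = (capVol n t * (c * capVol n π) - capVol n π * (c * capVol n t)) / _
      ring) hθ
  linarith

theorem shellPot_zonalOp (hn : 1 ≤ n) (P : Polynomial ℝ) {θ : ℝ} (hθ : θ ∈ Set.Ioc 0 π) :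
    shellPot n (fun s => (zonalOp n P).eval (cos s)) θ -
      shellPot n (fun s => (zonalOp n P).eval (cos s)) 0 =
      capVol n π * (P.eval (cos θ) - P.eval 1) := by
  rw [shellPot_sub_eq (U := fun t => capVol n π * P.eval (cos t)) (by fun_prop) (by fun_prop)
    (fun t ht => ?_) hθ, cos_zero]
  · ring
  · rw [integral_zonalOp_cos hn, integral_zonalOp_cos hn, sin_pi, zero_pow (by omega), mul_zero,
      mul_zero, zero_sub]
    refine (((P.hasDerivAt (cos t)).comp t (hasDerivAt_cos t)).const_mul _).congr_deriv ?_
    have h := deriv_mul_sin_eq_div hn P ht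
    rw [neg_div, mul_div_assoc, ← h]
    ring

theorem shellPot_add {f g : ℝ → ℝ} (hf : Continuous f) (hg : Continuous g) {θ : ℝ}
    (hθ : θ ∈ Set.Icc 0 π) :
    shellPot n (fun s => f s + g s) θ = shellPot n f θ + shellPot n g θ := by
  have hfS : Continuous fun s => f s * sin s ^ (n - 1) := hf.mul (continuous_sin_pow _)
  have hgS : Continuous fun s => g s * sin s ^ (n - 1) := hg.mul (continuous_sin_pow _)
  have s1 : Set.uIcc 0 θ ⊆ Set.uIcc 0 π := by
    rw [Set.uIcc_of_le hθ.1, Set.uIcc_of_le pi_pos.le]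
    exact Set.Icc_subset_Icc_right hθ.2
  have s2 : Set.uIcc θ π ⊆ Set.uIcc 0 π := by
    rw [Set.uIcc_of_le hθ.2, Set.uIcc_of_le pi_pos.le]
    exact Set.Icc_subset_Icc_left hθ.1
  simp only [shellPot, add_mul]
  rw [intervalIntegral.integral_add (hfS.intervalIntegrable _ _)
    (hgS.intervalIntegrable _ _),
    intervalIntegral.integral_add ((intervalIntegrable_mul_capPot hf).mono_set s1)
    ((intervalIntegrable_mul_capPot hg).mono_set s1),
    intervalIntegral.integral_add ((intervalIntegrable_mul_capPot_pi_sub hf).mono_set s2)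
    ((intervalIntegrable_mul_capPot_pi_sub hg).mono_set s2),
    intervalIntegral.integral_add (hfS.intervalIntegrable _ _)
    (hgS.intervalIntegrable _ _)]
  ring

theorem integral_eval_mul_zonalKernel_self (hn : 1 ≤ n) (p : UnitSphere n) (P : Polynomial ℝ) :
    ∫ q, P.eval (sphereInner p q) * zonalKernel p q ∂(sphereMeasure n) =
      (capVol n π)⁻¹ * shellPot n (fun s => P.eval (cos s)) 0 := by
  have h := integral_comp_sphereDist hn p
    (g := fun s => P.eval (cos s) * ((sphereVol n)⁻¹ * capPot n (π - s)))
    ((by fun_prop : Continuous fun s => P.eval (cos s)).aestronglyMeasurable.mul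
      ((aestronglyMeasurable_capPot_pi_sub n).const_mul _))
  simp only [cos_sphereDist] at h
  rw [shellPot_zero]
  refine h.trans ?_
  have e : ∀ s, P.eval (cos s) * ((sphereVol n)⁻¹ * capPot n (π - s)) * sin s ^ (n - 1) =
    (sphereVol n)⁻¹ * (P.eval (cos s) * (capPot n (π - s) * sin s ^ (n - 1))) := fun s => by ring
  simp_rw [e]
  rw [intervalIntegral.integral_const_mul]
  have := sphereVol_pos n
  field_simp

/-- Newton's shell theorem on the sphere, tested against polynomials. -/
theorem integral_eval_mul_zonalKernel (hn : 1 ≤ n) {p p₀ : UnitSphere n} (hp : p ≠ p₀)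
    (Q : Polynomial ℝ) :
    ∫ q, Q.eval (sphereInner p₀ q) * zonalKernel p q ∂(sphereMeasure n) =
      (capVol n π)⁻¹ * shellPot n (fun s => Q.eval (cos s)) (sphereDist p p₀) := by
  have hθ : sphereDist p p₀ ∈ Set.Ioc 0 π := ⟨sphereDist_pos hp, (sphereDist_mem_Icc p p₀).2⟩
  have hcont := continuous_sphereInner p₀
  -- On the part `zonalOp n P`, Green's identity makes the left side `P ⟨p₀, p⟩` minus a constant.
  -- Both sides thus vary with `p` in the same way, and they agree at `p = p₀` by direct integration
  -- in the distance. The constant part does not depend on `p` on either side.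
  obtain ⟨P, c, hPc⟩ := exists_zonalOp_eq_sub_C hn Q
  obtain rfl : Q = zonalOp n P + Polynomial.C c := by rw [hPc]; ring
  have hint : ∀ x : UnitSphere n, Integrable (fun q => (zonalOp n P).eval (sphereInner p₀ q) *
      zonalKernel x q) (sphereMeasure n) := by
    intro x
    have hfc : Continuous fun q => (zonalOp n P).eval (sphereInner p₀ q) := by fun_prop
    obtain ⟨M, hM⟩ := isCompact_univ.exists_bound_of_continuousOn hfc.continuousOn
    exact (integrable_zonalKernel hn x).bdd_mul (c := M) hfc.aestronglyMeasurable
      (Eventually.of_forall fun q => hM q trivial)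
  have hgreen : ∀ x : UnitSphere n, ∫ q, (zonalOp n P).eval (sphereInner p₀ q) * zonalKernel x q
      ∂(sphereMeasure n) = P.eval (sphereInner p₀ x) -
        (sphereVol n)⁻¹ * ∫ q, P.eval (sphereInner p₀ q) ∂(sphereMeasure n) := by
    intro x
    rw [← integral_zonalKernel_mul_sphereLaplacian hn x (contMDiff_eval_sphereInner p₀ P)]
    simp only [sphereLaplacian_eval_sphereInner, mul_comm]
  have h0 := integral_eval_mul_zonalKernel_self hn p₀ (zonalOp n P)
  rw [hgreen p₀, sphereInner_self] at h0
  have h1 := shellPot_zonalOp hn P hθ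
  have hB := capVol_pos (n := n) pi_pos le_rfl
  simp only [Polynomial.eval_add, Polynomial.eval_C, add_mul]
  rw [integral_add (hint p) ((integrable_zonalKernel hn p).const_mul c), hgreen p,
    integral_const_mul, integral_zonalKernel hn p,
    shellPot_add (by fun_prop) continuous_const ⟨hθ.1.le, hθ.2⟩, shellPot_const hθ,
    shellPot_zero (fun _ => c), intervalIntegral.integral_const_mul, zonalMean,
    intervalIntegral.integral_const_mul, eq_add_of_sub_eq h1, cos_sphereDist, sphereInner_comm p p₀]
  have h2 := sphereVol_pos n
  have e1 : (capVol n π)⁻¹ * (capVol n π * (P.eval (sphereInner p₀ p) - P.eval 1) +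
      shellPot n (fun s => (zonalOp n P).eval (cos s)) 0 +
      c * ∫ s in (0 : ℝ)..π, capPot n (π - s) * sin s ^ (n - 1)) =
      (capVol n π)⁻¹ * capVol n π * (P.eval (sphereInner p₀ p) - P.eval 1) +
      (capVol n π)⁻¹ * shellPot n (fun s => (zonalOp n P).eval (cos s)) 0 +
      c * ((capVol n π)⁻¹ * ∫ s in (0 : ℝ)..π, capPot n (π - s) * sin s ^ (n - 1)) := by ring
  rw [e1, ← h0, inv_mul_cancel₀ hB.ne']
  have e2 : ∀ J : ℝ, sphereVol n * ((capVol n π)⁻¹ * ((sphereVol n)⁻¹ * J)) =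
      (capVol n π)⁻¹ * J := fun J => by field_simp
  rw [e2]
  ring

theorem shellKernel_of_le {θ s : ℝ} (h : s ≤ θ) :
    shellKernel n θ s = capPot n (π - θ) + capPot n s := by
  rw [shellKernel, max_eq_left h, min_eq_right h]

theorem shellKernel_of_ge {θ s : ℝ} (h : θ ≤ s) :
    shellKernel n θ s = capPot n (π - s) + capPot n θ := by
  rw [shellKernel, max_eq_right h, min_eq_left h]

theorem intervalIntegrable_mul_shellKernel {f : ℝ → ℝ} (hf : Continuous f) {θ : ℝ}
    (hθ : θ ∈ Set.Icc 0 π) :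
    IntervalIntegrable (fun s => f s * (shellKernel n θ s * sin s ^ (n - 1))) volume 0 θ ∧
    IntervalIntegrable (fun s => f s * (shellKernel n θ s * sin s ^ (n - 1))) volume θ π ∧
    ∫ s in (0 : ℝ)..π, f s * (shellKernel n θ s * sin s ^ (n - 1)) = shellPot n f θ := by
  have hS := continuous_sin_pow (n - 1)
  have s1 : Set.uIcc 0 θ ⊆ Set.uIcc 0 π := by
    rw [Set.uIcc_of_le hθ.1, Set.uIcc_of_le pi_pos.le]
    exact Set.Icc_subset_Icc_right hθ.2
  have s2 : Set.uIcc θ π ⊆ Set.uIcc 0 π := by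
    rw [Set.uIcc_of_le hθ.2, Set.uIcc_of_le pi_pos.le]
    exact Set.Icc_subset_Icc_left hθ.1
  have a1 := (intervalIntegrable_mul_capPot (n := n) hf).mono_set s1
  have a2 := (intervalIntegrable_mul_capPot_pi_sub (n := n) hf).mono_set s2
  have b1 : IntervalIntegrable (fun s => capPot n (π - θ) * (f s * sin s ^ (n - 1))) volume 0 θ :=
    ((hf.mul hS).const_mul _).intervalIntegrable _ _
  have b2 : IntervalIntegrable (fun s => capPot n θ * (f s * sin s ^ (n - 1))) volume θ π :=
    ((hf.mul hS).const_mul _).intervalIntegrable _ _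
  have e1 : Set.EqOn (fun s => capPot n (π - θ) * (f s * sin s ^ (n - 1)) +
      f s * (capPot n s * sin s ^ (n - 1)))
      (fun s => f s * (shellKernel n θ s * sin s ^ (n - 1))) (Set.uIcc 0 θ) := by
    intro s hs
    rw [Set.uIcc_of_le hθ.1] at hs
    simp only [shellKernel_of_le hs.2]
    ring
  have e2 : Set.EqOn (fun s => f s * (capPot n (π - s) * sin s ^ (n - 1)) +
      capPot n θ * (f s * sin s ^ (n - 1)))
      (fun s => f s * (shellKernel n θ s * sin s ^ (n - 1))) (Set.uIcc θ π) := by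
    intro s hs
    rw [Set.uIcc_of_le hθ.2] at hs
    simp only [shellKernel_of_ge hs.1]
    ring
  have c1 := (b1.add a1).congr_uIoo (e1.mono Set.uIoo_subset_uIcc_self)
  have c2 := (a2.add b2).congr_uIoo (e2.mono Set.uIoo_subset_uIcc_self)
  refine ⟨c1, c2, ?_⟩
  rw [← intervalIntegral.integral_add_adjacent_intervals c1 c2,
    ← intervalIntegral.integral_congr e1, ← intervalIntegral.integral_congr e2,
    intervalIntegral.integral_add b1 a1, intervalIntegral.integral_add a2 b2,
    intervalIntegral.integral_const_mul, intervalIntegral.integral_const_mul, shellPot]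
  ring

theorem shellKernel_nonneg {θ s : ℝ} (hθ : θ ∈ Set.Icc 0 π) (hs : s ∈ Set.Icc 0 π) :
    0 ≤ shellKernel n θ s := by
  refine add_nonneg (capPot_nonneg ⟨?_, ?_⟩) (capPot_nonneg ⟨?_, ?_⟩)
  · linarith [max_le hθ.2 hs.2]
  · linarith [hθ.1.trans (le_max_left θ s)]
  · exact le_min hθ.1 hs.1
  · exact (min_le_left _ _).trans hθ.2

/-- The source of the inequality: beyond `θ` both terms drop, by monotonicity of `capPot n`. The
value `s = π` is excluded because monotonicity holds only on `[0, π)`. -/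
theorem shellKernel_le {θ s : ℝ} (hθ : θ ∈ Set.Ioc 0 π) (hs : s ∈ Set.Ioo 0 π) :
    shellKernel n θ s ≤ capPot n (π - θ) + capPot n s := by
  rcases le_total s θ with h | h
  · rw [shellKernel_of_le h]
  · rw [shellKernel_of_ge h]
    exact add_le_add (capPot_monotoneOn n ⟨by linarith [hs.2], by linarith [hs.1]⟩
      ⟨by linarith [hθ.2], by linarith [hθ.1]⟩ (by linarith))
      (capPot_monotoneOn n ⟨hθ.1.le, h.trans_lt hs.2⟩ ⟨hs.1.le, hs.2⟩ h)

theorem intervalIntegrable_shellKernel {θ : ℝ} (hθ : θ ∈ Set.Icc 0 π) :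
    IntervalIntegrable (fun s => shellKernel n θ s * sin s ^ (n - 1)) volume 0 π := by
  have h := intervalIntegrable_mul_shellKernel (n := n) (f := fun _ => 1) continuous_const hθ
  simpa using h.1.trans h.2.1

/-- The polynomial shell theorem says that two nonnegative densities have the same moments in `⟨p₀,
q⟩` and `cos s`; they therefore give the same mass to `(cos a, ∞)`, whose preimage on the sphere is
the ball. -/
theorem setIntegral_geodesicBall_zonalKernel (hn : 1 ≤ n) {p p₀ : UnitSphere n} (hp : p ≠ p₀)
    {a : ℝ} (ha : 0 < a) (haπ : a ≤ π) :
    ∫ q in geodesicBall p₀ a, zonalKernel p q ∂(sphereMeasure n) =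
      (capVol n π)⁻¹ * ∫ s in (0 : ℝ)..a, shellKernel n (sphereDist p p₀) s * sin s ^ (n - 1) := by
  have hθ := sphereDist_mem_Icc p p₀
  have hB := capVol_pos (n := n) pi_pos le_rfl
  have h := setIntegral_preimage_eq_of_moments (μ := sphereMeasure n)
    (ν := volume.restrict (Set.Ioc 0 π)) (w := zonalKernel p)
    (v := fun s => (capVol n π)⁻¹ * (shellKernel n (sphereDist p p₀) s * sin s ^ (n - 1)))
    (integrable_zonalKernel hn p)
    (((intervalIntegrable_iff_integrableOn_Ioc_of_le pi_pos.le).1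
      (intervalIntegrable_shellKernel hθ)).const_mul _)
    (Eventually.of_forall fun q => zonalKernel_nonneg p q)
    (by filter_upwards [ae_restrict_mem measurableSet_Ioc] with s hs
        exact mul_nonneg (inv_nonneg.2 hB.le) (mul_nonneg (shellKernel_nonneg hθ ⟨hs.1.le, hs.2⟩)
          (sin_pow_nonneg ⟨hs.1.le, hs.2⟩ _)))
    (continuous_sphereInner p₀).measurable measurable_cos (sphereInner_mem_Icc p₀)
    (fun s => ⟨neg_one_le_cos s, cos_le_one s⟩) (fun k => by
      have h1 := integral_eval_mul_zonalKernel hn hp (Polynomial.X ^ k)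
      have h2 := (intervalIntegrable_mul_shellKernel (n := n) (f := fun s => cos s ^ k)
        (by fun_prop) hθ).2.2
      simp only [Polynomial.eval_pow, Polynomial.eval_X] at h1
      rw [h1, ← h2, intervalIntegral.integral_of_le pi_pos.le, ← integral_const_mul]
      congr 1; funext s; ring) (A := Set.Ioi (cos a)) measurableSet_Ioi
  have e1 : sphereInner p₀ ⁻¹' Set.Ioi (cos a) = geodesicBall p₀ a := by
    ext q
    rw [Set.mem_preimage, Set.mem_Ioi, ← cos_sphereDist]
    exact strictAntiOn_cos.lt_iff_gt ⟨ha.le, haπ⟩ (sphereDist_mem_Icc p₀ q)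
  have e2 : (volume.restrict (Set.Ioc 0 π)).restrict (cos ⁻¹' Set.Ioi (cos a)) =
      volume.restrict (Set.Ioo 0 a) := by
    rw [Measure.restrict_restrict (measurable_cos measurableSet_Ioi)]
    congr 1
    ext s
    simp only [Set.mem_inter_iff, Set.mem_preimage, Set.mem_Ioi, Set.mem_Ioc, Set.mem_Ioo]
    constructor
    · rintro ⟨h1, h2⟩
      exact ⟨h2.1, (strictAntiOn_cos.lt_iff_gt ⟨ha.le, haπ⟩ ⟨h2.1.le, h2.2⟩).1 h1⟩
    · rintro ⟨h1, h2⟩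
      exact ⟨(strictAntiOn_cos.lt_iff_gt ⟨ha.le, haπ⟩ ⟨h1.le, h2.le.trans haπ⟩).2 h2,
        h1, h2.le.trans haπ⟩
  rw [e1, e2] at h
  rw [h, integral_const_mul, intervalIntegral.integral_of_le ha.le, integral_Ioc_eq_integral_Ioo]

end Shell

/-! ### The potential as a power series in `sin²(s/2)`, and the constant `K`. -/

section Series
open Real Filter Topology

theorem pochhammerSymbol_zero (x : ℝ) : pochhammerSymbol x 0 = 1 := by
  simp [pochhammerSymbol]

theorem pochhammerSymbol_succ (x : ℝ) (k : ℕ) :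
    pochhammerSymbol x (k + 1) = pochhammerSymbol x k * (x + k) := by
  simp [pochhammerSymbol, ascPochhammer_succ_right]

theorem pochhammerSymbol_pos {x : ℝ} (hx : 0 < x) (k : ℕ) : 0 < pochhammerSymbol x k :=
  ascPochhammer_pos k x hx

theorem mul_pochhammerSymbol_add_one (x : ℝ) (k : ℕ) :
    x * pochhammerSymbol (x + 1) k = pochhammerSymbol x k * (x + k) := by
  induction k with
  | zero => simp [pochhammerSymbol_zero]
  | succ k ih =>
    rw [pochhammerSymbol_succ, pochhammerSymbol_succ, ← mul_assoc, ih]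
    push_cast
    ring

theorem summable_pochhammerSymbol_div_mul_pow {x y σ : ℝ} (hx : 0 < x) (hy : 0 < y)
    (hσ : 0 < σ) (hσ1 : σ < 1) :
    Summable fun k => pochhammerSymbol x k / pochhammerSymbol y k * σ ^ k := by
  have hpos : ∀ k, 0 < pochhammerSymbol x k / pochhammerSymbol y k * σ ^ k := fun k =>
    mul_pos (div_pos (pochhammerSymbol_pos hx k) (pochhammerSymbol_pos hy k)) (pow_pos hσ k)
  refine summable_of_ratio_test_tendsto_lt_one hσ1 (Eventually.of_forall fun k => (hpos k).ne') ?_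
  have hy' : Tendsto (fun k : ℕ => y + (k : ℝ)) atTop atTop :=
    tendsto_atTop_add_const_left _ _ tendsto_natCast_atTop_atTop
  have h : Tendsto (fun k : ℕ => σ * (1 + (x - y) / (y + (k : ℝ)))) atTop (𝓝 (σ * (1 + 0))) :=
    ((hy'.const_div_atTop (x - y)).const_add 1).const_mul σ
  rw [add_zero, mul_one] at h
  refine h.congr fun k => ?_
  rw [Real.norm_of_nonneg (hpos _).le, Real.norm_of_nonneg (hpos _).le, pochhammerSymbol_succ,
    pochhammerSymbol_succ, pow_succ]
  have h1 := (pochhammerSymbol_pos hx k).ne'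
  have h2 := (pochhammerSymbol_pos hy k).ne'
  have h3 := (pow_pos hσ k).ne'
  have h4 : y + (k : ℝ) ≠ 0 := by positivity
  field_simp
  ring

/-- Nonnegative terms dominate themselves. Only interior points are asked for, so the series may
diverge at the endpoint `π`. -/
theorem hasSum_intervalIntegral_of_nonneg {F : ℕ → ℝ → ℝ} {f : ℝ → ℝ} {a b : ℝ} (hab : a ≤ b)
    (hF : ∀ k, Continuous (F k)) (hf : IntervalIntegrable f volume a b)
    (hpos : ∀ k, ∀ s ∈ Set.Ioo a b, 0 ≤ F k s)
    (hsum : ∀ s ∈ Set.Ioo a b, HasSum (fun k => F k s) (f s)) :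
    HasSum (fun k => ∫ s in a..b, F k s) (∫ s in a..b, f s) := by
  have hIoo : ∀ᵐ s : ℝ, s ∈ Set.uIoc a b → s ∈ Set.Ioo a b := by
    filter_upwards [Measure.ae_ne volume b] with s hs hs'
    rw [Set.uIoc_of_le hab] at hs'
    exact ⟨hs'.1, lt_of_le_of_ne hs'.2 hs⟩
  refine intervalIntegral.hasSum_integral_of_dominated_convergence F
    (fun k => (hF k).aestronglyMeasurable) (fun k => ?_) ?_ ?_ ?_
  · filter_upwards [hIoo] with s hs hs'
    exact (Real.norm_of_nonneg (hpos k s (hs hs'))).le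
  · filter_upwards [hIoo] with s hs hs'
    exact (hsum s (hs hs')).summable
  · refine hf.congr_ae ?_
    rw [EventuallyEq, ae_restrict_iff' measurableSet_uIoc]
    filter_upwards [hIoo] with s hs hs'
    exact (hsum s (hs hs')).tsum_eq.symm
  · filter_upwards [hIoo] with s hs hs'
    exact hsum s (hs hs')

/-- The moments of `sin²(s/2)` over a geodesic ball. -/
def capMoment (n k : ℕ) (θ : ℝ) : ℝ :=
  ∫ s in (0 : ℝ)..θ, (sin (s / 2) ^ 2) ^ k * sin s ^ (n - 1)

variable {n : ℕ}

theorem continuous_capMoment_integrand (n k : ℕ) :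
    Continuous fun s : ℝ => (sin (s / 2) ^ 2) ^ k * sin s ^ (n - 1) := by fun_prop

theorem capMoment_zero (n : ℕ) (θ : ℝ) : capMoment n 0 θ = capVol n θ := by
  simp [capMoment, capVol]

theorem hasDerivAt_sin_half_sq (s : ℝ) :
    HasDerivAt (fun s => sin (s / 2) ^ 2) (sin s / 2) s := by
  have h := (((hasDerivAt_id s).div_const 2).sin).pow 2
  refine h.congr_deriv ?_
  have e : sin s = 2 * sin (s / 2) * cos (s / 2) := by rw [← sin_two_mul]; congr 1; ring
  rw [e]
  simp
  ring

theorem sin_sq_eq_sin_half (s : ℝ) : sin s ^ 2 = 4 * sin (s / 2) ^ 2 * (1 - sin (s / 2) ^ 2) := by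
  have e : sin s = 2 * sin (s / 2) * cos (s / 2) := by rw [← sin_two_mul]; congr 1; ring
  rw [e, ← cos_sq']
  ring

theorem cos_eq_sin_half (s : ℝ) : cos s = 1 - 2 * sin (s / 2) ^ 2 := by
  have h := cos_two_mul' (s / 2)
  rw [mul_div_cancel₀ s two_ne_zero, cos_sq'] at h
  rw [h]
  ring

/-- Differentiate `σ ^ k * sin ^ n` with `σ = sin²(s/2)`, using `σ' = sin s / 2`, `sin² s = 4σ(1 -
σ)` and `cos s = 1 - 2σ`. -/
theorem capMoment_recurrence (hn : 1 ≤ n) (k : ℕ) (θ : ℝ) :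
    (2 * k + n) * capMoment n k θ - 2 * (k + n) * capMoment n (k + 1) θ =
      (sin (θ / 2) ^ 2) ^ k * sin θ ^ n := by
  obtain ⟨m, rfl⟩ : ∃ m, n = m + 1 := ⟨n - 1, by omega⟩
  have hd : ∀ s, HasDerivAt (fun s => (sin (s / 2) ^ 2) ^ k * sin s ^ (m + 1))
      ((2 * k + (m + 1 : ℕ)) * ((sin (s / 2) ^ 2) ^ k * sin s ^ (m + 1 - 1)) -
        2 * (k + (m + 1 : ℕ)) * ((sin (s / 2) ^ 2) ^ (k + 1) * sin s ^ (m + 1 - 1))) s := by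
    intro s
    refine (((hasDerivAt_sin_half_sq s).fun_pow k).fun_mul
      ((hasDerivAt_sin s).fun_pow (m + 1))).congr_deriv ?_
    have e2 := sin_sq_eq_sin_half s
    rw [cos_eq_sin_half]
    generalize sin (s / 2) ^ 2 = σ at *
    have e3 : (k : ℝ) * σ ^ (k - 1) * (sin s / 2) * sin s ^ (m + 1) =
        2 * (k * σ ^ (k - 1) * σ) * (1 - σ) * sin s ^ m := by
      rw [show (k : ℝ) * σ ^ (k - 1) * (sin s / 2) * sin s ^ (m + 1) =
        k * σ ^ (k - 1) * (sin s ^ 2 / 2) * sin s ^ m by ring, e2]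
      ring
    have e4 : (k : ℝ) * σ ^ (k - 1) * σ = k * σ ^ k := by
      rcases k with _ | k
      · simp
      · simp [pow_succ, mul_assoc]
    rw [e3, e4]
    simp only [add_tsub_cancel_right]
    push_cast
    ring
  have h := intervalIntegral.integral_eq_sub_of_hasDerivAt (a := 0) (b := θ) (fun s _ => hd s)
    (by apply Continuous.intervalIntegrable; fun_prop)
  rw [intervalIntegral.integral_sub
    (((continuous_capMoment_integrand _ _).const_mul _).intervalIntegrable _ _)
    (((continuous_capMoment_integrand _ _).const_mul _).intervalIntegrable _ _),
    intervalIntegral.integral_const_mul, intervalIntegral.integral_const_mul] at h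
  simpa [capMoment] using h

theorem capMoment_nonneg (k : ℕ) {θ : ℝ} (hθ : θ ∈ Set.Icc 0 π) : 0 ≤ capMoment n k θ :=
  intervalIntegral.integral_nonneg hθ.1 fun _ hs =>
    mul_nonneg (by positivity) (sin_pow_nonneg ⟨hs.1, hs.2.trans hθ.2⟩ _)

theorem capMoment_le (k : ℕ) {θ : ℝ} (hθ : θ ∈ Set.Icc 0 π) :
    capMoment n k θ ≤ (sin (θ / 2) ^ 2) ^ k * capVol n θ := by
  rw [capVol, ← intervalIntegral.integral_const_mul]
  refine intervalIntegral.integral_mono_on hθ.1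
    ((continuous_capMoment_integrand _ _).intervalIntegrable _ _)
    (((continuous_sin_pow _).const_mul _).intervalIntegrable _ _) fun s hs => ?_
  refine mul_le_mul_of_nonneg_right ?_ (sin_pow_nonneg ⟨hs.1, hs.2.trans hθ.2⟩ _)
  have h0 : 0 ≤ sin (s / 2) :=
    sin_nonneg_of_nonneg_of_le_pi (by linarith [hs.1]) (by linarith [hs.1, hs.2, hθ.2])
  have h1 : sin (s / 2) ≤ sin (θ / 2) :=
    sin_le_sin_of_le_of_le_pi_div_two (by linarith [hs.1, pi_pos]) (by linarith [hθ.2])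
      (by linarith [hs.2])
  gcongr

theorem sin_half_sq_mem_Ioo {θ : ℝ} (hθ : θ ∈ Set.Ioo 0 π) : sin (θ / 2) ^ 2 ∈ Set.Ioo 0 1 := by
  have h0 : 0 < sin (θ / 2) := sin_pos_of_pos_of_lt_pi (by linarith [hθ.1]) (by linarith [hθ.1, hθ.2])
  have h1 : 0 < cos (θ / 2) := cos_pos_of_mem_Ioo ⟨by linarith [hθ.1, pi_pos], by linarith [hθ.2]⟩
  exact ⟨by positivity, by nlinarith [sin_sq_add_cos_sq (θ / 2)]⟩

/-- The recurrence unrolled `m` times from `capMoment n 0 = capVol n`. The last term is the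
remainder, and it tends to zero for `0 < θ < π` since `sin²(θ/2) < 1`. -/
theorem capVol_eq_sum_add (hn : 1 ≤ n) (θ : ℝ) (m : ℕ) :
    capVol n θ = ∑ k ∈ Finset.range m, pochhammerSymbol n k / pochhammerSymbol (n / 2 + 1) k / n *
        ((sin (θ / 2) ^ 2) ^ k * sin θ ^ n) +
      pochhammerSymbol n m / pochhammerSymbol (n / 2) m * capMoment n m θ := by
  have hn0 : (0 : ℝ) < n := by exact_mod_cast hn
  induction m with
  | zero => simp [pochhammerSymbol_zero, capMoment_zero]
  | succ m ih =>
    rw [ih, Finset.sum_range_succ, add_assoc, ← capMoment_recurrence hn m θ, pochhammerSymbol_succ,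
      pochhammerSymbol_succ]
    congr 1
    have h1 := pochhammerSymbol_pos (by positivity : (0 : ℝ) < n / 2) m
    have h2 := pochhammerSymbol_pos (by positivity : (0 : ℝ) < n / 2 + 1) m
    have h3 := mul_pochhammerSymbol_add_one ((n : ℝ) / 2) m
    have h4 : pochhammerSymbol ((n : ℝ) / 2 + 1) m =
        pochhammerSymbol ((n : ℝ) / 2) m * (n / 2 + m) / (n / 2) := by
      rw [← h3]; field_simp
    rw [h4]
    have h5 : (0 : ℝ) < n / 2 + m := by positivity
    have h6 : (0 : ℝ) < n + 2 * m := by positivity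
    field_simp
    ring

theorem hasSum_capVol (hn : 1 ≤ n) {θ : ℝ} (hθ : θ ∈ Set.Ioo 0 π) :
    HasSum (fun k => pochhammerSymbol n k / pochhammerSymbol (n / 2 + 1) k / n *
      ((sin (θ / 2) ^ 2) ^ k * sin θ ^ n)) (capVol n θ) := by
  have hn0 : (0 : ℝ) < n := by exact_mod_cast hn
  have hθ' : θ ∈ Set.Icc 0 π := ⟨hθ.1.le, hθ.2.le⟩
  have hσ := sin_half_sq_mem_Ioo hθ
  have hd : ∀ k, 0 < pochhammerSymbol n k / pochhammerSymbol (n / 2) k := fun k =>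
    div_pos (pochhammerSymbol_pos hn0 k) (pochhammerSymbol_pos (by positivity) k)
  rw [hasSum_iff_tendsto_nat_of_nonneg (fun k => ?_)]
  · have h0 := ((summable_pochhammerSymbol_div_mul_pow hn0 (by positivity : (0 : ℝ) < n / 2)
      hσ.1 hσ.2).tendsto_atTop_zero).mul_const (capVol n θ)
    rw [zero_mul] at h0
    have h1 : Tendsto (fun m => pochhammerSymbol n m / pochhammerSymbol (n / 2) m *
        capMoment n m θ) atTop (𝓝 0) := by
      refine squeeze_zero (fun m => mul_nonneg (hd m).le (capMoment_nonneg m hθ')) (fun m => ?_) h0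
      rw [mul_assoc]
      exact mul_le_mul_of_nonneg_left (capMoment_le m hθ') (hd m).le
    have h2 := h1.const_sub (capVol n θ)
    rw [sub_zero] at h2
    refine h2.congr fun m => ?_
    rw [sub_eq_iff_eq_add]
    exact capVol_eq_sum_add hn θ m
  · have := pochhammerSymbol_pos hn0 k
    have := pochhammerSymbol_pos (by positivity : (0 : ℝ) < n / 2 + 1) k
    have := sin_pow_nonneg hθ' n
    positivity

/-- Division of the series for `capVol n` by `sin ^ (n - 1)` leaves terms `σ ^ k * sin s = 2 σ ^ k
σ'`, which integrate to `2 σ ^ (k + 1) / (k + 1)`. -/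
theorem hasSum_capPot (hn : 1 ≤ n) {θ : ℝ} (hθ : θ ∈ Set.Ioo 0 π) :
    HasSum (fun k : ℕ => 2 / n * (pochhammerSymbol n k / (pochhammerSymbol (n / 2 + 1) k * (k + 1))) *
      (sin (θ / 2) ^ 2) ^ (k + 1)) (capPot n θ) := by
  have hn0 : (0 : ℝ) < n := by exact_mod_cast hn
  have h := hasSum_intervalIntegral_of_nonneg (a := 0) (b := θ) hθ.1.le
    (F := fun k s => pochhammerSymbol n k / pochhammerSymbol (n / 2 + 1) k / n *
      ((sin (s / 2) ^ 2) ^ k * sin s)) (f := fun s => capVol n s / sin s ^ (n - 1))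
    (fun k => by fun_prop) (intervalIntegrable_capVol_div le_rfl hθ.2 hθ.1.le)
    (fun k s hs => by
      have := pochhammerSymbol_pos hn0 k
      have := pochhammerSymbol_pos (by positivity : (0 : ℝ) < n / 2 + 1) k
      have := sin_pos_of_pos_of_lt_pi hs.1 (hs.2.trans hθ.2)
      positivity)
    (fun s hs => by
      have hs' : s ∈ Set.Ioo 0 π := ⟨hs.1, hs.2.trans hθ.2⟩
      have h1 := (hasSum_capVol hn hs').div_const (sin s ^ (n - 1))
      refine h1.congr_fun fun k => ?_
      have h2 := (sin_pow_pos hs' (n - 1)).ne'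
      rw [eq_div_iff h2, mul_assoc, mul_assoc, ← pow_succ', Nat.sub_add_cancel hn])
  refine h.congr_fun fun k => ?_
  rw [intervalIntegral.integral_const_mul]
  have hd : ∀ s, HasDerivAt (fun s => 2 / ((k : ℝ) + 1) * (sin (s / 2) ^ 2) ^ (k + 1))
      ((sin (s / 2) ^ 2) ^ k * sin s) s := by
    intro s
    refine (((hasDerivAt_sin_half_sq s).fun_pow (k + 1)).const_mul _).congr_deriv ?_
    simp only [add_tsub_cancel_right]
    push_cast
    have : (k : ℝ) + 1 ≠ 0 := by positivity
    field_simp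
  rw [intervalIntegral.integral_eq_sub_of_hasDerivAt (fun s _ => hd s)
    (by apply Continuous.intervalIntegrable; fun_prop)]
  simp
  have : (k : ℝ) + 1 ≠ 0 := by positivity
  have := (pochhammerSymbol_pos (by positivity : (0 : ℝ) < n / 2 + 1) k).ne'
  field_simp

theorem hasSum_integral_capPot_mul (hn : 1 ≤ n) {a : ℝ} (ha : 0 < a) (haπ : a ≤ π) :
    HasSum (fun k : ℕ => 2 / n * (pochhammerSymbol n k / (pochhammerSymbol (n / 2 + 1) k * (k + 1))) *
      capMoment n (k + 1) a) (∫ s in (0 : ℝ)..a, capPot n s * sin s ^ (n - 1)) := by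
  have hn0 : (0 : ℝ) < n := by exact_mod_cast hn
  have h := hasSum_intervalIntegral_of_nonneg (a := 0) (b := a) ha.le
    (F := fun k s => 2 / n *
      (pochhammerSymbol n k / (pochhammerSymbol (n / 2 + 1) k * ((k : ℝ) + 1))) *
      ((sin (s / 2) ^ 2) ^ (k + 1) * sin s ^ (n - 1))) (f := fun s => capPot n s * sin s ^ (n - 1))
    (fun k => by fun_prop) ((intervalIntegrable_capPot_mul n).mono_set (by
      rw [Set.uIcc_of_le ha.le, Set.uIcc_of_le pi_pos.le]
      exact Set.Icc_subset_Icc_right haπ))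
    (fun k s hs => by
      have := pochhammerSymbol_pos hn0 k
      have := pochhammerSymbol_pos (by positivity : (0 : ℝ) < n / 2 + 1) k
      have := sin_pow_pos ⟨hs.1, hs.2.trans_le haπ⟩ (n - 1)
      positivity)
    (fun s hs => by
      simp_rw [← mul_assoc]
      exact (hasSum_capPot hn ⟨hs.1, hs.2.trans_le haπ⟩).mul_right _)
  simp_rw [intervalIntegral.integral_const_mul] at h
  exact h

theorem strictMonoOn_sin_half_sq : StrictMonoOn (fun s => sin (s / 2) ^ 2) (Set.Icc 0 π) := by
  intro s hs t ht hst
  have h0 : 0 ≤ sin (s / 2) :=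
    sin_nonneg_of_nonneg_of_le_pi (by linarith [hs.1]) (by linarith [hs.1, hs.2])
  have h1 : sin (s / 2) < sin (t / 2) :=
    sin_lt_sin_of_lt_of_le_pi_div_two (by linarith [hs.1, pi_pos]) (by linarith [ht.2])
      (by linarith)
  exact pow_lt_pow_left₀ h1 h0 two_ne_zero

theorem image_sin_half_sq {a : ℝ} (ha : 0 < a) (haπ : a ≤ π) :
    (fun s => sin (s / 2) ^ 2) '' Set.Ioo 0 a = Set.Ioo 0 (sin (a / 2) ^ 2) := by
  have hmono := strictMonoOn_sin_half_sq
  refine Set.Subset.antisymm ?_ ?_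
  · rintro _ ⟨s, hs, rfl⟩
    have h1 := hmono ⟨le_rfl, pi_pos.le⟩ ⟨hs.1.le, hs.2.le.trans haπ⟩ hs.1
    have h2 := hmono ⟨hs.1.le, hs.2.le.trans haπ⟩ ⟨ha.le, haπ⟩ hs.2
    simp only [zero_div, sin_zero] at h1
    exact ⟨by simpa using h1, h2⟩
  · have h := intermediate_value_Ioo ha.le (f := fun s => sin (s / 2) ^ 2)
      (by fun_prop : Continuous fun s => sin (s / 2) ^ 2).continuousOn
    simpa using h

/-- The substitution `t = sin²(s/2)`, for which `t (1 - t) = (sin s / 2) ^ 2`. -/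
theorem incompleteBeta_sin_half_sq (hn : 1 ≤ n) (k : ℕ) {α : ℝ} (hα : α = n / 2 + k) {a : ℝ}
    (ha : 0 < a) (haπ : a ≤ π) :
    incompleteBeta (sin (a / 2) ^ 2) α (n / 2) = (2 ^ (n - 1))⁻¹ * capMoment n k a := by
  have hsub : Set.Ioo 0 a ⊆ Set.Icc 0 π := fun s hs => ⟨hs.1.le, hs.2.le.trans haπ⟩
  rw [incompleteBeta, intervalIntegral.integral_of_le (by positivity), integral_Ioc_eq_integral_Ioo,
    ← image_sin_half_sq ha haπ, integral_image_eq_integral_abs_deriv_smul measurableSet_Ioo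
      (fun s _ => (hasDerivAt_sin_half_sq s).hasDerivWithinAt)
      (strictMonoOn_sin_half_sq.injOn.mono hsub),
    capMoment, intervalIntegral.integral_of_le ha.le, integral_Ioc_eq_integral_Ioo,
    ← integral_const_mul]
  refine setIntegral_congr_fun measurableSet_Ioo fun s hs => ?_
  have hs' : s ∈ Set.Ioo 0 π := ⟨hs.1, hs.2.trans_le haπ⟩
  have hσ := sin_half_sq_mem_Ioo hs'
  have hsin := sin_pos_of_mem_Ioo hs'
  have e2 := sin_sq_eq_sin_half s
  simp only [smul_eq_mul]
  generalize sin (s / 2) ^ 2 = σ at *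
  have hτ : 0 < 1 - σ := by linarith [hσ.2]
  have e3 : σ ^ (α - 1) = σ ^ k * σ ^ ((n : ℝ) / 2 - 1) := by
    rw [← rpow_natCast, ← rpow_add hσ.1, hα]
    congr 1; ring
  have e4 : σ ^ ((n : ℝ) / 2 - 1) * (1 - σ) ^ ((n : ℝ) / 2 - 1) = (sin s / 2) ^ ((n : ℝ) - 2) := by
    rw [← mul_rpow hσ.1.le hτ.le, show σ * (1 - σ) = (sin s / 2) ^ (2 : ℝ) by
      rw [rpow_two, div_pow, e2]; ring, ← rpow_mul (by positivity)]
    congr 1; ring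
  have e5 : sin s / 2 * (sin s / 2) ^ ((n : ℝ) - 2) = (sin s / 2) ^ (n - 1) := by
    rw [← rpow_natCast, Nat.cast_sub hn]
    nth_rewrite 1 [← rpow_one (sin s / 2)]
    rw [← rpow_add (by positivity)]
    congr 1; push_cast; ring
  rw [abs_of_pos (by positivity), e3, mul_assoc, e4, mul_left_comm, e5, div_pow]
  field_simp

/-- Identifies the series `K` with the mean of `capPot n / V_n` over a ball of radius `a`; the
powers of `2` from the beta functions cancel in the quotient. -/
theorem greenK_eq (hn : 1 ≤ n) {a : ℝ} (ha : 0 < a) (haπ : a ≤ π) :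
    greenK n a = (sphereVol n)⁻¹ *
      ((capVol n a)⁻¹ * ∫ s in (0 : ℝ)..a, capPot n s * sin s ^ (n - 1)) := by
  have hV := sphereVol_pos n
  have hB := capVol_pos (n := n) ha haπ
  have hn0 : (0 : ℝ) < n := by exact_mod_cast hn
  rw [← ((hasSum_integral_capPot_mul hn ha haπ).mul_left (capVol n a)⁻¹).tsum_eq, greenK,
    incompleteBeta_sin_half_sq hn 0 (by simp) ha haπ, capMoment_zero, ← tsum_mul_left,
    ← tsum_mul_left]
  refine tsum_congr fun k => ?_
  rw [incompleteBeta_sin_half_sq hn (k + 1) (by push_cast; ring) ha haπ]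
  field_simp

end Series

/-! ### Comparison of the ball mean with the value at the centre. -/

section Main
open Real Filter

variable {n : ℕ}

theorem intervalIntegrable_capPot_add_mul {a : ℝ} (ha : 0 < a) (haπ : a ≤ π) (c : ℝ) :
    IntervalIntegrable (fun s => (c + capPot n s) * sin s ^ (n - 1)) volume 0 a ∧
    ∫ s in (0 : ℝ)..a, (c + capPot n s) * sin s ^ (n - 1) =
      c * capVol n a + ∫ s in (0 : ℝ)..a, capPot n s * sin s ^ (n - 1) := by
  have h1 : IntervalIntegrable (fun s => c * sin s ^ (n - 1)) volume 0 a :=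
    ((continuous_sin_pow _).const_mul _).intervalIntegrable _ _
  have h2 : IntervalIntegrable (fun s => capPot n s * sin s ^ (n - 1)) volume 0 a :=
    (intervalIntegrable_capPot_mul n).mono_set (by
      rw [Set.uIcc_of_le ha.le, Set.uIcc_of_le pi_pos.le]
      exact Set.Icc_subset_Icc_right haπ)
  simp_rw [add_mul]
  exact ⟨h1.add h2, by
    rw [intervalIntegral.integral_add h1 h2, intervalIntegral.integral_const_mul, capVol]⟩

theorem integral_shellKernel_le {θ : ℝ} (hθ : θ ∈ Set.Ioc 0 π) {a : ℝ} (ha : 0 < a)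
    (haπ : a ≤ π) :
    ∫ s in (0 : ℝ)..a, shellKernel n θ s * sin s ^ (n - 1) ≤
      capPot n (π - θ) * capVol n a + ∫ s in (0 : ℝ)..a, capPot n s * sin s ^ (n - 1) := by
  have h := intervalIntegrable_capPot_add_mul (n := n) ha haπ (capPot n (π - θ))
  rw [← h.2]
  refine intervalIntegral.integral_mono_on_of_le_Ioo ha.le
    ((intervalIntegrable_shellKernel ⟨hθ.1.le, hθ.2⟩).mono_set (by
      rw [Set.uIcc_of_le ha.le, Set.uIcc_of_le pi_pos.le]
      exact Set.Icc_subset_Icc_right haπ)) h.1 fun s hs => ?_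
  have hs' : s ∈ Set.Ioo 0 π := ⟨hs.1, hs.2.trans_le haπ⟩
  exact mul_le_mul_of_nonneg_right (shellKernel_le hθ hs') (sin_pow_pos hs' _).le

theorem integral_shellKernel_of_le {θ : ℝ} (hθ : θ ≤ π) {a : ℝ} (ha : 0 < a) (haθ : a ≤ θ) :
    ∫ s in (0 : ℝ)..a, shellKernel n θ s * sin s ^ (n - 1) =
      capPot n (π - θ) * capVol n a + ∫ s in (0 : ℝ)..a, capPot n s * sin s ^ (n - 1) := by
  rw [← (intervalIntegrable_capPot_add_mul (n := n) ha (haθ.trans hθ) (capPot n (π - θ))).2]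
  refine intervalIntegral.integral_congr fun s hs => ?_
  rw [Set.uIcc_of_le ha.le] at hs
  simp only [shellKernel_of_le (hs.2.trans haθ)]

/-- The mean of the Green function over a geodesic ball, through the shell kernel. -/
theorem mean_greenFunction (hn : 1 ≤ n) {p p₀ : UnitSphere n} (hp : p ≠ p₀) {a : ℝ} (ha : 0 < a)
    (haπ : a ≤ π) :
    1 / (sphereMeasure n).real (geodesicBall p₀ a) *
        ∫ q in geodesicBall p₀ a, greenFunction n p q ∂(sphereMeasure n) =
      (sphereVol n)⁻¹ * ((capVol n a)⁻¹ *
        ∫ s in (0 : ℝ)..a, shellKernel n (sphereDist p p₀) s * sin s ^ (n - 1)) - zonalMean n := by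
  have hV := sphereVol_pos n
  have hB := capVol_pos (n := n) ha haπ
  have hBπ := capVol_pos (n := n) pi_pos le_rfl
  have hcongr : ∫ q in geodesicBall p₀ a, greenFunction n p q ∂(sphereMeasure n) =
      ∫ q in geodesicBall p₀ a, (zonalKernel p q - zonalMean n) ∂(sphereMeasure n) :=
    integral_congr_ae (ae_restrict_of_ae (by
      filter_upwards [ae_ne_sphere hn p] with q hq using greenFunction_eq hn hq))
  rw [hcongr, integral_sub (integrable_zonalKernel hn p).integrableOn (integrable_const _),
    setIntegral_const, setIntegral_geodesicBall_zonalKernel hn hp ha haπ,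
    measureReal_geodesicBall hn p₀ ha.le haπ, smul_eq_mul]
  field_simp

theorem add_greenK_eq (hn : 1 ≤ n) {p p₀ : UnitSphere n} (hp : p ≠ p₀) {a : ℝ} (ha : 0 < a)
    (haπ : a ≤ π) :
    greenFunction n p p₀ + greenK n a = (sphereVol n)⁻¹ * ((capVol n a)⁻¹ *
      (capPot n (π - sphereDist p p₀) * capVol n a +
        ∫ s in (0 : ℝ)..a, capPot n s * sin s ^ (n - 1))) - zonalMean n := by
  have hB := capVol_pos (n := n) ha haπ
  rw [greenFunction_eq hn hp.symm, greenK_eq hn ha haπ, zonalKernel]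
  field_simp
  ring

end Main

end

theorem mainTheorem5 (n : ℕ) (hn : 1 ≤ n) (p p₀ : UnitSphere n) (a : ℝ) (ha : 0 < a)
    (haπ : a ≤ Real.pi) :
    IntegrableOn (greenFunction n p) (geodesicBall p₀ a) (sphereMeasure n) ∧
    (p ≠ p₀ →
      1 / (sphereMeasure n).real (geodesicBall p₀ a) *
          ∫ q in geodesicBall p₀ a, greenFunction n p q ∂(sphereMeasure n) ≤
        greenFunction n p p₀ + greenK n a) ∧
    (p ∉ geodesicBall p₀ a →
      1 / (sphereMeasure n).real (geodesicBall p₀ a) *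
          ∫ q in geodesicBall p₀ a, greenFunction n p q ∂(sphereMeasure n) =
        greenFunction n p p₀ + greenK n a) := by
  refine ⟨((isGreenFunction_greenFunction hn).integrable p).integrableOn, fun hp => ?_,
    fun hp => ?_⟩
  · rw [mean_greenFunction hn hp ha haπ, add_greenK_eq hn hp ha haπ]
    have hV := sphereVol_pos n
    have hB := capVol_pos (n := n) ha haπ
    gcongr
    exact integral_shellKernel_le ⟨sphereDist_pos hp, (sphereDist_mem_Icc p p₀).2⟩ ha haπ
  -- Since `a > 0`, a point outside the ball differs from the centre; every shell then has radius at
  -- most `θ`, where the bound on the shell kernel is an equality.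
  · have hne : p ≠ p₀ := by
      rintro rfl
      exact hp (by simpa [geodesicBall, sphereDist_self] using ha)
    have hle : a ≤ sphereDist p p₀ := by
      rw [sphereDist_comm]
      exact not_lt.1 hp
    rw [mean_greenFunction hn hne ha haπ, add_greenK_eq hn hne ha haπ,
      integral_shellKernel_of_le (sphereDist_mem_Icc p p₀).2 ha hle]
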